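/- Let $\Gamma=\{(\tau,\xi)\in\mathbb R\times\mathbb R^2: 1+\tau^2=|\xi|^2\}$ be the one-sheeted hyperboloid, with the Lorentz-invariant measure $$\int_\Gamma f\,d\sigma=\int_{\{|\xi|>1\}}\bigl(f(-\sqrt{|\xi|^2-1},\xi)+f(\sqrt{|\xi|^2-1},\xi)\bigr)\frac{d\xi}{\sqrt{|\xi|^2-1}},$$ and let $\mathcal E f(t,x)=\int_\Gamma e^{i(t,x)\cdot(\tau,\xi)}f(\tau,\xi)\,d\sigma(\tau,\xi)$ for $(t,x)\in\mathbb R\times\mathbb R^2$. For $N\ge 0$ let $\Gamma_N=\{(\tau,\xi)\in\Gamma: 2^N\le|\xi|<2^{N+1}\}$. For exponents $p,q\in[1,\infty]$, say that - $\mathcal R^*(p\to q)$ holds if there is a constant $C<\infty$ such that $\|\mathcal E f\|_{L^q(\mathbb R^3)}\le C\|f\|_{L^p(\Gamma;d\sigma)}$ for all complex-valued $f\in C_c^\infty(\mathbb R^3)$; - $\mathcal R^*_{ann}(p\to q)$ holds if there is a constant $C<\infty$ such that $\|\mathcal E f\|_{L^q(\mathbb R^3)}\le C\|f\|_{L^p(\Gamma;d\sigma)}$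 for all integers $N\ge1$ and all measurable complex-valued $f\in L^p(\Gamma;d\sigma)$ supported on $\Gamma_N$. Write $r'$ for the Hölder conjugate of $r\in[1,\infty]$. **Lemma.** Let $p_0,q_0$ satisfy $q_0\ge 2$ and $(\tfrac{q_0}2)'\le p_0\le q_0$, and suppose that $\mathcal R^*_{ann}(p_0\to q_0)$ holds. Then $\mathcal R^*(p\to q)$ holds for all $q>q_0$ (including $q=\infty$) and $p\in[1,\infty]$ with $p'=\tfrac{p_0'}{q_0}\,q$. -/

import Mathlib

open MeasureTheory
open scoped ENNReal NNReal ContDiff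

namespace HypHyp

noncomputable section

/-- Space-time `ℝ^{1+2}`, with points written `(τ, ξ)` on the frequency side and `(t, x)` on the
physical side. -/
abbrev SpaceTime : Type := ℝ × EuclideanSpace ℝ (Fin 2)

/-- The one-sheeted hyperboloid `{(τ, ξ) : 1 + τ² = |ξ|²}`. -/
def hyperboloid : Set SpaceTime := {z | 1 + z.1 ^ 2 = ‖z.2‖ ^ 2}

/-- The bracket `√(|ξ|² - 1)`, used for `|ξ| ≥ 1`. -/
def bracket (ξ : EuclideanSpace ℝ (Fin 2)) : ℝ := Real.sqrt (‖ξ‖ ^ 2 - 1)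

/-- The measure `dξ / √(|ξ|² - 1)` on `{|ξ| > 1} ⊆ ℝ²`. -/
def planeMeasure : Measure (EuclideanSpace ℝ (Fin 2)) :=
  (volume.restrict {ξ | 1 < ‖ξ‖}).withDensity (fun ξ => ENNReal.ofReal (1 / bracket ξ))

/-- The Lorentz-invariant (affine surface) measure on the hyperboloid, as a measure on space-time:
`∫ f dσ = ∫_{|ξ| > 1} (f(-√(|ξ|²-1), ξ) + f(√(|ξ|²-1), ξ)) dξ / √(|ξ|²-1)`. -/
def sigma : Measure SpaceTime :=
  planeMeasure.map (fun ξ => (-bracket ξ, ξ)) + planeMeasure.map (fun ξ => (bracket ξ, ξ))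

/-- The Euclidean pairing `(t, x) · (τ, ξ) = t τ + x · ξ`. -/
def pairing (y z : SpaceTime) : ℝ := y.1 * z.1 + inner ℝ y.2 z.2

/-- The Fourier extension operator `ℰ f (t, x) = ∫ e^{i (t, x) · (τ, ξ)} f(τ, ξ) dσ(τ, ξ)`. -/
def extension (f : SpaceTime → ℂ) (y : SpaceTime) : ℂ :=
  ∫ z, Complex.exp (Complex.I * (pairing y z : ℂ)) * f z ∂sigma

/-- The dyadic annulus (frustum) of the hyperboloid on which `2^N ≤ |ξ| < 2^(N+1)`. -/
def annulus (N : ℕ) : Set SpaceTime :=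
  {z | z ∈ hyperboloid ∧ (2 : ℝ) ^ N ≤ ‖z.2‖ ∧ ‖z.2‖ < (2 : ℝ) ^ (N + 1)}

/-- The global extension estimate `ℛ*(p → q)`. -/
def GlobalExtension (p q : ℝ≥0∞) : Prop :=
  ∃ C : ℝ≥0, ∀ f : SpaceTime → ℂ, ContDiff ℝ ∞ f → HasCompactSupport f →
    eLpNorm (extension f) q volume ≤ C * eLpNorm f p sigma

/-- The uniform extension estimate on dyadic annuli `ℛ*_ann(p → q)`: the constant does not depend
on `N ≥ 1`. -/
def AnnularExtension (p q : ℝ≥0∞) : Prop :=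
  ∃ C : ℝ≥0, ∀ N : ℕ, 1 ≤ N → ∀ f : SpaceTime → ℂ, Measurable f →
    Function.support f ⊆ annulus N → MemLp f p sigma →
    eLpNorm (extension f) q volume ≤ C * eLpNorm f p sigma

end

end HypHyp

open MeasureTheory
open scoped ENNReal NNReal ContDiff

namespace HypHyp

/-! Put β = q₀/p₀'. The hypothesis `(q₀/2)' ≤ p₀ ≤ q₀` says 2 ≤ β ≤ q₀ − 1, and the target exponents
satisfy q − β = q/p. For f bounded by the indicator of a set of measure m inside one annulus, the
annular estimate reads ∫ (|ℰf|/m)^q₀ ≲ m^(−β) (`annular_moment`). Testing this on a full dyadic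
sector near the origin forces β ≤ 3 (`scaling_condition`).

The annuli are summed by a bilinear argument. The group speed |ξ|/√(|ξ|²−1) exceeds 1 by about
1/(2|ξ|²), so the lower of two well separated frequencies travels faster, by a margin that grows
with the square of the difference of the slopes (`phase_deriv_lower_bound`). This transversality
bounds the density of the convolution of the measures on two sectors (`lintegral_sectorPairs_le`),
hence an L² norm by Plancherel; pairs with nearly equal slopes carry little mass and are absorbed
pointwise. The result is an L⁴ bound for the product of two extensions with a gain 2^(−|N−M|)
(`lintegral_product_pow_four_le`).

Since |ℰf|/m ≤ 1 and q > q₀, Hölder interpolation of this gain with the annular bounds gives an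
L^(q/2) estimate for products that decays both in |N−M| and in the ratio of the two measures
(`exists_bilinear_bound`). A general f is cut into pieces by scale and by height; the condition q −
β = q/p turns the estimate into decay off the diagonal of the lattice of scales and heights, and the
inclusion ℓ^p ⊆ ℓ^q finishes the sum (`sector_extension`).

This treats one quarter of the upper sheet over |ξ| ≥ 2. Reflections give all of |ξ| ≥ 2, and
Lorentz boosts move the remaining compact part into that region (`Admissible.univ_of_sectors`).
Invariance of σ comes from viewing it as the cone measure of the Lorentz unit ball
(`lintegral_cone`). -/

/-! ### Basic properties of σ and of the extension operator. -/

abbrev Plane : Type := EuclideanSpace ℝ (Fin 2)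

instance : (volume : Measure SpaceTime).IsAddHaarMeasure :=
  inferInstanceAs ((volume : Measure ℝ).prod (volume : Measure Plane)).IsAddHaarMeasure

instance : (volume : Measure SpaceTime).IsNegInvariant :=
  Measure.IsAddHaarMeasure.isNegInvariant_of_regular volume

lemma continuous_bracket : Continuous bracket := by
  unfold bracket; fun_prop

lemma measurable_bracket : Measurable bracket := continuous_bracket.measurable

instance : SFinite planeMeasure := by unfold planeMeasure; infer_instance

instance : SFinite sigma := by unfold sigma; infer_instance

lemma continuous_pairing : Continuous fun p : SpaceTime × SpaceTime => pairing p.1 p.2 := by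
  unfold pairing; fun_prop

lemma measurableSet_hyperboloid : MeasurableSet hyperboloid := by
  have : IsClosed hyperboloid := by
    unfold hyperboloid
    exact isClosed_eq (by fun_prop) (by fun_prop)
  exact this.measurableSet

lemma lintegral_planeMeasure {g : Plane → ℝ≥0∞} (hg : Measurable g) :
    ∫⁻ ξ, g ξ ∂planeMeasure =
      ∫⁻ ξ in {ξ : Plane | 1 < ‖ξ‖}, ENNReal.ofReal (1 / bracket ξ) * g ξ := by
  unfold planeMeasure
  rw [lintegral_withDensity_eq_lintegral_mul _ _ hg]
  · rfl
  · exact (measurable_const.div measurable_bracket).ennreal_ofReal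

lemma lintegral_sigma {g : SpaceTime → ℝ≥0∞} (hg : Measurable g) :
    ∫⁻ z, g z ∂sigma = ∫⁻ ξ, g (-bracket ξ, ξ) ∂planeMeasure
      + ∫⁻ ξ, g (bracket ξ, ξ) ∂planeMeasure := by
  have h := measurable_bracket
  unfold sigma
  rw [lintegral_add_measure, lintegral_map hg (by fun_prop), lintegral_map hg (by fun_prop)]

lemma bracket_sq {ξ : Plane} (h : 1 ≤ ‖ξ‖) : bracket ξ ^ 2 = ‖ξ‖ ^ 2 - 1 := by
  unfold bracket
  rw [Real.sq_sqrt]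
  nlinarith

lemma bracket_nonneg (ξ : Plane) : 0 ≤ bracket ξ := Real.sqrt_nonneg _

lemma bracket_pos {ξ : Plane} (h : 1 < ‖ξ‖) : 0 < bracket ξ := by
  unfold bracket
  apply Real.sqrt_pos.2
  nlinarith

lemma sigma_compl_hyperboloid : sigma hyperboloidᶜ = 0 := by
  rw [← lintegral_indicator_one measurableSet_hyperboloid.compl,
    lintegral_sigma (measurable_one.indicator measurableSet_hyperboloid.compl)]
  have h := measurable_bracket
  have hm : Measurable (hyperboloidᶜ.indicator (1 : SpaceTime → ℝ≥0∞)) :=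
    measurable_one.indicator measurableSet_hyperboloid.compl
  rw [lintegral_planeMeasure (g := fun ξ => hyperboloidᶜ.indicator 1 (-bracket ξ, ξ))
      (hm.comp (by fun_prop)),
    lintegral_planeMeasure (g := fun ξ => hyperboloidᶜ.indicator 1 (bracket ξ, ξ))
      (hm.comp (by fun_prop))]
  have hs : MeasurableSet {ξ : Plane | 1 < ‖ξ‖} := measurableSet_lt (by fun_prop) (by fun_prop)
  have key : ∀ ξ ∈ {ξ : Plane | 1 < ‖ξ‖}, (-bracket ξ, ξ) ∈ hyperboloid ∧
      (bracket ξ, ξ) ∈ hyperboloid := by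
    intro ξ hξ
    have := bracket_sq (ξ := ξ) (le_of_lt hξ)
    simp [hyperboloid, this]
  have e1 := setLIntegral_congr_fun (μ := (volume : Measure Plane)) hs (g := 0)
    (f := fun ξ => ENNReal.ofReal (1 / bracket ξ) * hyperboloidᶜ.indicator 1 (-bracket ξ, ξ))
    (fun ξ hξ => by simp [(key ξ hξ).1])
  have e2 := setLIntegral_congr_fun (μ := (volume : Measure Plane)) hs (g := 0)
    (f := fun ξ => ENNReal.ofReal (1 / bracket ξ) * hyperboloidᶜ.indicator 1 (bracket ξ, ξ))
    (fun ξ hξ => by simp [(key ξ hξ).2])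
  rw [e1, e2]
  simp

lemma ae_mem_hyperboloid : ∀ᵐ z ∂sigma, z ∈ hyperboloid := by
  rw [ae_iff]; exact sigma_compl_hyperboloid

lemma norm_cexp_I_mul (t : ℝ) : ‖Complex.exp (Complex.I * (t : ℂ))‖ = 1 := by
  rw [mul_comm]; exact Complex.norm_exp_ofReal_mul_I t

lemma enorm_extension_le (f : SpaceTime → ℂ) (y : SpaceTime) :
    ‖extension f y‖ₑ ≤ ∫⁻ z, ‖f z‖ₑ ∂sigma := by
  unfold extension
  refine (enorm_integral_le_lintegral_enorm _).trans (le_of_eq ?_)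
  refine lintegral_congr fun z => ?_
  rw [enorm_mul]
  have : ‖Complex.exp (Complex.I * (pairing y z : ℂ))‖ₑ = 1 := by
    rw [← ofReal_norm, norm_cexp_I_mul]; simp
  rw [this, one_mul]

lemma measurable_extension {f : SpaceTime → ℂ} (hf : Measurable f) :
    Measurable (extension f) := by
  have h : StronglyMeasurable (Function.uncurry fun y z : SpaceTime =>
      Complex.exp (Complex.I * (pairing y z : ℂ)) * f z) := by
    refine Measurable.stronglyMeasurable ?_
    refine Measurable.mul ?_ (hf.comp measurable_snd)
    have := continuous_pairing
    have h2 : Continuous fun p : SpaceTime × SpaceTime =>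
      Complex.exp (Complex.I * (pairing p.1 p.2 : ℂ)) := by fun_prop
    exact h2.measurable
  exact (h.integral_prod_right (ν := sigma)).measurable

lemma integrable_cexp_mul {f : SpaceTime → ℂ} (hf : Integrable f sigma) (y : SpaceTime) :
    Integrable (fun z => Complex.exp (Complex.I * (pairing y z : ℂ)) * f z) sigma := by
  refine hf.bdd_mul (c := 1) ?_ ?_
  · have := continuous_pairing
    have h2 : Continuous fun z : SpaceTime =>
      Complex.exp (Complex.I * (pairing y z : ℂ)) := by fun_prop
    exact h2.aestronglyMeasurable
  · exact Filter.Eventually.of_forall fun z => (norm_cexp_I_mul _).le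

lemma extension_add {f g : SpaceTime → ℂ} (hf : Integrable f sigma) (hg : Integrable g sigma)
    (y : SpaceTime) : extension (f + g) y = extension f y + extension g y := by
  unfold extension
  rw [← integral_add (integrable_cexp_mul hf y) (integrable_cexp_mul hg y)]
  simp [mul_add]

/-! ### Slope coordinates on the plane. -/

lemma lintegral_plane {h : Plane → ℝ≥0∞} (hh : Measurable h) :
    ∫⁻ ξ, h ξ = ∫⁻ x : ℝ, ∫⁻ y : ℝ, h !₂[x, y] := by
  rw [← (EuclideanSpace.volume_preserving_symm_measurableEquiv_toLp (Fin 2)).symm.lintegral_comp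
    hh, ← (volume_preserving_finTwoArrow ℝ).symm.lintegral_comp (by fun_prop)]
  rw [Measure.volume_eq_prod, lintegral_prod _ (by fun_prop)]
  rfl

lemma lintegral_comp_mul_left_real {h : ℝ → ℝ≥0∞} {x : ℝ} (hx : 0 < x) :
    ∫⁻ y, h y = ENNReal.ofReal x * ∫⁻ s, h (x * s) := by
  have e : MeasurableEmbedding fun s : ℝ => x * s :=
    (Homeomorph.mulLeft₀ x hx.ne').measurableEmbedding
  rw [← e.lintegral_map h, Real.map_volume_mul_left hx.ne', lintegral_smul_measure, smul_eq_mul,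
    ← mul_assoc, ← ENNReal.ofReal_mul hx.le, abs_of_pos (inv_pos.2 hx), mul_inv_cancel₀ hx.ne']
  simp

/-- The substitution ξ = (x, xs) has Jacobian x. Slopes replace angles because the time frequency is
algebraic along the rays of fixed s. -/
lemma lintegral_plane_slope {h : Plane → ℝ≥0∞} (hh : Measurable h)
    (h0 : ∀ ξ : Plane, ξ 0 ≤ 0 → h ξ = 0) :
    ∫⁻ ξ, h ξ = ∫⁻ s : ℝ, ∫⁻ x in Set.Ioi (0 : ℝ), ENNReal.ofReal x * h !₂[x, x * s] := by
  have hm : Measurable fun p : ℝ × ℝ => h !₂[p.1, p.1 * p.2] := by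
    apply hh.comp
    apply Continuous.measurable
    fun_prop
  have hsw := lintegral_lintegral_swap (μ := (volume : Measure ℝ))
    (ν := (volume : Measure ℝ).restrict (Set.Ioi 0))
    (f := fun s x => ENNReal.ofReal x * h !₂[x, x * s])
    (((by fun_prop : Measurable fun p : ℝ × ℝ => ENNReal.ofReal p.2).mul
      (hm.comp measurable_swap)).aemeasurable)
  rw [lintegral_plane hh, hsw, ← lintegral_indicator measurableSet_Ioi]
  refine lintegral_congr fun x => ?_
  by_cases hx : 0 < x
  · rw [Set.indicator_of_mem (by exact hx), lintegral_comp_mul_left_real hx,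
      lintegral_const_mul _ (by fun_prop)]
  · rw [Set.indicator_of_notMem (by exact hx)]
    simp [h0 _ (show (!₂[x, _] : Plane) 0 ≤ 0 by simpa using hx)]

/-! ### Plancherel inequality by Gaussian regularization. -/

/-- The Gaussian weight on space-time. -/
noncomputable def gauss (b : ℝ) (y : SpaceTime) : ℝ :=
  Real.exp (-b * y.1 ^ 2) * Real.exp (-b * ‖y.2‖ ^ 2)

lemma gauss_pos (b : ℝ) (y : SpaceTime) : 0 < gauss b y := by
  unfold gauss; positivity

lemma continuous_gauss (b : ℝ) : Continuous (gauss b) := by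
  unfold gauss; fun_prop

lemma integral_gauss_plane {b : ℝ} (hb : 0 < b) :
    Integrable (fun v : Plane => Real.exp (-b * ‖v‖ ^ 2)) ∧
      ∫ v : Plane, Real.exp (-b * ‖v‖ ^ 2) = Real.pi / b := by
  have h1 := GaussianFourier.integrable_cexp_neg_mul_sq_norm_add (V := Plane) (b := (b : ℂ))
    (by simpa using hb) 0 0
  have h2 := GaussianFourier.integral_cexp_neg_mul_sq_norm_add (V := Plane) (b := (b : ℂ))
    (by simpa using hb) 0 0
  have e : ∀ v : Plane, Complex.exp (-b * ↑‖v‖ ^ 2 + 0 * ↑(inner ℝ 0 v)) =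
      ((Real.exp (-b * ‖v‖ ^ 2) : ℝ) : ℂ) := by
    intro v; push_cast; congr 1; ring
  simp_rw [e] at h1 h2
  refine ⟨by simpa only [RCLike.ofReal_re] using! h1.re, ?_⟩
  rw [integral_complex_ofReal] at h2
  have h3 : ((∫ v : Plane, Real.exp (-b * ‖v‖ ^ 2) : ℝ) : ℂ) = ((Real.pi / b : ℝ) : ℂ) := by
    rw [h2]; simp
  exact_mod_cast h3

lemma integrable_gauss {b : ℝ} (hb : 0 < b) : Integrable (gauss b) := by
  unfold gauss
  rw [Measure.volume_eq_prod]
  exact (integrable_exp_neg_mul_sq hb).mul_prod (integral_gauss_plane hb).1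

lemma integral_gauss {b : ℝ} (hb : 0 < b) :
    ∫ y, gauss b y = √(Real.pi / b) * (Real.pi / b) := by
  unfold gauss
  rw [Measure.volume_eq_prod, integral_prod_mul (fun t : ℝ => Real.exp (-b * t ^ 2))
    (fun v : Plane => Real.exp (-b * ‖v‖ ^ 2)), integral_gaussian, (integral_gauss_plane hb).2]

lemma integral_gauss_mul_cexp {b : ℝ} (hb : 0 < b) (u : SpaceTime) :
    ∫ y, (gauss b y : ℂ) * Complex.exp (Complex.I * (pairing y u : ℂ)) =
      ((√(Real.pi / b) * (Real.pi / b) * gauss (1 / (4 * b)) u : ℝ) : ℂ) := by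
  have h1 := GaussianFourier.integral_cexp_neg_mul_sq_norm_add (V := Plane) (b := (b : ℂ))
    (by simpa using hb) Complex.I u.2
  have h0 := GaussianFourier.integral_cexp_neg_mul_sq_norm_add (V := ℝ) (b := (b : ℂ))
    (by simpa using hb) Complex.I u.1
  have : ∀ y : SpaceTime, (gauss b y : ℂ) * Complex.exp (Complex.I * (pairing y u : ℂ)) =
      Complex.exp (-b * ↑‖y.1‖ ^ 2 + Complex.I * ↑(inner ℝ u.1 y.1)) *
      Complex.exp (-b * ↑‖y.2‖ ^ 2 + Complex.I * ↑(inner ℝ u.2 y.2)) := by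
    intro y
    unfold gauss pairing
    push_cast
    rw [← Complex.exp_add, ← Complex.exp_add, ← Complex.exp_add]
    congr 1
    rw [real_inner_comm u.2 y.2, ← Complex.ofReal_pow ‖y.1‖ 2, Real.norm_eq_abs, sq_abs]
    simp
    ring
  simp_rw [this]
  rw [Measure.volume_eq_prod, integral_prod_mul
    (fun t : ℝ => Complex.exp (-b * ↑‖t‖ ^ 2 + Complex.I * ↑(inner ℝ u.1 t)))
    (fun v : Plane => Complex.exp (-b * ↑‖v‖ ^ 2 + Complex.I * ↑(inner ℝ u.2 v))), h0, h1]
  have hs : ((Real.pi : ℂ) / b) ^ ((Module.finrank ℝ ℝ : ℂ) / 2) = ((√(Real.pi / b) : ℝ) : ℂ) := by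
    rw [Real.sqrt_eq_rpow, Complex.ofReal_cpow (by positivity)]
    simp
  rw [hs]
  unfold gauss
  have e1 : Complex.exp (Complex.I ^ 2 * ↑‖u.1‖ ^ 2 / (4 * b)) =
      ((Real.exp (-(1 / (4 * b)) * u.1 ^ 2) : ℝ) : ℂ) := by
    rw [← Complex.ofReal_pow ‖u.1‖ 2, Real.norm_eq_abs, sq_abs]
    push_cast; congr 1
    rw [Complex.I_sq]; ring
  have e2 : Complex.exp (Complex.I ^ 2 * ↑‖u.2‖ ^ 2 / (4 * b)) =
      ((Real.exp (-(1 / (4 * b)) * ‖u.2‖ ^ 2) : ℝ) : ℂ) := by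
    push_cast; congr 1
    rw [Complex.I_sq]; ring
  rw [e1, e2]
  simp
  ring

lemma pairing_sub (y u v : SpaceTime) : pairing y (u - v) = pairing y u - pairing y v := by
  simp [pairing, inner_sub_right]; ring

/-- Expanding the square turns the left side into a double integral over X × X of a positive
Gaussian kernel in T x − T x' against H(x) and the conjugate of H(x'). The factors H are dropped,
and the density bound `hA` replaces the inner integral by the total mass of the kernel, which does
not depend on b. -/
lemma lintegral_gauss_mul_enorm_sq_le {X : Type*} [MeasurableSpace X] {ν : Measure X}
    [IsFiniteMeasure ν] {T : X → SpaceTime} (hT : Measurable T) {H : X → ℂ} (hH : Measurable H)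
    (hH1 : ∀ x, ‖H x‖ ≤ 1) {A : ℝ≥0∞}
    (hA : ∀ g : SpaceTime → ℝ≥0∞, Measurable g → ∫⁻ x, g (T x) ∂ν ≤ A * ∫⁻ z, g z)
    {b : ℝ} (hb : 0 < b) :
    ∫⁻ y, ENNReal.ofReal (gauss b y) *
      ‖∫ x, Complex.exp (Complex.I * (pairing y (T x) : ℂ)) * H x ∂ν‖ₑ ^ 2
      ≤ ENNReal.ofReal (8 * Real.pi ^ 3) * A * ν Set.univ := by
  set e : SpaceTime → X → ℂ := fun y x => Complex.exp (Complex.I * (pairing y (T x) : ℂ)) * H x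
    with he
  have hem : Measurable (Function.uncurry e) := by
    have h2 : Continuous fun p : SpaceTime × SpaceTime =>
      Complex.exp (Complex.I * (pairing p.1 p.2 : ℂ)) := by
      have := continuous_pairing
      fun_prop
    exact (h2.measurable.comp (measurable_fst.prodMk (hT.comp measurable_snd))).mul
      (hH.comp measurable_snd)
  have he1 : ∀ y x, ‖e y x‖ ≤ 1 := by
    intro y x
    rw [he, norm_mul, norm_cexp_I_mul, one_mul]
    exact hH1 x
  have e_apply : ∀ y x, e y x =
      Complex.exp (Complex.I * (pairing y (T x) : ℂ)) * H x := fun _ _ => rfl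
  change ∫⁻ y, ENNReal.ofReal (gauss b y) * ‖∫ x, e y x ∂ν‖ₑ ^ 2 ≤ _
  clear_value e
  set G : SpaceTime → ℂ := fun y => ∫ x, e y x ∂ν with hG
  have hGm : Measurable G := (hem.stronglyMeasurable.integral_prod_right (ν := ν)).measurable
  have hG1 : ∀ y, ‖G y‖ ≤ ν.real Set.univ := by
    intro y
    simpa using norm_integral_le_of_norm_le_const (μ := ν) (f := e y) (C := 1)
      (Filter.Eventually.of_forall (he1 y))
  have hgi := integrable_gauss hb
  have hint : Integrable (fun y => gauss b y * ‖G y‖ ^ 2) := by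
    refine hgi.mul_bdd (c := ν.real Set.univ ^ 2) (by fun_prop) ?_
    refine Filter.Eventually.of_forall fun y => ?_
    rw [norm_pow, norm_norm]
    exact pow_le_pow_left₀ (norm_nonneg _) (hG1 y) 2
  have hΦ : Integrable (fun p : SpaceTime × X × X =>
      (gauss b p.1 : ℂ) * (e p.1 p.2.1 * (starRingEnd ℂ) (e p.1 p.2.2)))
      (volume.prod (ν.prod ν)) := by
    have h1 : Integrable (fun p : SpaceTime × X × X => gauss b p.1 * (1 : ℝ))
        (volume.prod (ν.prod ν)) := hgi.mul_prod (integrable_const 1)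
    refine h1.mono' ?_ ?_
    · have m1 : Measurable fun p : SpaceTime × X × X => (gauss b p.1 : ℂ) :=
        Complex.measurable_ofReal.comp ((continuous_gauss b).measurable.comp measurable_fst)
      have m2 : Measurable fun p : SpaceTime × X × X => e p.1 p.2.1 :=
        hem.comp (measurable_fst.prodMk (measurable_fst.comp measurable_snd))
      have m3 : Measurable fun p : SpaceTime × X × X => e p.1 p.2.2 :=
        hem.comp (measurable_fst.prodMk (measurable_snd.comp measurable_snd))
      have m4 : Measurable fun p : SpaceTime × X × X => (starRingEnd ℂ) (e p.1 p.2.2) :=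
        Complex.continuous_conj.measurable.comp m3
      exact (m1.mul (m2.mul m4)).aestronglyMeasurable
    · refine Filter.Eventually.of_forall fun p => ?_
      rw [norm_mul, norm_mul, RCLike.norm_conj, Complex.norm_real, Real.norm_of_nonneg
        (gauss_pos b _).le]
      refine mul_le_mul_of_nonneg_left ?_ (gauss_pos b _).le
      exact mul_le_one₀ (he1 _ _) (norm_nonneg _) (he1 _ _)
  set g' : SpaceTime → ℝ := fun u => √(Real.pi / b) * (Real.pi / b) * gauss (1 / (4 * b)) u
    with hg'
  have hg'0 : ∀ u, 0 ≤ g' u := fun u => by have := gauss_pos (1 / (4 * b)) u; positivity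
  have hg'c : Continuous g' := by
    have := continuous_gauss (1 / (4 * b))
    fun_prop
  have key : ((∫ y, gauss b y * ‖G y‖ ^ 2 : ℝ) : ℂ) =
      ∫ q : X × X, (g' (T q.1 - T q.2) : ℂ) * (H q.1 * (starRingEnd ℂ) (H q.2)) ∂(ν.prod ν) := by
    rw [← integral_complex_ofReal]
    have e1 : ∀ y, ((gauss b y * ‖G y‖ ^ 2 : ℝ) : ℂ) = ∫ q : X × X, (gauss b y : ℂ) *
        (e y q.1 * (starRingEnd ℂ) (e y q.2)) ∂(ν.prod ν) := by
      intro y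
      rw [integral_const_mul, integral_prod_mul (fun x => e y x)
        (fun x => (starRingEnd ℂ) (e y x)), integral_conj]
      push_cast
      rw [← Complex.mul_conj']
    simp_rw [e1]
    rw [integral_integral_swap hΦ]
    refine integral_congr_ae (Filter.Eventually.of_forall fun q => ?_)
    have e2 : ∀ y, (gauss b y : ℂ) * (e y q.1 * (starRingEnd ℂ) (e y q.2)) =
        ((gauss b y : ℂ) * Complex.exp (Complex.I * (pairing y (T q.1 - T q.2) : ℂ))) *
          (H q.1 * (starRingEnd ℂ) (H q.2)) := by
      intro y
      rw [e_apply, e_apply, pairing_sub]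
      simp only [map_mul, ← Complex.exp_conj, Complex.conj_I, Complex.conj_ofReal]
      push_cast
      rw [mul_sub, sub_eq_add_neg, Complex.exp_add]
      ring_nf
    simp_rw [e2]
    rw [integral_mul_const, integral_gauss_mul_cexp hb]
  calc ∫⁻ y, ENNReal.ofReal (gauss b y) * ‖G y‖ₑ ^ 2
      = ∫⁻ y, ENNReal.ofReal (gauss b y * ‖G y‖ ^ 2) := by
        refine lintegral_congr fun y => ?_
        rw [ENNReal.ofReal_mul (gauss_pos b y).le, ENNReal.ofReal_pow (norm_nonneg _), ofReal_norm]
    _ = ENNReal.ofReal (∫ y, gauss b y * ‖G y‖ ^ 2) := by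
        rw [ofReal_integral_eq_lintegral_ofReal hint]
        exact Filter.Eventually.of_forall fun y => by have := gauss_pos b y; positivity
    _ ≤ ‖((∫ y, gauss b y * ‖G y‖ ^ 2 : ℝ) : ℂ)‖ₑ := by
        rw [← ofReal_norm, Complex.norm_real]
        exact ENNReal.ofReal_le_ofReal (le_abs_self _)
    _ ≤ ∫⁻ q : X × X, ENNReal.ofReal (g' (T q.1 - T q.2)) ∂(ν.prod ν) := by
        rw [key]
        refine (enorm_integral_le_lintegral_enorm _).trans (lintegral_mono fun q => ?_)
        rw [← ofReal_norm]
        refine ENNReal.ofReal_le_ofReal ?_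
        rw [norm_mul, norm_mul, RCLike.norm_conj, Complex.norm_real,
          Real.norm_of_nonneg (hg'0 _)]
        exact mul_le_of_le_one_right (hg'0 _) (mul_le_one₀ (hH1 _) (norm_nonneg _) (hH1 _))
    _ = ∫⁻ x, ∫⁻ x', ENNReal.ofReal (g' (T x - T x')) ∂ν ∂ν := by
        rw [lintegral_prod]
        exact (hg'c.measurable.comp ((hT.comp measurable_fst).sub
          (hT.comp measurable_snd))).ennreal_ofReal.aemeasurable
    _ ≤ ∫⁻ x, (A * ∫⁻ u : SpaceTime, ENNReal.ofReal (g' (T x - u))) ∂ν := by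
        refine lintegral_mono fun x => ?_
        exact hA (fun u => ENNReal.ofReal (g' (T x - u)))
          (hg'c.measurable.comp (measurable_const.sub measurable_id)).ennreal_ofReal
    _ = ∫⁻ _x, A * ENNReal.ofReal (8 * Real.pi ^ 3) ∂ν := by
        refine lintegral_congr fun x => ?_
        congr 1
        rw [lintegral_sub_left_eq_self (fun u => ENNReal.ofReal (g' u)) (T x),
          ← ofReal_integral_eq_lintegral_ofReal]
        · congr 1
          rw [hg', integral_const_mul, integral_gauss (by positivity)]
          -- The widths b and 1/(4b) are dual, so b cancels and the total mass is (2π)³.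
          have h1 : √(Real.pi / b) * √(Real.pi / (1 / (4 * b))) = 2 * Real.pi := by
            rw [← Real.sqrt_mul (by positivity), show Real.pi / b * (Real.pi / (1 / (4 * b))) =
              (2 * Real.pi) ^ 2 by field_simp; ring, Real.sqrt_sq (by positivity)]
          calc _ = (√(Real.pi / b) * √(Real.pi / (1 / (4 * b)))) * (Real.pi / b *
              (Real.pi / (1 / (4 * b)))) := by ring
            _ = _ := by rw [h1]; field_simp; ring
        · exact (integrable_gauss (by positivity)).const_mul _
        · exact Filter.Eventually.of_forall hg'0
    _ = _ := by rw [lintegral_const]; ring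

lemma tendsto_gauss (y : SpaceTime) :
    Filter.Tendsto (fun n : ℕ => ENNReal.ofReal (gauss (1 / ((n : ℝ) + 1)) y)) Filter.atTop
      (nhds 1) := by
  have h0 := tendsto_one_div_add_atTop_nhds_zero_nat (𝕜 := ℝ)
  have hc : Continuous fun b : ℝ => ENNReal.ofReal (gauss b y) := by
    unfold gauss
    exact ENNReal.continuous_ofReal.comp (by fun_prop)
  have := (hc.tendsto 0).comp h0
  simpa [gauss, Function.comp_def] using this

/-- If the image of `ν` under `T` has density at most `A`, then the Fourier transform of the image
of `H ν`, `|H| ≤ 1`, is square integrable. -/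
lemma lintegral_enorm_sq_le_of_density {X : Type*} [MeasurableSpace X] {ν : Measure X}
    [IsFiniteMeasure ν] {T : X → SpaceTime} (hT : Measurable T) {H : X → ℂ} (hH : Measurable H)
    (hH1 : ∀ x, ‖H x‖ ≤ 1) {A : ℝ≥0∞}
    (hA : ∀ g : SpaceTime → ℝ≥0∞, Measurable g → ∫⁻ x, g (T x) ∂ν ≤ A * ∫⁻ z, g z) :
    ∫⁻ y, ‖∫ x, Complex.exp (Complex.I * (pairing y (T x) : ℂ)) * H x ∂ν‖ₑ ^ 2
      ≤ ENNReal.ofReal (8 * Real.pi ^ 3) * A * ν Set.univ := by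
  set G : SpaceTime → ℂ := fun y => ∫ x, Complex.exp (Complex.I * (pairing y (T x) : ℂ)) * H x ∂ν
    with hG
  have hem : Measurable (Function.uncurry fun (y : SpaceTime) (x : X) =>
      Complex.exp (Complex.I * (pairing y (T x) : ℂ)) * H x) := by
    have h2 : Continuous fun p : SpaceTime × SpaceTime =>
      Complex.exp (Complex.I * (pairing p.1 p.2 : ℂ)) := by
      have := continuous_pairing
      fun_prop
    exact (h2.measurable.comp (measurable_fst.prodMk (hT.comp measurable_snd))).mul
      (hH.comp measurable_snd)
  have hGm : Measurable G := (hem.stronglyMeasurable.integral_prod_right (ν := ν)).measurable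
  have hlim : ∀ y, Filter.liminf (fun n : ℕ => ENNReal.ofReal (gauss (1 / ((n : ℝ) + 1)) y) *
      ‖G y‖ₑ ^ 2) Filter.atTop = ‖G y‖ₑ ^ 2 := by
    intro y
    have := ENNReal.Tendsto.mul_const (b := ‖G y‖ₑ ^ 2) (tendsto_gauss y) (Or.inl one_ne_zero)
    rw [one_mul] at this
    exact this.liminf_eq
  -- Fatou along b = 1/(n+1) → 0; the weighted bound is uniform in b.
  calc ∫⁻ y, ‖G y‖ₑ ^ 2 = ∫⁻ y, Filter.liminf (fun n : ℕ =>
        ENNReal.ofReal (gauss (1 / ((n : ℝ) + 1)) y) * ‖G y‖ₑ ^ 2) Filter.atTop :=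
        lintegral_congr fun y => (hlim y).symm
    _ ≤ Filter.liminf (fun n : ℕ => ∫⁻ y, ENNReal.ofReal (gauss (1 / ((n : ℝ) + 1)) y) *
        ‖G y‖ₑ ^ 2) Filter.atTop := by
        refine lintegral_liminf_le fun n => ?_
        exact (continuous_gauss _).measurable.ennreal_ofReal.mul (hGm.enorm.pow_const 2)
    _ ≤ _ := by
        refine Filter.liminf_le_of_frequently_le' (Filter.Frequently.of_forall fun n => ?_)
        exact lintegral_gauss_mul_enorm_sq_le hT hH hH1 hA (by positivity)

/-! ### Dyadic sectors. -/

/-- The slope `ξ₂ / ξ₁` of a frequency. -/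
noncomputable def slope (ξ : Plane) : ℝ := ξ 1 / ξ 0

/-- The restriction to a quarter of the plane keeps slopes in [−1, 1] and makes ξ₁ comparable to
|ξ|. -/
def planeSector (N : ℕ) : Set Plane :=
  {ξ | (2 : ℝ) ^ N ≤ ‖ξ‖ ∧ ‖ξ‖ < (2 : ℝ) ^ (N + 1) ∧ |ξ 1| ≤ ξ 0}

/-- The part of the dyadic annulus on the upper sheet over the sector `|ξ₂| ≤ ξ₁`. -/
def sector (N : ℕ) : Set SpaceTime :=
  {z | z ∈ hyperboloid ∧ 0 < z.1 ∧ z.2 ∈ planeSector N}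

lemma measurable_slope : Measurable slope := by unfold slope; fun_prop

lemma measurableSet_planeSector (N : ℕ) : MeasurableSet (planeSector N) := by
  unfold planeSector
  refine MeasurableSet.inter ?_ (MeasurableSet.inter ?_ ?_)
  · exact measurableSet_le measurable_const measurable_norm
  · exact measurableSet_lt measurable_norm measurable_const
  · exact measurableSet_le (f := fun ξ : Plane => |ξ 1|) (g := fun ξ : Plane => ξ 0)
      (by fun_prop) (by fun_prop)

lemma measurableSet_sector (N : ℕ) : MeasurableSet (sector N) := by
  unfold sector
  refine measurableSet_hyperboloid.inter (MeasurableSet.inter ?_ ?_)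
  · exact measurableSet_lt measurable_const measurable_fst
  · exact measurable_snd (measurableSet_planeSector N)

lemma sector_subset_annulus (N : ℕ) : sector N ⊆ annulus N :=
  fun _ hz => ⟨hz.1, hz.2.2.1, hz.2.2.2.1⟩

lemma norm_sq_plane (ξ : Plane) : ‖ξ‖ ^ 2 = ξ 0 ^ 2 + ξ 1 ^ 2 := by
  rw [EuclideanSpace.real_norm_sq_eq]; simp

lemma bracket_mk (x y : ℝ) : bracket !₂[x, y] = √(x ^ 2 + y ^ 2 - 1) := by
  simp [bracket, norm_sq_plane]

lemma lintegral_sigma_of_pos {h : SpaceTime → ℝ≥0∞} (hh : Measurable h)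
    (h0 : ∀ z : SpaceTime, z.1 ≤ 0 → h z = 0) (h1 : ∀ z : SpaceTime, ‖z.2‖ ≤ 1 → h z = 0) :
    ∫⁻ z, h z ∂sigma = ∫⁻ ξ, ENNReal.ofReal (1 / bracket ξ) * h (bracket ξ, ξ) := by
  have hb := measurable_bracket
  have hs : MeasurableSet {ξ : Plane | 1 < ‖ξ‖} := measurableSet_lt (by fun_prop) (by fun_prop)
  rw [lintegral_sigma hh]
  have e : ∀ ξ : Plane, h (-bracket ξ, ξ) = 0 := fun ξ => h0 _ (by simp [bracket_nonneg])
  simp only [e, lintegral_zero, zero_add]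
  rw [lintegral_planeMeasure (g := fun ξ => h (bracket ξ, ξ)) (hh.comp (by fun_prop)),
    ← lintegral_indicator hs]
  refine lintegral_congr fun ξ => ?_
  by_cases hξ : 1 < ‖ξ‖
  · rw [Set.indicator_of_mem (by exact hξ)]
  · rw [Set.indicator_of_notMem (by exact hξ), h1 _ (by simpa using hξ), mul_zero]

lemma pos_of_mem_planeSector {N : ℕ} {ξ : Plane} (h : ξ ∈ planeSector N) : 0 < ξ 0 := by
  obtain ⟨h1, -, h3⟩ := h
  rcases (abs_nonneg _).trans h3 |>.lt_or_eq with h | h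
  · exact h
  · have h4 : ξ 1 = 0 := by
      rw [← h] at h3
      exact abs_nonpos_iff.1 h3
    have := norm_sq_plane ξ
    rw [← h, h4] at this
    have h5 : (0 : ℝ) < 2 ^ N := by positivity
    nlinarith

/-! ### Transversality of two separated scales along a ray. -/

lemma le_of_sq_le_sq_of_nonneg {a b : ℝ} (h : a ^ 2 ≤ b ^ 2) (hb : 0 ≤ b) : a ≤ b := by
  by_contra hab
  push Not at hab
  nlinarith

/-- Let A = √(1+s²), R = |ξ|² and P = |η|² for ξ = (x, xs), η = (y, v). The first speed is at least
A(1 + 1/(2R)). The second is at most A(1 + 1/P)(1 − d²/8), where d is the difference of slopes and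
the last factor is the defect in Cauchy–Schwarz. Since P ≥ 4R, half of the excess 1/(2R) survives.
-/
lemma phase_deriv_lower_bound {x s y v : ℝ} (hx : 0 < x) (hs : |s| ≤ 1) (hy : 0 < y)
    (hv : |v| ≤ y) (h1 : 1 < x ^ 2 * (1 + s ^ 2)) (h2 : 4 * (x ^ 2 * (1 + s ^ 2)) ≤ y ^ 2 + v ^ 2) :
    1 / (4 * (x ^ 2 * (1 + s ^ 2))) + (s - v / y) ^ 2 / 8 ≤
      x * (1 + s ^ 2) / √(x ^ 2 * (1 + s ^ 2) - 1) - (y + s * v) / √(y ^ 2 + v ^ 2 - 1) := by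
  set A := √(1 + s ^ 2) with hA
  have hA2 : A ^ 2 = 1 + s ^ 2 := Real.sq_sqrt (by positivity)
  have hA1 : 1 ≤ A := by rw [hA]; exact Real.one_le_sqrt.2 (by nlinarith)
  set R := x ^ 2 * (1 + s ^ 2) with hR
  set P := y ^ 2 + v ^ 2 with hP
  have hP0 : 4 < P := by linarith
  set d := s - v / y with hd
  have hs2 : s ^ 2 ≤ 1 := by rw [← sq_abs]; nlinarith [abs_nonneg s]
  have hv2 : v ^ 2 ≤ y ^ 2 := by rw [← sq_abs v]; nlinarith [abs_nonneg v]
  have hT1 : 0 < √(R - 1) := Real.sqrt_pos.2 (by linarith)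
  have hT2 : 0 < √(P - 1) := Real.sqrt_pos.2 (by linarith)
  have hR0 : 0 < R := by linarith
  have e1 : A * (1 + 1 / (2 * R)) ≤ x * (1 + s ^ 2) / √(R - 1) := by
    rw [le_div_iff₀ hT1]
    have : √(R - 1) ≤ x * A / (1 + 1 / (2 * R)) := by
      rw [le_div_iff₀ (by positivity)]
      have hxA : R = (x * A) ^ 2 := by rw [mul_pow, hA2]
      refine le_of_sq_le_sq_of_nonneg ?_ (by positivity)
      rw [mul_pow, Real.sq_sqrt (by linarith), ← hxA]
      have h3 : (R - 1) * (1 + 1 / (2 * R)) ^ 2 = R - 3 / (4 * R) - 1 / (4 * R ^ 2) := by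
        field_simp; ring
      rw [h3]
      have : 0 < 3 / (4 * R) := by positivity
      have : 0 < 1 / (4 * R ^ 2) := by positivity
      linarith
    rw [le_div_iff₀ (by positivity)] at this
    calc A * (1 + 1 / (2 * R)) * √(R - 1) = A * (√(R - 1) * (1 + 1 / (2 * R))) := by ring
      _ ≤ A * (x * A) := by gcongr
      _ = x * (1 + s ^ 2) := by rw [← hA2]; ring
  have hd8 : d ^ 2 / 8 ≤ 1 / 2 := by
    have : |v / y| ≤ 1 := by
      rw [abs_div, abs_of_pos hy]; exact (div_le_one hy).2 hv
    have h3 : |d| ≤ 2 := by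
      have := abs_add_le s (-(v / y))
      rw [abs_neg, ← sub_eq_add_neg] at this
      rw [hd]
      exact this.trans (by linarith)
    rw [← sq_abs]; nlinarith [abs_nonneg d]
  -- Lagrange's identity gives (y+sv)² = A²P − (yd)², and A²P ≤ 2 · 2y² because both slopes are at
  -- most 1.
  have e2 : y + s * v ≤ A * √P * (1 - d ^ 2 / 8) := by
    refine le_of_sq_le_sq_of_nonneg ?_
      (mul_nonneg (by positivity) (by linarith))
    rw [mul_pow, mul_pow, hA2, Real.sq_sqrt (by linarith)]
    have h3 : (y + s * v) ^ 2 = (1 + s ^ 2) * P - (y * d) ^ 2 := by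
      rw [hP, hd]; field_simp; ring
    have h4 : (1 + s ^ 2) * P * (d ^ 2 / 4) ≤ (y * d) ^ 2 := by
      have : (1 + s ^ 2) * P ≤ 4 * y ^ 2 := by nlinarith
      nlinarith [sq_nonneg d]
    have h5 : 1 - d ^ 2 / 4 ≤ (1 - d ^ 2 / 8) ^ 2 := by nlinarith [sq_nonneg (d ^ 2)]
    have h6 : 0 < (1 + s ^ 2) * P := by positivity
    rw [h3]
    have h7 := mul_le_mul_of_nonneg_left h5 h6.le
    linarith
  have e3 : √P ≤ (1 + 1 / P) * √(P - 1) := by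
    refine le_of_sq_le_sq_of_nonneg ?_ (by positivity)
    rw [mul_pow, Real.sq_sqrt (by linarith), Real.sq_sqrt (by linarith)]
    have h3 : (1 + 1 / P) ^ 2 * (P - 1) = P + 1 - 1 / P - 1 / P ^ 2 := by
      field_simp; ring
    have h4 : 1 / P ≤ 1 / 4 := by gcongr
    have h5 : 1 / P ^ 2 ≤ 1 / 4 := by
      apply one_div_le_one_div_of_le (by norm_num); nlinarith
    rw [h3]; linarith
  have e4 : (y + s * v) / √(P - 1) ≤ A * (1 + 1 / P) * (1 - d ^ 2 / 8) := by
    rw [div_le_iff₀ hT2]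
    have h0 : 0 ≤ 1 - d ^ 2 / 8 := by linarith
    calc y + s * v ≤ A * √P * (1 - d ^ 2 / 8) := e2
      _ ≤ A * ((1 + 1 / P) * √(P - 1)) * (1 - d ^ 2 / 8) := by gcongr
      _ = _ := by ring
  have e5 : 1 / P ≤ 1 / (4 * R) := by gcongr
  have e6 : 1 / (2 * R) = 2 * (1 / (4 * R)) := by field_simp; norm_num
  have e7 : 0 ≤ 1 / P * (d ^ 2 / 8) := by positivity
  have e8 : 1 / (4 * R) + d ^ 2 / 8 ≤ (1 + 1 / (2 * R)) - (1 + 1 / P) * (1 - d ^ 2 / 8) := by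
    rw [e6]
    have : (1 + 1 / P) * (1 - d ^ 2 / 8) = 1 + 1 / P - d ^ 2 / 8 - 1 / P * (d ^ 2 / 8) := by ring
    linarith
  have e9 : 0 ≤ 1 / (4 * R) + d ^ 2 / 8 := by positivity
  have e10 := le_mul_of_one_le_left e9 hA1
  have e11 := mul_le_mul_of_nonneg_left e8 (zero_le_one.trans hA1)
  have e12 : A * ((1 + 1 / (2 * R)) - (1 + 1 / P) * (1 - d ^ 2 / 8)) =
    A * (1 + 1 / (2 * R)) - A * (1 + 1 / P) * (1 - d ^ 2 / 8) := by ring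
  linarith

/-- The time frequency `⟨ξ⟩ + ⟨ζ - ξ⟩` along the ray `ξ = (x, x s)`. -/
noncomputable def phase (ζ : Plane) (s x : ℝ) : ℝ :=
  √(x ^ 2 * (1 + s ^ 2) - 1) + √((ζ 0 - x) ^ 2 + (ζ 1 - x * s) ^ 2 - 1)

noncomputable def phaseDeriv (ζ : Plane) (s x : ℝ) : ℝ :=
  x * (1 + s ^ 2) / √(x ^ 2 * (1 + s ^ 2) - 1) -
    ((ζ 0 - x) + s * (ζ 1 - x * s)) / √((ζ 0 - x) ^ 2 + (ζ 1 - x * s) ^ 2 - 1)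

lemma hasDerivAt_phase {ζ : Plane} {s x : ℝ} (h1 : 0 < x ^ 2 * (1 + s ^ 2) - 1)
    (h2 : 0 < (ζ 0 - x) ^ 2 + (ζ 1 - x * s) ^ 2 - 1) :
    HasDerivAt (phase ζ s) (phaseDeriv ζ s x) x := by
  have d1 : HasDerivAt (fun x : ℝ => x ^ 2 * (1 + s ^ 2) - 1) (2 * x * (1 + s ^ 2)) x := by
    simpa using (((hasDerivAt_id x).pow 2).mul_const (1 + s ^ 2)).sub_const 1
  have d2 : HasDerivAt (fun x : ℝ => (ζ 0 - x) ^ 2 + (ζ 1 - x * s) ^ 2 - 1)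
      (-(2 * ((ζ 0 - x) + s * (ζ 1 - x * s)))) x := by
    have a := ((hasDerivAt_id x).const_sub (ζ 0)).pow 2
    have b := (((hasDerivAt_id x).mul_const s).const_sub (ζ 1)).pow 2
    refine ((a.add b).sub_const 1).congr_deriv ?_
    simp; ring
  have d3 : HasDerivAt (phase ζ s) _ x := (d1.sqrt h1.ne').add (d2.sqrt h2.ne')
  refine d3.congr_deriv ?_
  have p1 := Real.sqrt_pos.2 h1
  have p2 := Real.sqrt_pos.2 h2
  unfold phaseDeriv
  field_simp
  ring

/-- The set of `x` such that `(x, x s)` and `ζ - (x, x s)` are in the given dyadic sectors. -/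
def raySet (N M : ℕ) (ζ : Plane) (s : ℝ) : Set ℝ :=
  {x | 0 < x ∧ !₂[x, x * s] ∈ planeSector N ∧ ζ - !₂[x, x * s] ∈ planeSector M}

section ray
variable {N M : ℕ} {ζ : Plane} {s x : ℝ}

/-- These consequences of membership persist on the segment between two points of the ray: the upper
bound on |ζ − ξ| is dropped, and the lower one is put on the first coordinate, at the cost of a
factor 2. -/
lemma raySet_bounds (hx : x ∈ raySet N M ζ s) :
    0 < x ∧ |s| ≤ 1 ∧ (2 : ℝ) ^ (2 * N) ≤ x ^ 2 * (1 + s ^ 2) ∧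
      x ^ 2 * (1 + s ^ 2) < (2 : ℝ) ^ (2 * (N + 1)) ∧ 0 < ζ 0 - x ∧ |ζ 1 - x * s| ≤ ζ 0 - x ∧
      (2 : ℝ) ^ (2 * M) ≤ 2 * (ζ 0 - x) ^ 2 := by
  obtain ⟨hx0, h1, h2⟩ := hx
  have p2 := pos_of_mem_planeSector h2
  obtain ⟨a1, a2, a3⟩ := h1
  obtain ⟨b1, b2, b3⟩ := h2
  have n1 := norm_sq_plane !₂[x, x * s]
  have n2 := norm_sq_plane (ζ - !₂[x, x * s])
  simp only [PiLp.sub_apply, Matrix.cons_val_zero, Matrix.cons_val_one] at *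
  have e : x ^ 2 + (x * s) ^ 2 = x ^ 2 * (1 + s ^ 2) := by ring
  rw [e] at n1
  rw [abs_mul, abs_of_pos hx0] at a3
  have q1 := pow_le_pow_left₀ (by positivity) a1 2
  have q2 := pow_lt_pow_left₀ a2 (norm_nonneg _) two_ne_zero
  have q3 := pow_le_pow_left₀ (by positivity) b1 2
  have hv : (ζ 1 - x * s) ^ 2 ≤ (ζ 0 - x) ^ 2 := by
    rw [← sq_abs (ζ 1 - x * s)]; exact pow_le_pow_left₀ (abs_nonneg _) b3 2
  refine ⟨hx0, by nlinarith, ?_, ?_, p2, b3, ?_⟩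
  · rw [← n1, mul_comm 2, pow_mul]; exact q1
  · rw [← n1, mul_comm 2, pow_mul]; exact q2
  · rw [mul_comm, pow_mul]; linarith

lemma four_le_pow {N : ℕ} (hN : 1 ≤ N) : (4 : ℝ) ≤ 2 ^ (2 * N) := by
  calc (4 : ℝ) = 2 ^ 2 := by norm_num
    _ ≤ _ := pow_le_pow_right₀ (by norm_num) (by omega)

/-- The gap of three scales gives (ζ₁ − x)² ≥ 8|ξ|², which covers the factor 4 needed for
transversality. -/
lemma phase_deriv_of_bounds (hN : 1 ≤ N) (hNM : N + 3 ≤ M) (h0 : 0 < x) (hs : |s| ≤ 1)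
    (h1 : (2 : ℝ) ^ (2 * N) ≤ x ^ 2 * (1 + s ^ 2))
    (h2 : x ^ 2 * (1 + s ^ 2) < (2 : ℝ) ^ (2 * (N + 1))) (h3 : 0 < ζ 0 - x)
    (h4 : |ζ 1 - x * s| ≤ ζ 0 - x) (h5 : (2 : ℝ) ^ (2 * M) ≤ 2 * (ζ 0 - x) ^ 2) :
    HasDerivAt (phase ζ s) (phaseDeriv ζ s x) x ∧
      1 / (4 * (x ^ 2 * (1 + s ^ 2))) + (s - (ζ 1 - x * s) / (ζ 0 - x)) ^ 2 / 8 ≤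
        phaseDeriv ζ s x := by
  have f := four_le_pow hN
  have g : (2 : ℝ) ^ (2 * (N + 1)) * 16 ≤ (2 : ℝ) ^ (2 * M) := by
    rw [show (16 : ℝ) = 2 ^ 4 by norm_num, ← pow_add]
    exact pow_le_pow_right₀ (by norm_num) (by omega)
  have k : 4 * (x ^ 2 * (1 + s ^ 2)) ≤ (ζ 0 - x) ^ 2 + (ζ 1 - x * s) ^ 2 := by
    nlinarith [sq_nonneg (ζ 1 - x * s)]
  exact ⟨hasDerivAt_phase (by linarith) (by linarith),
    phase_deriv_lower_bound h0 hs h3 h4 (by linarith) k⟩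

/-- The set need not be treated as an interval: the relaxed bounds hold between any two of its
points, so the phase has positive derivative on the whole segment joining them. -/
lemma raySet_injOn (hN : 1 ≤ N) (hNM : N + 3 ≤ M) : Set.InjOn (phase ζ s) (raySet N M ζ s) := by
  have key : ∀ x₁ ∈ raySet N M ζ s, ∀ x₂ ∈ raySet N M ζ s, x₁ < x₂ →
      phase ζ s x₁ < phase ζ s x₂ := by
    intro x₁ hx₁ x₂ hx₂ hlt
    obtain ⟨a0, as, a1, a2, a3, a4, a5⟩ := raySet_bounds hx₁
    obtain ⟨b0, -, b1, b2, b3, b4, b5⟩ := raySet_bounds hx₂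
    have hd : ∀ t ∈ Set.Icc x₁ x₂, HasDerivAt (phase ζ s) (phaseDeriv ζ s t) t ∧
        1 / (4 * (t ^ 2 * (1 + s ^ 2))) + (s - (ζ 1 - t * s) / (ζ 0 - t)) ^ 2 / 8 ≤
          phaseDeriv ζ s t := by
      intro t ⟨ht1, ht2⟩
      have hs := abs_le.1 as
      have c4 := abs_le.1 b4
      have t0 : 0 < t := by linarith
      have s0 : 0 < 1 + s ^ 2 := by positivity
      refine phase_deriv_of_bounds hN hNM t0 as ?_ ?_ (by linarith) ?_ ?_
      · refine a1.trans ?_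
        gcongr
      · refine lt_of_le_of_lt ?_ b2
        gcongr
      · rw [abs_le]
        constructor <;> nlinarith
      · refine b5.trans ?_
        gcongr
    have hmono : StrictMonoOn (phase ζ s) (Set.Icc x₁ x₂) := by
      refine strictMonoOn_of_deriv_pos (convex_Icc _ _)
        (fun t ht => (hd t ht).1.continuousAt.continuousWithinAt) fun t ht => ?_
      rw [interior_Icc] at ht
      have := hd t (Set.Ioo_subset_Icc_self ht)
      rw [this.1.deriv]
      refine lt_of_lt_of_le ?_ this.2
      have t0 : 0 < t := by linarith [ht.1]
      positivity
    exact hmono (Set.left_mem_Icc.2 hlt.le) (Set.right_mem_Icc.2 hlt.le) hlt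
  intro x₁ h₁ x₂ h₂ he
  rcases lt_trichotomy x₁ x₂ with h | h | h
  · exact absurd he (key _ h₁ _ h₂ h).ne
  · exact h
  · exact absurd he (key _ h₂ _ h₁ h).ne'

end ray

/-! ### Density of the convolution of two sector measures. -/

lemma lintegral_comp_le_of_deriv {X : Set ℝ} (hX : MeasurableSet X) {φ φ' : ℝ → ℝ} {κ : ℝ}
    (hκ : 0 < κ) (hd : ∀ x ∈ X, HasDerivAt φ (φ' x) x) (hk : ∀ x ∈ X, κ ≤ φ' x)
    (hi : Set.InjOn φ X) (g : ℝ → ℝ≥0∞) :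
    ∫⁻ x in X, g (φ x) ≤ ENNReal.ofReal κ⁻¹ * ∫⁻ t, g t := by
  have h1 := lintegral_image_eq_lintegral_abs_deriv_mul hX
    (fun x hx => (hd x hx).hasDerivWithinAt) hi g
  have h2 : ∫⁻ x in X, ENNReal.ofReal κ * g (φ x) ≤ ∫⁻ t, g t := by
    calc ∫⁻ x in X, ENNReal.ofReal κ * g (φ x)
        ≤ ∫⁻ x in X, ENNReal.ofReal |φ' x| * g (φ x) := by
          refine setLIntegral_mono' hX fun x hx => ?_
          gcongr
          exact (hk x hx).trans (le_abs_self _)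
      _ = ∫⁻ t in φ '' X, g t := h1.symm
      _ ≤ _ := setLIntegral_le_lintegral _ _
  calc ∫⁻ x in X, g (φ x) = ENNReal.ofReal κ⁻¹ * ∫⁻ x in X, ENNReal.ofReal κ * g (φ x) := by
        rw [lintegral_const_mul' _ _ ENNReal.ofReal_ne_top, ← mul_assoc,
          ← ENNReal.ofReal_mul (by positivity), inv_mul_cancel₀ hκ.ne']
        simp
    _ ≤ _ := by gcongr

lemma lintegral_inv_sq_add_sq {a : ℝ} (ha : 0 < a) (s₀ : ℝ) :
    ∫⁻ s : ℝ, ENNReal.ofReal ((a ^ 2 + (s - s₀) ^ 2)⁻¹) = ENNReal.ofReal (Real.pi / a) := by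
  rw [lintegral_sub_right_eq_self (fun s => ENNReal.ofReal ((a ^ 2 + s ^ 2)⁻¹)) s₀,
    lintegral_comp_mul_left_real ha]
  have e : ∀ s : ℝ, ENNReal.ofReal ((a ^ 2 + (a * s) ^ 2)⁻¹) =
      ENNReal.ofReal ((a ^ 2)⁻¹) * ENNReal.ofReal ((1 + s ^ 2)⁻¹) := by
    intro s
    rw [← ENNReal.ofReal_mul (by positivity), ← mul_inv]
    congr 2; ring
  simp_rw [e]
  rw [lintegral_const_mul _ (by fun_prop), ← ofReal_integral_eq_lintegral_ofReal
    integrable_inv_one_add_sq (Filter.Eventually.of_forall fun s => by positivity),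
    integral_univ_inv_one_add_sq, ← ENNReal.ofReal_mul (by positivity),
    ← ENNReal.ofReal_mul (by positivity)]
  congr 1
  field_simp

/-- Pairs of points in two dyadic sectors which, unless `a ≤ 2^(-N)`, have slopes `a` apart. -/
def sectorPairs (a : ℝ) (N M : ℕ) : Set (SpaceTime × SpaceTime) :=
  {p | p.1 ∈ sector N ∧ p.2 ∈ sector M ∧
    (a ≤ ((2 : ℝ) ^ N)⁻¹ ∨ a ≤ |slope p.1.2 - slope p.2.2|)}

lemma measurableSet_sectorPairs (a : ℝ) (N M : ℕ) : MeasurableSet (sectorPairs a N M) := by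
  unfold sectorPairs
  have h := measurable_slope
  refine (measurable_fst (measurableSet_sector N)).inter
    ((measurable_snd (measurableSet_sector M)).inter ?_)
  refine (MeasurableSet.const _).union ?_
  exact measurableSet_le measurable_const (f := fun _ => a)
    (g := fun p : SpaceTime × SpaceTime => |slope p.1.2 - slope p.2.2|) (by fun_prop)

lemma norm_le_two_mul_bracket {ξ : Plane} (h : 2 ≤ ‖ξ‖) : ‖ξ‖ ≤ 2 * bracket ξ := by
  have := bracket_sq (ξ := ξ) (by linarith)
  have h0 := bracket_nonneg ξ
  exact le_of_sq_le_sq_of_nonneg (by nlinarith) (by positivity)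

lemma two_le_norm_of_mem {N : ℕ} (hN : 1 ≤ N) {ξ : Plane} (h : ξ ∈ planeSector N) : 2 ≤ ‖ξ‖ := by
  refine le_trans ?_ h.1
  calc (2 : ℝ) = 2 ^ 1 := by norm_num
    _ ≤ _ := pow_le_pow_right₀ (by norm_num) hN

/-- The Jacobian ξ₁ of slope coordinates cancels the density 1/⟨ξ⟩ up to a factor 2; the density of
the high frequency, at most 2/2^M, remains. -/
lemma jacobian_bound {N M : ℕ} (hN : 1 ≤ N) (hM : 1 ≤ M) {ξ η : Plane} (hξ : ξ ∈ planeSector N)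
    (hη : η ∈ planeSector M) :
    ξ 0 * (1 / bracket ξ * (1 / bracket η)) ≤ 4 / 2 ^ M := by
  have h1 := two_le_norm_of_mem hN hξ
  have h2 := two_le_norm_of_mem hM hη
  have b1 := norm_le_two_mul_bracket h1
  have b2 := norm_le_two_mul_bracket h2
  have n1 : ξ 0 ≤ ‖ξ‖ := le_of_sq_le_sq_of_nonneg
    (by rw [norm_sq_plane]; nlinarith [sq_nonneg (ξ 1)]) (norm_nonneg _)
  have p1 : 0 < bracket ξ := by linarith
  have p2 : 0 < bracket η := by linarith
  have q1 : ξ 0 * (1 / bracket ξ) ≤ 2 := by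
    rw [mul_one_div, div_le_iff₀ p1]; linarith
  have q2 : 1 / bracket η ≤ 2 / 2 ^ M := by
    rw [div_le_div_iff₀ p2 (by positivity)]; linarith [hη.1]
  calc ξ 0 * (1 / bracket ξ * (1 / bracket η)) = ξ 0 * (1 / bracket ξ) * (1 / bracket η) := by ring
    _ ≤ 2 * (2 / 2 ^ M) := by
      gcongr
    _ = 4 / 2 ^ M := by ring

lemma measurableSet_raySet (N M : ℕ) (ζ : Plane) (s : ℝ) : MeasurableSet (raySet N M ζ s) := by
  have h : Measurable fun x : ℝ => (!₂[x, x * s] : Plane) := by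
    apply Continuous.measurable; fun_prop
  exact (measurableSet_lt measurable_const measurable_id).inter
    ((h (measurableSet_planeSector N)).inter
      ((measurable_const.sub h) (measurableSet_planeSector M)))

/-- The slope of ζ = ξ + η is a weighted mean of the slopes of ξ and η. This gives a comparison
point independent of x. -/
lemma slope_sub_le {ζ : Plane} {s x : ℝ} (hx : 0 < x) (h : 0 < ζ 0 - x) :
    |s - slope ζ| ≤ |s - (ζ 1 - x * s) / (ζ 0 - x)| := by
  have h0 : 0 < ζ 0 := by linarith
  have e : s - slope ζ = (ζ 0 - x) / ζ 0 * (s - (ζ 1 - x * s) / (ζ 0 - x)) := by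
    unfold slope; field_simp; ring
  rw [e, abs_mul, abs_of_pos (by positivity)]
  refine mul_le_of_le_one_left (abs_nonneg _) ?_
  rw [div_le_one h0]; linarith

/-- One-dimensional density estimate along a ray. -/
lemma lintegral_ray_le {N M : ℕ} (hN : 1 ≤ N) (hNM : N + 3 ≤ M) {a : ℝ} (ha : 0 < a) (ζ : Plane)
    (s : ℝ) (g : ℝ → ℝ≥0∞) :
    ∫⁻ x in raySet N M ζ s ∩ {x | a ≤ ((2 : ℝ) ^ N)⁻¹ ∨ a ≤ |s - (ζ 1 - x * s) / (ζ 0 - x)|},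
      g (phase ζ s x) ≤ ENNReal.ofReal (16 * (a ^ 2 + (s - slope ζ) ^ 2)⁻¹) * ∫⁻ t, g t := by
  have hm : MeasurableSet (raySet N M ζ s ∩
      {x | a ≤ ((2 : ℝ) ^ N)⁻¹ ∨ a ≤ |s - (ζ 1 - x * s) / (ζ 0 - x)|}) := by
    refine (measurableSet_raySet N M ζ s).inter ((MeasurableSet.const _).union ?_)
    exact measurableSet_le (f := fun _ => a) measurable_const (by fun_prop)
  have e : 16 * (a ^ 2 + (s - slope ζ) ^ 2)⁻¹ = ((a ^ 2 + (s - slope ζ) ^ 2) / 16)⁻¹ := by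
    field_simp
  rw [e]
  have hd : ∀ x ∈ raySet N M ζ s, HasDerivAt (phase ζ s) (phaseDeriv ζ s x) x ∧
      1 / (4 * (x ^ 2 * (1 + s ^ 2))) + (s - (ζ 1 - x * s) / (ζ 0 - x)) ^ 2 / 8 ≤
        phaseDeriv ζ s x := by
    intro x hx
    obtain ⟨a0, as, a1, a2, a3, a4, a5⟩ := raySet_bounds hx
    exact phase_deriv_of_bounds hN hNM a0 as a1 a2 a3 a4 a5
  refine lintegral_comp_le_of_deriv hm (φ' := phaseDeriv ζ s) (by positivity)
    (fun x hx => (hd x hx.1).1) (fun x hx => le_trans ?_ (hd x hx.1).2)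
    ((raySet_injOn hN hNM).mono Set.inter_subset_left) g
  obtain ⟨a0, as, a1, a2, a3, a4, a5⟩ := raySet_bounds hx.1
  have h1 := slope_sub_le (s := s) a0 a3
  have h2 := sq_le_sq.2 h1
  have hpos : 0 < 1 / (4 * (x ^ 2 * (1 + s ^ 2))) := by positivity
  -- For a ≤ 2^(−N) the term 1/(4|ξ|²) supplies a²/16, because |ξ|² < 4·2^(2N). Otherwise the
  -- separation term d²/8 supplies both a²/16 and (s − slope ζ)²/16.
  rcases hx.2 with h3 | h3
  · have h4 : a ^ 2 / 16 ≤ 1 / (4 * (x ^ 2 * (1 + s ^ 2))) := by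
      have h5 : a ^ 2 ≤ (((2 : ℝ) ^ N)⁻¹) ^ 2 := pow_le_pow_left₀ ha.le h3 2
      have h6 : (((2 : ℝ) ^ N)⁻¹) ^ 2 / 16 = 1 / (4 * (2 : ℝ) ^ (2 * (N + 1))) := by
        rw [mul_add, pow_add, pow_mul', inv_pow]; field_simp; norm_num
      calc a ^ 2 / 16 ≤ (((2 : ℝ) ^ N)⁻¹) ^ 2 / 16 := by gcongr
        _ = _ := h6
        _ ≤ _ := by gcongr
    nlinarith [sq_nonneg (s - slope ζ)]
  · have h4 : a ^ 2 ≤ (s - (ζ 1 - x * s) / (ζ 0 - x)) ^ 2 := by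
      rw [← sq_abs (s - _)]; exact pow_le_pow_left₀ ha.le h3 2
    linarith

/-- The convolution of the measures on two separated dyadic sectors has bounded density. -/
theorem lintegral_sectorPairs_le {N M : ℕ} (hN : 1 ≤ N) (hNM : N + 3 ≤ M) {a : ℝ} (ha : 0 < a)
    {g : SpaceTime → ℝ≥0∞} (hg : Measurable g) :
    ∫⁻ p in sectorPairs a N M, g (p.1 + p.2) ∂(sigma.prod sigma) ≤
      ENNReal.ofReal (64 * Real.pi / (2 ^ M * a)) * ∫⁻ z, g z := by
  have hb := measurable_bracket
  set F : SpaceTime × SpaceTime → ℝ≥0∞ :=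
    (sectorPairs a N M).indicator (fun p => g (p.1 + p.2)) with hF
  have hFm : Measurable F :=
    (hg.comp (measurable_fst.add measurable_snd)).indicator (measurableSet_sectorPairs a N M)
  have F0 : ∀ p, p ∉ sectorPairs a N M → F p = 0 := fun p hp => Set.indicator_of_notMem hp _
  have F1 : ∀ p, F p ≤ g (p.1 + p.2) := fun p => Set.indicator_le_self _ _ p
  clear_value F
  set K : Plane × Plane → ℝ≥0∞ := fun q => ENNReal.ofReal (1 / bracket q.1) *
    (ENNReal.ofReal (1 / bracket q.2) * F ((bracket q.1, q.1), (bracket q.2, q.2))) with hK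
  have hKm : Measurable K := by
    refine Measurable.mul (by fun_prop) (Measurable.mul (by fun_prop) (hFm.comp ?_))
    fun_prop
  have K0 : ∀ q : Plane × Plane, ¬ (q.1 ∈ planeSector N ∧ q.2 ∈ planeSector M ∧
      (a ≤ ((2 : ℝ) ^ N)⁻¹ ∨ a ≤ |slope q.1 - slope q.2|)) → K q = 0 := by
    intro q hq
    simp only [hK]
    rw [F0, mul_zero, mul_zero]
    intro h
    exact hq ⟨h.1.2.2, h.2.1.2.2, h.2.2⟩
  have K1 : ∀ q, K q ≤ ENNReal.ofReal (1 / bracket q.1) * (ENNReal.ofReal (1 / bracket q.2) *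
      g (bracket q.1 + bracket q.2, q.1 + q.2)) := by
    intro q
    simp only [hK]
    gcongr
    exact F1 _
  have step1 : ∫⁻ p in sectorPairs a N M, g (p.1 + p.2) ∂(sigma.prod sigma) =
      ∫⁻ ξ, ∫⁻ η, K (ξ, η) := by
    rw [← lintegral_indicator (measurableSet_sectorPairs a N M), ← hF, lintegral_prod _
      hFm.aemeasurable, lintegral_sigma_of_pos]
    · refine lintegral_congr fun ξ => ?_
      rw [lintegral_sigma_of_pos, ← lintegral_const_mul]
      · fun_prop
      · fun_prop
      · exact fun z hz => F0 _ fun h => absurd h.2.1.2.1 (not_lt.2 hz)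
      · exact fun z hz => F0 _ fun h => by
          have := two_le_norm_of_mem (by omega) h.2.1.2.2
          simp only at this
          linarith
    · exact hFm.lintegral_prod_right'
    · intro z hz
      have : ∀ w, F (z, w) = 0 := fun w => F0 _ fun h => absurd h.1.2.1 (not_lt.2 hz)
      simp [this]
    · intro z hz
      have : ∀ w, F (z, w) = 0 := fun w => F0 _ fun h => by
        have := two_le_norm_of_mem hN h.1.2.2
        simp only at this
        linarith
      simp [this]
  -- Convolution form: the sum ζ of the frequencies becomes the outer variable.
  have step2 : ∫⁻ ξ, ∫⁻ η, K (ξ, η) = ∫⁻ ζ, ∫⁻ ξ, K (ξ, ζ - ξ) := by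
    have hsw := lintegral_lintegral_swap (μ := (volume : Measure Plane))
      (ν := (volume : Measure Plane)) (f := fun ζ ξ : Plane => K (ξ, ζ - ξ))
      (hKm.comp (measurable_snd.prodMk (measurable_fst.sub measurable_snd))).aemeasurable
    rw [hsw]
    refine lintegral_congr fun ξ => ?_
    rw [lintegral_sub_right_eq_self (fun η => K (ξ, η)) ξ]
  -- With ζ and s fixed, only x varies, and the phase serves as the new time variable. The resulting
  -- factor is integrable in s, with integral π/a.
  have hray : ∀ (ζ : Plane) (s : ℝ), ∫⁻ x in Set.Ioi (0 : ℝ), ENNReal.ofReal x *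
      K (!₂[x, x * s], ζ - !₂[x, x * s]) ≤ ENNReal.ofReal (64 / 2 ^ M) *
        (ENNReal.ofReal ((a ^ 2 + (s - slope ζ) ^ 2)⁻¹) * ∫⁻ t, g (t, ζ)) := by
    intro ζ s
    set X := raySet N M ζ s ∩
      {x | a ≤ ((2 : ℝ) ^ N)⁻¹ ∨ a ≤ |s - (ζ 1 - x * s) / (ζ 0 - x)|} with hX
    have hm : MeasurableSet X := by
      refine (measurableSet_raySet N M ζ s).inter ((MeasurableSet.const _).union ?_)
      exact measurableSet_le (f := fun _ => a) measurable_const (by fun_prop)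
    calc ∫⁻ x in Set.Ioi (0 : ℝ), ENNReal.ofReal x * K (!₂[x, x * s], ζ - !₂[x, x * s])
        ≤ ∫⁻ x in Set.Ioi (0 : ℝ), X.indicator
            (fun x => ENNReal.ofReal (4 / 2 ^ M) * g (phase ζ s x, ζ)) x := by
          refine setLIntegral_mono' measurableSet_Ioi fun x hx => ?_
          have hx0 : 0 < x := hx
          by_cases hxX : x ∈ X
          · rw [Set.indicator_of_mem hxX]
            have hb := jacobian_bound hN (by omega) hxX.1.2.1 hxX.1.2.2
            have e1 : bracket !₂[x, x * s] + bracket (ζ - !₂[x, x * s]) = phase ζ s x := by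
              have : ζ - !₂[x, x * s] = !₂[ζ 0 - x, ζ 1 - x * s] := by
                ext i; fin_cases i <;> simp
              rw [this, bracket_mk, bracket_mk, phase]
              congr 3; ring
            calc _ ≤ ENNReal.ofReal x * _ := mul_le_mul' le_rfl (K1 _)
              _ = ENNReal.ofReal (x * (1 / bracket !₂[x, x * s] *
                  (1 / bracket (ζ - !₂[x, x * s])))) * g (phase ζ s x, ζ) := by
                rw [ENNReal.ofReal_mul hx0.le, ENNReal.ofReal_mul (by
                  have := bracket_nonneg !₂[x, x * s]; positivity), e1, add_sub_cancel]
                ring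
              _ ≤ _ := by
                gcongr
                simpa using hb
          · rw [Set.indicator_of_notMem hxX, K0, mul_zero]
            intro h
            refine hxX ⟨⟨hx0, h.1, h.2.1⟩, ?_⟩
            have e2 : slope !₂[x, x * s] = s := by simp [slope, hx0.ne']
            have e3 : slope (ζ - !₂[x, x * s]) = (ζ 1 - x * s) / (ζ 0 - x) := by simp [slope]
            have := h.2.2
            simp only [e2, e3] at this
            exact this
      _ ≤ ∫⁻ x, X.indicator (fun x => ENNReal.ofReal (4 / 2 ^ M) * g (phase ζ s x, ζ)) x :=
          setLIntegral_le_lintegral _ _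
      _ = ENNReal.ofReal (4 / 2 ^ M) * ∫⁻ x in X, g (phase ζ s x, ζ) := by
          rw [lintegral_indicator hm, lintegral_const_mul' _ _ ENNReal.ofReal_ne_top]
      _ ≤ ENNReal.ofReal (4 / 2 ^ M) * (ENNReal.ofReal (16 * (a ^ 2 + (s - slope ζ) ^ 2)⁻¹) *
            ∫⁻ t, g (t, ζ)) := by
          gcongr
          exact lintegral_ray_le hN hNM ha ζ s fun t => g (t, ζ)
      _ = _ := by
          rw [← mul_assoc, ← mul_assoc, ← ENNReal.ofReal_mul (by positivity),
            ← ENNReal.ofReal_mul (by positivity)]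
          congr 2; ring
  rw [step1, step2]
  calc ∫⁻ ζ, ∫⁻ ξ, K (ξ, ζ - ξ)
      = ∫⁻ ζ : Plane, ∫⁻ s : ℝ, ∫⁻ x in Set.Ioi (0 : ℝ), ENNReal.ofReal x *
          K (!₂[x, x * s], ζ - !₂[x, x * s]) := by
        refine lintegral_congr fun ζ => ?_
        refine lintegral_plane_slope (h := fun ξ => K (ξ, ζ - ξ)) (by fun_prop) fun ξ hξ => ?_
        exact K0 _ fun h => absurd (pos_of_mem_planeSector h.1) (not_lt.2 hξ)
    _ ≤ ∫⁻ ζ : Plane, ∫⁻ s : ℝ, ENNReal.ofReal (64 / 2 ^ M) *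
        (ENNReal.ofReal ((a ^ 2 + (s - slope ζ) ^ 2)⁻¹) * ∫⁻ t, g (t, ζ)) :=
        lintegral_mono fun ζ => lintegral_mono fun s => hray ζ s
    _ = ∫⁻ ζ : Plane, ENNReal.ofReal (64 * Real.pi / (2 ^ M * a)) * ∫⁻ t, g (t, ζ) := by
        refine lintegral_congr fun ζ => ?_
        rw [lintegral_const_mul' _ _ ENNReal.ofReal_ne_top, lintegral_mul_const _ (by fun_prop),
          lintegral_inv_sq_add_sq ha, ← mul_assoc, ← ENNReal.ofReal_mul (by positivity)]
        congr 2; field_simp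
    _ = _ := by
        rw [lintegral_const_mul' _ _ ENNReal.ofReal_ne_top, Measure.volume_eq_prod,
          lintegral_prod_symm _ hg.aemeasurable]

/-- The mass of the part of a dyadic sector lying over a small interval of slopes. -/
lemma sigma_slope_le {N : ℕ} (hN : 1 ≤ N) (s₀ : ℝ) {a : ℝ} (ha : 0 < a) :
    sigma {z | z ∈ sector N ∧ |slope z.2 - s₀| < a} ≤ ENNReal.ofReal (8 * 2 ^ N * a) := by
  have hb := measurable_bracket
  have hsl := measurable_slope
  set S := {z : SpaceTime | z ∈ sector N ∧ |slope z.2 - s₀| < a} with hS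
  have hm : MeasurableSet S := by
    refine (measurableSet_sector N).inter ?_
    exact measurableSet_lt (f := fun z : SpaceTime => |slope z.2 - s₀|) (by fun_prop)
      measurable_const
  have hm1 : Measurable (S.indicator (1 : SpaceTime → ℝ≥0∞)) := measurable_one.indicator hm
  rw [← lintegral_indicator_one hm, lintegral_sigma_of_pos hm1]
  · rw [lintegral_plane_slope]
    -- The slope interval has length 2a, x is below 2^(N+1), and the density x/⟨ξ⟩ is at most 2.
    · calc _ ≤ ∫⁻ s : ℝ, ∫⁻ x in Set.Ioi (0 : ℝ),
            (Set.Ioo (s₀ - a) (s₀ + a)).indicator 1 s *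
              (Set.Ioo 0 ((2 : ℝ) ^ (N + 1))).indicator (fun _ => 2) x := by
            refine lintegral_mono fun s => setLIntegral_mono' measurableSet_Ioi fun x hx => ?_
            have hx0 : 0 < x := hx
            by_cases h : ((bracket !₂[x, x * s], !₂[x, x * s]) : SpaceTime) ∈ S
            · have e2 : slope !₂[x, x * s] = s := by simp [slope, hx0.ne']
              have h1 : s ∈ Set.Ioo (s₀ - a) (s₀ + a) := by
                have := h.2
                simp only [e2] at this
                rw [abs_lt] at this
                constructor <;> linarith
              have hp := h.1.2.2
              simp only at hp
              have n1 : x ≤ ‖(!₂[x, x * s] : Plane)‖ := le_of_sq_le_sq_of_nonneg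
                (by rw [norm_sq_plane]; simp; nlinarith [sq_nonneg (x * s)]) (norm_nonneg _)
              have h2 : x ∈ Set.Ioo 0 ((2 : ℝ) ^ (N + 1)) := ⟨hx0, n1.trans_lt hp.2.1⟩
              rw [Set.indicator_of_mem h, Set.indicator_of_mem h1, Set.indicator_of_mem h2]
              simp only [Pi.one_apply, mul_one, one_mul]
              rw [← ENNReal.ofReal_mul hx0.le]
              refine (ENNReal.ofReal_le_ofReal (q := 2) ?_).trans_eq (by simp)
              have b1 := norm_le_two_mul_bracket (two_le_norm_of_mem hN hp)
              have b0 : 0 < bracket !₂[x, x * s] := by linarith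
              rw [mul_one_div, div_le_iff₀ b0]; linarith
            · rw [Set.indicator_of_notMem h]; simp
        _ = ENNReal.ofReal (2 * a) * (2 * ENNReal.ofReal (2 ^ (N + 1))) := by
            have hc (s : ℝ) := lintegral_const_mul (μ := volume.restrict (Set.Ioi (0 : ℝ)))
              ((Set.Ioo (s₀ - a) (s₀ + a)).indicator (1 : ℝ → ℝ≥0∞) s)
              ((measurable_const (a := (2 : ℝ≥0∞))).indicator
                (measurableSet_Ioo (a := (0 : ℝ)) (b := (2 : ℝ) ^ (N + 1))))
            simp_rw [hc]
            rw [lintegral_mul_const _ (measurable_one.indicator measurableSet_Ioo),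
              lintegral_indicator_one measurableSet_Ioo, lintegral_indicator measurableSet_Ioo,
              setLIntegral_const, Measure.restrict_apply measurableSet_Ioo,
              Set.inter_eq_left.2 Set.Ioo_subset_Ioi_self, Real.volume_Ioo, Real.volume_Ioo]
            congr 3 <;> ring
        _ = _ := by
            rw [show (2 : ℝ≥0∞) = ENNReal.ofReal 2 by simp, ← ENNReal.ofReal_mul (by positivity),
              ← ENNReal.ofReal_mul (by positivity)]
            congr 1; ring
    · exact Measurable.mul (by fun_prop) (hm1.comp (by fun_prop))
    · intro ξ hξ
      rw [Set.indicator_of_notMem, mul_zero]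
      exact fun h => absurd (pos_of_mem_planeSector h.1.2.2) (not_lt.2 hξ)
  · intro z hz
    exact Set.indicator_of_notMem (fun h => absurd h.1.2.1 (not_lt.2 hz)) _
  · intro z hz
    refine Set.indicator_of_notMem (fun h => ?_) _
    have := two_le_norm_of_mem hN h.1.2.2
    linarith

/-! ### The bilinear L⁴ estimate for bumps on separated sectors. -/

/-- `f` is bounded by the indicator function of the set `E`, whose measure is `m`. -/
structure IsBump (f : SpaceTime → ℂ) (E : Set SpaceTime) (m : ℝ) : Prop where
  measurable : Measurable f
  measurableSet : MeasurableSet E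
  norm_le : ∀ z, ‖f z‖ ≤ 1
  eq_zero : ∀ z, z ∉ E → f z = 0
  pos : 0 < m
  measure_eq : sigma E = ENNReal.ofReal m

lemma IsBump.enorm_le_indicator {f : SpaceTime → ℂ} {E : Set SpaceTime} {m : ℝ}
    (hf : IsBump f E m) (z : SpaceTime) : ‖f z‖ₑ ≤ E.indicator 1 z := by
  by_cases hz : z ∈ E
  · rw [Set.indicator_of_mem hz, ← ofReal_norm]
    exact ENNReal.ofReal_le_one.2 (hf.norm_le z)
  · simp [hf.eq_zero z hz]

lemma IsBump.lintegral_enorm_le {f : SpaceTime → ℂ} {E : Set SpaceTime} {m : ℝ}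
    (hf : IsBump f E m) : ∫⁻ z, ‖f z‖ₑ ∂sigma ≤ ENNReal.ofReal m := by
  rw [← hf.measure_eq, ← lintegral_indicator_one hf.measurableSet]
  exact lintegral_mono fun z => hf.enorm_le_indicator z

lemma IsBump.integrable {f : SpaceTime → ℂ} {E : Set SpaceTime} {m : ℝ}
    (hf : IsBump f E m) : Integrable f sigma :=
  ⟨hf.measurable.aestronglyMeasurable, hf.lintegral_enorm_le.trans_lt ENNReal.ofReal_lt_top⟩

lemma IsBump.norm_extension_le {f : SpaceTime → ℂ} {E : Set SpaceTime} {m : ℝ}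
    (hf : IsBump f E m) (y : SpaceTime) : ‖extension f y‖ ≤ m := by
  have := (enorm_extension_le f y).trans hf.lintegral_enorm_le
  rw [← ofReal_norm] at this
  exact (ENNReal.ofReal_le_ofReal_iff hf.pos.le).1 this

section bilinear
variable {f g : SpaceTime → ℂ} {E F : Set SpaceTime} {mE mF : ℝ}

/-- The part of the product of two extensions coming from a set of pairs of frequencies. -/
noncomputable def pairExtension (P : Set (SpaceTime × SpaceTime)) (f g : SpaceTime → ℂ)
    (y : SpaceTime) : ℂ :=
  ∫ p in P, Complex.exp (Complex.I * (pairing y (p.1 + p.2) : ℂ)) * (f p.1 * g p.2)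
    ∂(sigma.prod sigma)

lemma pairing_add (y u v : SpaceTime) : pairing y (u + v) = pairing y u + pairing y v := by
  simp [pairing, inner_add_right]; ring

lemma extension_mul_extension (hf : IsBump f E mE) (hg : IsBump g F mF)
    {P : Set (SpaceTime × SpaceTime)} (hP : MeasurableSet P) (y : SpaceTime) :
    extension f y * extension g y = pairExtension P f g y + pairExtension Pᶜ f g y := by
  have e : ∀ p : SpaceTime × SpaceTime,
      Complex.exp (Complex.I * (pairing y (p.1 + p.2) : ℂ)) * (f p.1 * g p.2) =
      (Complex.exp (Complex.I * (pairing y p.1 : ℂ)) * f p.1) *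
        (Complex.exp (Complex.I * (pairing y p.2 : ℂ)) * g p.2) := by
    intro p
    rw [pairing_add]; push_cast
    rw [mul_add, Complex.exp_add]; ring
  have hi := (integrable_cexp_mul hf.integrable y).mul_prod (integrable_cexp_mul hg.integrable y)
  unfold pairExtension extension
  simp_rw [e]
  rw [integral_add_compl hP hi, integral_prod_mul
    (fun z => Complex.exp (Complex.I * (pairing y z : ℂ)) * f z)
    (fun z => Complex.exp (Complex.I * (pairing y z : ℂ)) * g z)]

lemma IsBump.measure_prod (hf : IsBump f E mE) (hg : IsBump g F mF) :
    (sigma.prod sigma) (E ×ˢ F) = ENNReal.ofReal (mE * mF) := by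
  rw [Measure.prod_prod, hf.measure_eq, hg.measure_eq, ENNReal.ofReal_mul hf.pos.le]

lemma pairExtension_inter (hf : IsBump f E mE) (hg : IsBump g F mF)
    {P : Set (SpaceTime × SpaceTime)} (hP : MeasurableSet P) (y : SpaceTime) :
    pairExtension P f g y = pairExtension (P ∩ E ×ˢ F) f g y := by
  unfold pairExtension
  have hEF := hf.measurableSet.prod hg.measurableSet
  rw [← integral_indicator hP, ← integral_indicator (hP.inter hEF)]
  congr 1; ext p
  by_cases h : p ∈ P
  · by_cases h2 : p ∈ E ×ˢ F
    · rw [Set.indicator_of_mem h, Set.indicator_of_mem (Set.mem_inter h h2)]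
    · rw [Set.indicator_of_mem h, Set.indicator_of_notMem fun h3 => h2 h3.2]
      have : f p.1 * g p.2 = 0 := by
        by_cases h3 : p.1 ∈ E
        · rw [hg.eq_zero p.2 fun h4 => h2 ⟨h3, h4⟩, mul_zero]
        · rw [hf.eq_zero p.1 h3, zero_mul]
      rw [this, mul_zero]
  · rw [Set.indicator_of_notMem h, Set.indicator_of_notMem fun h3 => h h3.1]

/-- The Plancherel bound is applied to the addition map on pairs, whose image measure has density at
most 64π/(2^M a); the total mass is at most mE·mF. -/
lemma lintegral_pairExtension_sq_le {N M : ℕ} (hN : 1 ≤ N) (hNM : N + 3 ≤ M)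
    (hf : IsBump f E mE) (hg : IsBump g F mF) {a : ℝ} (ha : 0 < a) :
    ∫⁻ y, ‖pairExtension (sectorPairs a N M) f g y‖ₑ ^ 2 ≤
      ENNReal.ofReal (512 * Real.pi ^ 4 / (2 ^ M * a) * (mE * mF)) := by
  have hP := measurableSet_sectorPairs a N M
  simp_rw [pairExtension_inter hf hg hP]
  set Q := sectorPairs a N M ∩ E ×ˢ F with hQ
  have hQm : (sigma.prod sigma) Q ≤ ENNReal.ofReal (mE * mF) := by
    rw [← hf.measure_prod hg]; exact measure_mono Set.inter_subset_right
  have : IsFiniteMeasure ((sigma.prod sigma).restrict Q) :=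
    ⟨by rw [Measure.restrict_apply_univ]; exact hQm.trans_lt ENNReal.ofReal_lt_top⟩
  have h := lintegral_enorm_sq_le_of_density (ν := (sigma.prod sigma).restrict Q)
    (T := fun p => p.1 + p.2) (by fun_prop) (H := fun p => f p.1 * g p.2)
    ((hf.measurable.comp measurable_fst).mul (hg.measurable.comp measurable_snd))
    (fun p => by
      rw [norm_mul]; exact mul_le_one₀ (hf.norm_le _) (norm_nonneg _) (hg.norm_le _))
    (A := (64 * Real.pi / (2 ^ M * a)).toNNReal) (fun u hu => by
      refine (lintegral_mono_set Set.inter_subset_left).trans ?_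
      exact lintegral_sectorPairs_le hN hNM ha hu)
  refine h.trans ?_
  rw [Measure.restrict_apply_univ]
  calc _ ≤ ENNReal.ofReal (8 * Real.pi ^ 3) * ENNReal.ofReal (64 * Real.pi / (2 ^ M * a)) *
        ENNReal.ofReal (mE * mF) := by gcongr; rfl
    _ = _ := by
      rw [← ENNReal.ofReal_mul (by positivity), ← ENNReal.ofReal_mul (by positivity)]
      congr 1; ring

/-- For each fixed high frequency, the low frequencies of nearly the same slope fill a thin sector
of mass at most 8·2^N·a, so the trivial bound by mass suffices. -/
lemma norm_pairExtension_compl_le {N M : ℕ} (hN : 1 ≤ N)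
    (hf : IsBump f E mE) (hg : IsBump g F mF) (hE : E ⊆ sector N) (hF : F ⊆ sector M)
    {a : ℝ} (ha : 0 < a) (y : SpaceTime) :
    ‖pairExtension (sectorPairs a N M)ᶜ f g y‖ ≤ 8 * 2 ^ N * a * mF := by
  have hP := (measurableSet_sectorPairs a N M).compl
  have hsl := measurable_slope
  rw [pairExtension_inter hf hg hP]
  set Q := (sectorPairs a N M)ᶜ ∩ E ×ˢ F with hQ
  have hQm : MeasurableSet Q := hP.inter (hf.measurableSet.prod hg.measurableSet)
  have h1 : ‖pairExtension Q f g y‖ₑ ≤ (sigma.prod sigma) Q := by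
    unfold pairExtension
    refine (enorm_integral_le_lintegral_enorm _).trans ?_
    rw [← setLIntegral_one]
    refine lintegral_mono fun p => ?_
    rw [← ofReal_norm]
    refine ENNReal.ofReal_le_one.2 ?_
    rw [norm_mul, norm_cexp_I_mul, one_mul, norm_mul]
    exact mul_le_one₀ (hf.norm_le _) (norm_nonneg _) (hg.norm_le _)
  have h2 : (sigma.prod sigma) Q ≤ ENNReal.ofReal (8 * 2 ^ N * a * mF) := by
    rw [Measure.prod_apply_symm hQm]
    calc ∫⁻ w, sigma ((fun z => (z, w)) ⁻¹' Q) ∂sigma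
        ≤ ∫⁻ w, F.indicator (fun _ => ENNReal.ofReal (8 * 2 ^ N * a)) w ∂sigma := by
          refine lintegral_mono fun w => ?_
          by_cases hw : w ∈ F
          · rw [Set.indicator_of_mem hw]
            refine (measure_mono ?_).trans (sigma_slope_le hN (slope w.2) ha)
            intro z hz
            refine ⟨hE hz.2.1, ?_⟩
            by_contra hcon
            exact hz.1 ⟨hE hz.2.1, hF hw, Or.inr (not_lt.1 hcon)⟩
          · rw [Set.indicator_of_notMem hw]
            have : (fun z => (z, w)) ⁻¹' Q = ∅ := by
              ext z; simp only [Set.mem_preimage, Set.mem_empty_iff_false, iff_false]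
              exact fun h => hw h.2.2
            simp [this]
      _ = _ := by
          rw [lintegral_indicator_const hg.measurableSet, hg.measure_eq,
            ← ENNReal.ofReal_mul (by positivity)]
  have h3 := h1.trans h2
  rw [← ofReal_norm] at h3
  have := hg.pos
  exact (ENNReal.ofReal_le_ofReal_iff (by positivity)).1 h3

/-- `hbad` ensures that the pairs with close slopes contribute at most half of the level t·mE·mF:
either there are none, or their mass is small. The separated pairs must then reach the other half,
and Chebyshev applies to their L² norm. -/
lemma measure_product_gt_le {N M : ℕ} (hN : 1 ≤ N) (hNM : N + 3 ≤ M)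
    (hf : IsBump f E mE) (hg : IsBump g F mF) (hE : E ⊆ sector N) (hF : F ⊆ sector M)
    {a t : ℝ} (ha : 0 < a) (ht : 0 < t)
    (hbad : a ≤ ((2 : ℝ) ^ N)⁻¹ ∨ 16 * 2 ^ N * a ≤ t * mE) :
    volume {y | t < ‖extension f y‖ / mE * (‖extension g y‖ / mF)} ≤
      ENNReal.ofReal (2048 * Real.pi ^ 4 / (2 ^ M * a) * t⁻¹ ^ 2 * mE⁻¹ * mF⁻¹) := by
  have pE := hf.pos
  have pF := hg.pos
  set P := sectorPairs a N M with hP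
  have hPm : MeasurableSet P := measurableSet_sectorPairs a N M
  have hsub : {y | t < ‖extension f y‖ / mE * (‖extension g y‖ / mF)} ⊆
      {y | ENNReal.ofReal ((t * mE * mF / 2) ^ 2) ≤ ‖pairExtension P f g y‖ₑ ^ 2} := by
    intro y hy
    have hy' : t < ‖extension f y‖ / mE * (‖extension g y‖ / mF) := hy
    rw [div_mul_div_comm, lt_div_iff₀ (by positivity), ← norm_mul,
      extension_mul_extension hf hg hPm] at hy'
    have h1 := norm_add_le (pairExtension P f g y) (pairExtension Pᶜ f g y)
    have h2 : ‖pairExtension Pᶜ f g y‖ ≤ t * mE * mF / 2 := by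
      rcases hbad with h | h
      · have e : Pᶜ ∩ E ×ˢ F = ∅ := by
          ext p
          simp only [Set.mem_inter_iff, Set.mem_compl_iff, Set.mem_prod, Set.mem_empty_iff_false,
            iff_false]
          exact fun hp => hp.1 ⟨hE hp.2.1, hF hp.2.2, Or.inl h⟩
        rw [pairExtension_inter hf hg hPm.compl, e]
        simp only [pairExtension, Measure.restrict_empty, integral_zero_measure, norm_zero]
        positivity
      · refine (norm_pairExtension_compl_le hN hf hg hE hF ha y).trans ?_
        nlinarith
    have h3 : t * mE * mF / 2 ≤ ‖pairExtension P f g y‖ := by nlinarith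
    have h4 : (t * mE * mF / 2) ^ 2 ≤ ‖pairExtension P f g y‖ ^ 2 :=
      pow_le_pow_left₀ (by positivity) h3 2
    have h5 := ENNReal.ofReal_le_ofReal h4
    rwa [ENNReal.ofReal_pow (norm_nonneg _), ofReal_norm] at h5
  have hm : Measurable fun y => ‖pairExtension P f g y‖ₑ ^ 2 := by
    have hem : Measurable (Function.uncurry fun (y : SpaceTime) (p : SpaceTime × SpaceTime) =>
        Complex.exp (Complex.I * (pairing y (p.1 + p.2) : ℂ)) * (f p.1 * g p.2)) := by
      have h2 : Continuous fun p : SpaceTime × SpaceTime =>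
        Complex.exp (Complex.I * (pairing p.1 p.2 : ℂ)) := by
        have := continuous_pairing
        fun_prop
      refine Measurable.mul (h2.measurable.comp (g := fun p : SpaceTime × SpaceTime =>
        Complex.exp (Complex.I * (pairing p.1 p.2 : ℂ)))
        (f := fun q : SpaceTime × SpaceTime × SpaceTime => (q.1, q.2.1 + q.2.2)) (by fun_prop)) ?_
      exact (hf.measurable.comp (measurable_fst.comp measurable_snd)).mul
        (hg.measurable.comp (measurable_snd.comp measurable_snd))
    have := (hem.stronglyMeasurable.integral_prod_right
      (ν := (sigma.prod sigma).restrict P)).measurable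
    exact this.enorm.pow_const 2
  have hc : 0 < (t * mE * mF / 2) ^ 2 := by positivity
  refine (measure_mono hsub).trans ?_
  refine (meas_ge_le_lintegral_div hm.aemeasurable (by rw [Ne, ENNReal.ofReal_eq_zero]; exact not_le.2 hc)
    ENNReal.ofReal_ne_top).trans ?_
  refine (ENNReal.div_le_div_right (lintegral_pairExtension_sq_le hN hNM hf hg ha) _).trans ?_
  rw [← ENNReal.ofReal_div_of_pos hc]
  refine ENNReal.ofReal_le_ofReal (le_of_eq ?_)
  field_simp
  ring

/-- Bilinear estimate with off-diagonal decay for dyadic sectors. -/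
theorem lintegral_product_pow_four_le {N M : ℕ} (hN : 1 ≤ N) (hNM : N + 3 ≤ M)
    (hf : IsBump f E mE) (hg : IsBump g F mF) (hE : E ⊆ sector N) (hF : F ⊆ sector M)
    {r : ℝ} (hr0 : 0 ≤ r) (hr1 : r ≤ 1) :
    ∫⁻ y, ENNReal.ofReal ((‖extension f y‖ / mE * (‖extension g y‖ / mF)) ^ (4 : ℝ)) ≤
      ENNReal.ofReal (2 ^ 17 * Real.pi ^ 4 * (2 ^ N / 2 ^ M) * mE ^ (-(1 + r)) * mF⁻¹) := by
  have pE := hf.pos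
  have pF := hg.pos
  set u : SpaceTime → ℝ := fun y => ‖extension f y‖ / mE * (‖extension g y‖ / mF) with hu
  have hu0 : ∀ y, 0 ≤ u y := fun y => by positivity
  have hu1 : ∀ y, u y ≤ 1 := fun y => mul_le_one₀
    ((div_le_one pE).2 (hf.norm_extension_le y)) (by positivity)
    ((div_le_one pF).2 (hg.norm_extension_le y))
  have hum : Measurable u := ((measurable_extension hf.measurable).norm.div_const _).mul
    ((measurable_extension hg.measurable).norm.div_const _)
  have hlevel : ∀ t : ℝ, 0 < t → t < 1 → volume {y | t < u y} ≤
      ENNReal.ofReal (2 ^ 15 * Real.pi ^ 4 * (2 ^ N / 2 ^ M) * mE ^ (-(1 + r)) * mF⁻¹ *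
        t⁻¹ ^ 3) := by
    intro t ht ht1
    have hti : 1 ≤ t⁻¹ := (one_le_inv₀ ht).2 ht1.le
    have hcomm : ∀ X : ℝ, X ≤ t⁻¹ * mE ^ (-(1 + r)) →
        2048 * Real.pi ^ 4 * (2 ^ N / 2 ^ M) * t⁻¹ ^ 2 * 16 * mF⁻¹ * X ≤
        2 ^ 15 * Real.pi ^ 4 * (2 ^ N / 2 ^ M) * mE ^ (-(1 + r)) * mF⁻¹ * t⁻¹ ^ 3 := by
      intro X hX
      calc _ ≤ 2048 * Real.pi ^ 4 * (2 ^ N / 2 ^ M) * t⁻¹ ^ 2 * 16 * mF⁻¹ *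
            (t⁻¹ * mE ^ (-(1 + r))) := by gcongr
        _ = _ := by ring
    -- For mE ≥ 1 the largest a allowed by the mass condition is used, giving mE^(−2); for mE ≤ 1
    -- the choice a = 2^(−N) leaves no close pairs and gives mE^(−1). In both ranges the power
    -- −(1+r) dominates.
    rcases le_total 1 mE with h1 | h1
    · have := measure_product_gt_le hN hNM hf hg hE hF (a := t * mE / (16 * 2 ^ N)) (t := t)
        (by positivity) ht (Or.inr (le_of_eq (by field_simp)))
      refine this.trans (ENNReal.ofReal_le_ofReal ?_)
      refine le_trans (le_of_eq ?_) (hcomm (t⁻¹ * mE ^ (-2 : ℝ)) ?_)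
      · rw [Real.rpow_neg pE.le, Real.rpow_two]
        field_simp
      · gcongr
        linarith
    · have := measure_product_gt_le hN hNM hf hg hE hF (a := ((2 : ℝ) ^ N)⁻¹) (t := t)
        (by positivity) ht (Or.inl le_rfl)
      refine this.trans (ENNReal.ofReal_le_ofReal ?_)
      refine le_trans ?_ (hcomm mE⁻¹ ?_)
      · have : 0 ≤ 2048 * Real.pi ^ 4 * (2 ^ N / 2 ^ M) * t⁻¹ ^ 2 * mF⁻¹ * mE⁻¹ := by positivity
        calc _ = 2048 * Real.pi ^ 4 * (2 ^ N / 2 ^ M) * t⁻¹ ^ 2 * mF⁻¹ * mE⁻¹ := by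
              field_simp
          _ ≤ 16 * (2048 * Real.pi ^ 4 * (2 ^ N / 2 ^ M) * t⁻¹ ^ 2 * mF⁻¹ * mE⁻¹) := by linarith
          _ = _ := by ring
      · rw [← Real.rpow_neg_one]
        calc mE ^ (-1 : ℝ) ≤ mE ^ (-(1 + r)) :=
              Real.rpow_le_rpow_of_exponent_ge pE h1 (by linarith)
          _ ≤ _ := le_mul_of_one_le_left (by positivity) hti
  rw [lintegral_rpow_eq_lintegral_meas_lt_mul volume (Filter.Eventually.of_forall hu0)
    hum.aemeasurable (by norm_num)]
  set B := 2 ^ 15 * Real.pi ^ 4 * (2 ^ N / 2 ^ M) * mE ^ (-(1 + r)) * mF⁻¹ with hB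
  have hB0 : 0 ≤ B := by positivity
  -- In the layer cake formula for the fourth power, the weight t³ cancels the t^(−3) of the level
  -- sets exactly. Only t < 1 contributes because u ≤ 1.
  calc ENNReal.ofReal 4 * ∫⁻ t in Set.Ioi 0, volume {y | t < u y} *
        ENNReal.ofReal (t ^ ((4 : ℝ) - 1))
      ≤ ENNReal.ofReal 4 * ∫⁻ t in Set.Ioi 0, (Set.Ioo (0 : ℝ) 1).indicator
          (fun _ => ENNReal.ofReal B) t := by
        gcongr ENNReal.ofReal 4 * ?_
        refine setLIntegral_mono' measurableSet_Ioi fun t ht => ?_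
        have ht0 : 0 < t := ht
        by_cases ht1 : t < 1
        · rw [Set.indicator_of_mem (show t ∈ Set.Ioo (0 : ℝ) 1 from ⟨ht0, ht1⟩)]
          calc _ ≤ ENNReal.ofReal (B * t⁻¹ ^ 3) * ENNReal.ofReal (t ^ ((4 : ℝ) - 1)) := by
                gcongr; exact hlevel t ht0 ht1
            _ = _ := by
                rw [← ENNReal.ofReal_mul (by positivity)]
                congr 1
                rw [show (4 : ℝ) - 1 = (3 : ℕ) by norm_num, Real.rpow_natCast]
                field_simp
        · have : {y | t < u y} = ∅ := by
            ext y; simp only [Set.mem_ofPred_eq, Set.mem_empty_iff_false, iff_false, not_lt]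
            linarith [hu1 y]
          simp [this]
    _ = ENNReal.ofReal 4 * ENNReal.ofReal B := by
        congr 1
        rw [lintegral_indicator measurableSet_Ioo, setLIntegral_const,
          Measure.restrict_apply measurableSet_Ioo, Set.inter_eq_left.2 Set.Ioo_subset_Ioi_self,
          Real.volume_Ioo]
        simp
    _ = _ := by
        rw [← ENNReal.ofReal_mul (by norm_num), hB]
        congr 1; ring

end bilinear

/-! ### Consequences of the annular hypothesis for bumps. -/

/-- A bump has L^(p₀) norm at most m^(1/p₀); after division by m the exponent is q₀/p₀ − q₀ = −β.
The constant C + 1 is taken to be positive. -/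
lemma annular_moment {p₀ q₀ : ℝ≥0∞} (hann : AnnularExtension p₀ q₀) (hp0 : p₀ ≠ 0)
    (hp : p₀ ≠ ⊤) (hq0 : q₀ ≠ 0) (hq : q₀ ≠ ⊤) :
    ∃ C : ℝ, 0 < C ∧ ∀ N : ℕ, 1 ≤ N → ∀ f E m, IsBump f E m → E ⊆ annulus N →
      ∫⁻ y, ENNReal.ofReal ((‖extension f y‖ / m) ^ q₀.toReal) ≤
        ENNReal.ofReal (C * m ^ (-(q₀.toReal * (1 - p₀.toReal⁻¹)))) := by
  obtain ⟨C, hC⟩ := hann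
  have hq' : 0 < q₀.toReal := ENNReal.toReal_pos hq0 hq
  refine ⟨(C + 1 : ℝ) ^ q₀.toReal, by positivity, fun N hN f E m hf hE => ?_⟩
  have hm := hf.pos
  have h1 : eLpNorm f p₀ sigma ≤ ENNReal.ofReal (m ^ p₀.toReal⁻¹) := by
    calc eLpNorm f p₀ sigma ≤ eLpNorm (E.indicator (fun _ => (1 : ℝ))) p₀ sigma := by
          refine eLpNorm_mono fun z => ?_
          by_cases hz : z ∈ E
          · simpa [hz] using hf.norm_le z
          · simp [hz, hf.eq_zero z hz]
      _ = _ := by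
          rw [eLpNorm_indicator_const hf.measurableSet hp0 hp, hf.measure_eq,
            ENNReal.ofReal_rpow_of_pos hm]
          simp
  have hL : MemLp f p₀ sigma := ⟨hf.measurable.aestronglyMeasurable,
    h1.trans_lt ENNReal.ofReal_lt_top⟩
  have h2 := hC N hN f hf.measurable
    (fun z hz => hE (by_contra fun h => hz (hf.eq_zero z h))) hL
  have h3 : eLpNorm (extension f) q₀ volume ≤ ENNReal.ofReal ((C + 1) * m ^ p₀.toReal⁻¹) := by
    refine h2.trans ?_
    rw [ENNReal.ofReal_mul (by positivity)]
    refine mul_le_mul' ?_ h1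
    rw [← ENNReal.ofReal_coe_nnreal]
    exact ENNReal.ofReal_le_ofReal (by linarith)
  rw [eLpNorm_eq_lintegral_rpow_enorm_toReal hq0 hq, one_div,
    ENNReal.rpow_inv_le_iff hq', ENNReal.ofReal_rpow_of_pos (by positivity)] at h3
  have e : ∀ y, ENNReal.ofReal ((‖extension f y‖ / m) ^ q₀.toReal) =
      ENNReal.ofReal (m⁻¹ ^ q₀.toReal) * ‖extension f y‖ₑ ^ q₀.toReal := by
    intro y
    rw [div_eq_inv_mul, Real.mul_rpow (by positivity) (norm_nonneg _),
      ENNReal.ofReal_mul (by positivity), ← ENNReal.ofReal_rpow_of_nonneg (norm_nonneg _) hq'.le,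
      ofReal_norm]
  simp_rw [e]
  rw [lintegral_const_mul' _ _ ENNReal.ofReal_ne_top]
  refine (mul_le_mul' le_rfl h3).trans ?_
  rw [← ENNReal.ofReal_mul (by positivity)]
  refine ENNReal.ofReal_le_ofReal (le_of_eq ?_)
  rw [Real.mul_rpow (by positivity) (by positivity), ← Real.rpow_mul hm.le, Real.inv_rpow hm.le,
    ← Real.rpow_neg hm.le, mul_left_comm, ← Real.rpow_add hm]
  congr 2; ring

lemma sigma_sector_ne_top {N : ℕ} (hN : 1 ≤ N) : sigma (sector N) ≠ ⊤ := by
  refine ((measure_mono ?_).trans_lt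
    ((sigma_slope_le hN 0 (a := 2) (by norm_num)).trans_lt ENNReal.ofReal_lt_top)).ne
  intro z hz
  refine ⟨hz, ?_⟩
  have h0 := pos_of_mem_planeSector hz.2.2
  rw [sub_zero, slope, abs_div, abs_of_pos h0]
  exact lt_of_le_of_lt ((div_le_one h0).2 hz.2.2.2.2) (by norm_num)

/-- The box 0 < s < 1/2, 2^N < x < (3/2)·2^N lies over the sector, since |ξ| ≤ (5/4)x < 2^(N+1)
there, and x/⟨ξ⟩ ≥ 1/2 on it. -/
lemma le_sigma_sector {N : ℕ} (hN : 1 ≤ N) :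
    ENNReal.ofReal (2 ^ N / 8) ≤ sigma (sector N) := by
  have hb := measurable_bracket
  have hm := measurableSet_sector N
  have hm1 : Measurable ((sector N).indicator (1 : SpaceTime → ℝ≥0∞)) := measurable_one.indicator hm
  rw [← lintegral_indicator_one hm, lintegral_sigma_of_pos hm1]
  · rw [lintegral_plane_slope]
    · calc ENNReal.ofReal (2 ^ N / 8) = ∫⁻ s : ℝ, ∫⁻ x in Set.Ioi (0 : ℝ),
            (Set.Ioo (0 : ℝ) (1 / 2)).indicator 1 s *
              (Set.Ioo ((2 : ℝ) ^ N) (2 ^ N + 2 ^ N / 2)).indicator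
                (fun _ => ENNReal.ofReal (1 / 2)) x := by
            have hc (s : ℝ) := lintegral_const_mul (μ := volume.restrict (Set.Ioi (0 : ℝ)))
              ((Set.Ioo (0 : ℝ) (1 / 2)).indicator (1 : ℝ → ℝ≥0∞) s)
              ((measurable_const (a := ENNReal.ofReal (1 / 2))).indicator
                (measurableSet_Ioo (a := (2 : ℝ) ^ N) (b := 2 ^ N + 2 ^ N / 2)))
            have hsub : Set.Ioo ((2 : ℝ) ^ N) (2 ^ N + 2 ^ N / 2) ⊆ Set.Ioi 0 :=
              fun x hx => lt_trans (by positivity) hx.1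
            simp_rw [hc]
            rw [lintegral_mul_const _ (measurable_one.indicator measurableSet_Ioo),
              lintegral_indicator_one measurableSet_Ioo, lintegral_indicator measurableSet_Ioo,
              setLIntegral_const, Measure.restrict_apply measurableSet_Ioo,
              Set.inter_eq_left.2 hsub, Real.volume_Ioo, Real.volume_Ioo,
              ← ENNReal.ofReal_mul (by norm_num), ← ENNReal.ofReal_mul (by norm_num)]
            congr 1; ring
        _ ≤ _ := by
            refine lintegral_mono fun s => setLIntegral_mono' measurableSet_Ioi fun x hx => ?_
            have hx0 : 0 < x := hx
            by_cases h1 : s ∈ Set.Ioo (0 : ℝ) (1 / 2)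
            · by_cases h2 : x ∈ Set.Ioo ((2 : ℝ) ^ N) (2 ^ N + 2 ^ N / 2)
              · have hn := norm_sq_plane !₂[x, x * s]
                simp only [Matrix.cons_val_zero, Matrix.cons_val_one] at hn
                have hp2 : (0 : ℝ) < 2 ^ N := by positivity
                have hxs : (x * s) ^ 2 ≤ x ^ 2 / 4 := by
                  have hs4 : s ^ 2 ≤ 1 / 4 := by nlinarith [h1.1, h1.2]
                  rw [mul_pow]; nlinarith [sq_nonneg x]
                have n1 : x ≤ ‖(!₂[x, x * s] : Plane)‖ := le_of_sq_le_sq_of_nonneg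
                  (by nlinarith [sq_nonneg (x * s)]) (norm_nonneg _)
                have n2 : ‖(!₂[x, x * s] : Plane)‖ ≤ 5 / 4 * x := le_of_sq_le_sq_of_nonneg
                  (by nlinarith [sq_nonneg x]) (by positivity)
                have hp : !₂[x, x * s] ∈ planeSector N := by
                  refine ⟨h2.1.le.trans n1, ?_, ?_⟩
                  · rw [pow_succ]; linarith [h2.2]
                  · simp only [Matrix.cons_val_zero, Matrix.cons_val_one]
                    rw [abs_of_pos (mul_pos hx0 h1.1)]
                    nlinarith [h1.2]
                have hb1 := two_le_norm_of_mem hN hp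
                have hb2 := bracket_sq (ξ := !₂[x, x * s]) (by linarith)
                have hb3 := bracket_pos (ξ := !₂[x, x * s]) (by linarith)
                have hb4 : bracket !₂[x, x * s] ≤ ‖(!₂[x, x * s] : Plane)‖ :=
                  le_of_sq_le_sq_of_nonneg (by linarith) (norm_nonneg _)
                have hs : ((bracket !₂[x, x * s], !₂[x, x * s]) : SpaceTime) ∈ sector N := by
                  refine ⟨?_, hb3, hp⟩
                  simp only [hyperboloid, Set.mem_ofPred_eq]
                  linarith
                rw [Set.indicator_of_mem hs, Set.indicator_of_mem h1, Set.indicator_of_mem h2]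
                simp only [Pi.one_apply, mul_one, one_mul]
                rw [← ENNReal.ofReal_mul hx0.le]
                refine ENNReal.ofReal_le_ofReal ?_
                rw [mul_one_div, le_div_iff₀ hb3]; linarith
              · rw [Set.indicator_of_notMem h2, mul_zero]; simp
            · rw [Set.indicator_of_notMem h1, zero_mul]; simp
    · exact Measurable.mul (by fun_prop) (hm1.comp (by fun_prop))
    · intro ξ hξ
      rw [Set.indicator_of_notMem, mul_zero]
      exact fun h => absurd (pos_of_mem_planeSector h.2.2) (not_lt.2 hξ)
  · intro z hz
    exact Set.indicator_of_notMem (fun h => absurd h.2.1 (not_lt.2 hz)) _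
  · intro z hz
    refine Set.indicator_of_notMem (fun h => ?_) _
    have := two_le_norm_of_mem hN h.2.2
    linarith

lemma isBump_sector {N : ℕ} (hN : 1 ≤ N) :
    IsBump ((sector N).indicator 1) (sector N) (sigma (sector N)).toReal where
  measurable := measurable_one.indicator (measurableSet_sector N)
  measurableSet := measurableSet_sector N
  norm_le z := by by_cases h : z ∈ sector N <;> simp [h]
  eq_zero z hz := by simp [hz]
  pos := by
    refine ENNReal.toReal_pos ?_ (sigma_sector_ne_top hN)
    have := le_sigma_sector hN
    refine (lt_of_lt_of_le ?_ this).ne'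
    rw [ENNReal.ofReal_pos]; positivity
  measure_eq := (ENNReal.ofReal_toReal (sigma_sector_ne_top hN)).symm

lemma abs_fst_le_of_mem_hyperboloid {z : SpaceTime} (hz : z ∈ hyperboloid) : |z.1| ≤ ‖z.2‖ := by
  have : 1 + z.1 ^ 2 = ‖z.2‖ ^ 2 := hz
  refine le_of_sq_le_sq_of_nonneg ?_ (norm_nonneg _)
  rw [sq_abs]; linarith

lemma abs_pairing_le (y z : SpaceTime) : |pairing y z| ≤ ‖y‖ * (|z.1| + ‖z.2‖) := by
  unfold pairing
  have h1 : |y.1| ≤ ‖y‖ := norm_fst_le y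
  have h2 : ‖y.2‖ ≤ ‖y‖ := norm_snd_le y
  calc _ ≤ |y.1 * z.1| + |inner ℝ y.2 z.2| := abs_add_le _ _
    _ ≤ |y.1| * |z.1| + ‖y.2‖ * ‖z.2‖ := by
      rw [abs_mul]; gcongr; exact abs_real_inner_le_norm _ _
    _ ≤ ‖y‖ * |z.1| + ‖y‖ * ‖z.2‖ := by gcongr
    _ = _ := by ring

/-- On this ball the phase is at most 1/2 throughout the sector, where |τ| + |ξ| ≤ 4·2^N, so there
is no cancellation. -/
lemma half_le_extension_sector {N : ℕ} (hN : 1 ≤ N) {y : SpaceTime}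
    (hy : ‖y‖ ≤ (8 * 2 ^ N)⁻¹) :
    1 / 2 ≤ ‖extension ((sector N).indicator 1) y‖ / (sigma (sector N)).toReal := by
  have hb := isBump_sector hN
  have hm := measurableSet_sector N
  set m := (sigma (sector N)).toReal with hmdef
  have h1 : extension ((sector N).indicator 1) y - m =
      ∫ z in sector N, (Complex.exp (Complex.I * (pairing y z : ℂ)) - 1) ∂sigma := by
    have e1 : extension ((sector N).indicator 1) y =
        ∫ z in sector N, Complex.exp (Complex.I * (pairing y z : ℂ)) ∂sigma := by
      unfold extension
      rw [← integral_indicator hm]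
      congr 1; ext z
      by_cases hz : z ∈ sector N <;> simp [hz]
    have hfin : sigma.real (sector N) = m := rfl
    have : IsFiniteMeasure (sigma.restrict (sector N)) :=
      ⟨by rw [Measure.restrict_apply_univ]; exact (sigma_sector_ne_top hN).lt_top⟩
    have hi := (integrable_cexp_mul hb.integrable y)
    have hi' : Integrable (fun z => Complex.exp (Complex.I * (pairing y z : ℂ)))
        (sigma.restrict (sector N)) := by
      rw [← IntegrableOn, ← integrable_indicator_iff hm]
      refine hi.congr (Filter.Eventually.of_forall fun z => ?_)
      by_cases hz : z ∈ sector N <;> simp [hz]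
    rw [e1, integral_sub hi' (integrable_const _)]
    simp [hfin]
  have h2 : ‖extension ((sector N).indicator 1) y - m‖ ≤ 1 / 2 * m := by
    rw [h1]
    refine norm_setIntegral_le_of_norm_le_const (sigma_sector_ne_top hN).lt_top fun z hz => ?_
    refine (Real.norm_exp_I_mul_ofReal_sub_one_le).trans ?_
    have h4 := abs_fst_le_of_mem_hyperboloid hz.1
    have h5 := hz.2.2.2.1
    rw [Real.norm_eq_abs]
    calc |pairing y z| ≤ ‖y‖ * (|z.1| + ‖z.2‖) := abs_pairing_le y z
      _ ≤ (8 * 2 ^ N)⁻¹ * (2 ^ (N + 1) + 2 ^ (N + 1)) := by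
        gcongr; exact h4.trans h5.le
      _ = 1 / 2 := by rw [pow_succ]; field_simp; norm_num
  have h3 := norm_sub_norm_le (m : ℂ) (extension ((sector N).indicator 1) y)
  have hp := hb.pos
  rw [norm_sub_rev, Complex.norm_real, Real.norm_of_nonneg hp.le] at h3
  rw [le_div_iff₀ hp]
  linarith

/-- The uniform annular estimate forces the exponents to satisfy the scaling condition
of the cone. -/
lemma scaling_condition {q C β : ℝ} (hq : 0 < q) (hC : 0 < C) (hβ0 : 0 ≤ β)
    (h : ∀ N : ℕ, 1 ≤ N → ∀ f E m, IsBump f E m → E ⊆ annulus N →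
      ∫⁻ y, ENNReal.ofReal ((‖extension f y‖ / m) ^ q) ≤ ENNReal.ofReal (C * m ^ (-β))) :
    β ≤ 3 := by
  set V := (volume (Metric.closedBall (0 : SpaceTime) 1)).toReal with hV
  have hVtop : volume (Metric.closedBall (0 : SpaceTime) 1) ≠ ⊤ :=
    measure_closedBall_lt_top.ne
  have hV0 : 0 < V := ENNReal.toReal_pos (Metric.measure_closedBall_pos _ _ one_pos).ne' hVtop
  have hdim : Module.finrank ℝ SpaceTime = 3 := by simp
  -- The extension is at least half its maximal size on a ball of volume comparable to 2^(−3N),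
  -- while m is at least 2^N/8. Hence 2^(−3N) ≲ 2^(−βN).
  have key : ∀ N : ℕ, 1 ≤ N → (1 / 2) ^ q * ((8 * 2 ^ N)⁻¹ ^ 3 * V) ≤ C * (2 ^ N / 8) ^ (-β) := by
    intro N hN
    have hb := isBump_sector hN
    have h1 := h N hN _ _ _ hb (sector_subset_annulus N)
    set δ : ℝ := (8 * 2 ^ N)⁻¹ with hδ
    have h2 : ENNReal.ofReal ((1 / 2) ^ q * (δ ^ 3 * V)) ≤ ∫⁻ y, ENNReal.ofReal
        ((‖extension ((sector N).indicator 1) y‖ / (sigma (sector N)).toReal) ^ q) := by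
      calc _ = ENNReal.ofReal ((1 / 2) ^ q) * volume (Metric.closedBall (0 : SpaceTime) δ) := by
            rw [Measure.addHaar_closedBall' _ _ (by positivity), hdim,
              ENNReal.ofReal_mul (by positivity), ENNReal.ofReal_mul (by positivity), hV,
              ENNReal.ofReal_toReal hVtop]
        _ = ∫⁻ y in Metric.closedBall (0 : SpaceTime) δ, ENNReal.ofReal ((1 / 2) ^ q) := by
            rw [setLIntegral_const]
        _ ≤ ∫⁻ y in Metric.closedBall (0 : SpaceTime) δ, ENNReal.ofReal
            ((‖extension ((sector N).indicator 1) y‖ / (sigma (sector N)).toReal) ^ q) := by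
            refine setLIntegral_mono' measurableSet_closedBall fun y hy => ?_
            refine ENNReal.ofReal_le_ofReal (Real.rpow_le_rpow (by norm_num) ?_ hq.le)
            exact half_le_extension_sector hN (mem_closedBall_zero_iff.1 hy)
        _ ≤ _ := setLIntegral_le_lintegral _ _
    have hp := hb.pos
    have h3 := (ENNReal.ofReal_le_ofReal_iff (by positivity)).1 (h2.trans h1)
    refine h3.trans ?_
    have h4 : 2 ^ N / 8 ≤ (sigma (sector N)).toReal := by
      have := ENNReal.toReal_mono (sigma_sector_ne_top hN) (le_sigma_sector hN)
      rwa [ENNReal.toReal_ofReal (by positivity)] at this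
    gcongr ?_ * ?_
    exact Real.rpow_le_rpow_of_nonpos (by positivity) h4 (by linarith)
  by_contra hcon
  push Not at hcon
  have hlim : Filter.Tendsto (fun N : ℕ => ((2 : ℝ) ^ (β - 3)) ^ N) Filter.atTop Filter.atTop :=
    tendsto_pow_atTop_atTop_of_one_lt (Real.one_lt_rpow (by norm_num) (by linarith))
  set B := C * 8 ^ β * 8 ^ 3 / ((1 / 2) ^ q * V) with hB
  obtain ⟨N, hN1, hN2⟩ := ((Filter.tendsto_atTop.1 hlim (B + 1)).and
    (Filter.eventually_ge_atTop 1)).exists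
  have h1 := key N hN2
  have e1 : ((2 : ℝ) ^ (β - 3)) ^ N = ((2 : ℝ) ^ N) ^ β / (2 ^ N) ^ 3 := by
    rw [← Real.rpow_natCast, ← Real.rpow_mul (by norm_num), ← Real.rpow_natCast,
      ← Real.rpow_natCast, ← Real.rpow_mul (by norm_num), ← Real.rpow_mul (by norm_num),
      ← Real.rpow_sub (by norm_num)]
    congr 1; push_cast; ring
  have h2 : ((2 : ℝ) ^ N) ^ β / (2 ^ N) ^ 3 ≤ B := by
    rw [Real.rpow_neg (by positivity), Real.div_rpow (x := (2 : ℝ) ^ N) (by positivity)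
      (by norm_num), inv_div, mul_inv, mul_pow] at h1
    rw [hB, div_le_div_iff₀ (by positivity) (by positivity)]
    have hx : 0 < ((2 : ℝ) ^ N) ^ β := by positivity
    have h5 := mul_le_mul_of_nonneg_right h1 (show 0 ≤ ((2 : ℝ) ^ N) ^ β * (2 ^ N) ^ 3 * 8 ^ 3 by
      positivity)
    calc _ = (1 / 2) ^ q * ((8 : ℝ)⁻¹ ^ 3 * ((2 : ℝ) ^ N)⁻¹ ^ 3 * V) *
          (((2 : ℝ) ^ N) ^ β * (2 ^ N) ^ 3 * 8 ^ 3) := by field_simp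
      _ ≤ _ := h5
      _ = _ := by field_simp
  linarith

/-! ### Interpolation: the bilinear L^(q/2) estimate with decay. -/

lemma lintegral_rpow_mul_rpow_mul_rpow_le {X : Type*} [MeasurableSpace X] {μ : Measure X}
    {F₁ F₂ F₃ : X → ℝ≥0∞} (h₁ : Measurable F₁) (h₂ : Measurable F₂) (h₃ : Measurable F₃)
    {a b c : ℝ} (ha : 0 ≤ a) (hb : 0 ≤ b) (hc : 0 ≤ c) (habc : a + b + c = 1) :
    ∫⁻ x, F₁ x ^ a * F₂ x ^ b * F₃ x ^ c ∂μ ≤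
      (∫⁻ x, F₁ x ∂μ) ^ a * (∫⁻ x, F₂ x ∂μ) ^ b * (∫⁻ x, F₃ x ∂μ) ^ c := by
  have h := ENNReal.lintegral_prod_norm_pow_le (μ := μ) (Finset.univ : Finset (Fin 3))
    (f := ![F₁, F₂, F₃]) (p := ![a, b, c])
    (fun i _ => by fin_cases i <;> simp <;> fun_prop)
    (by simpa [Fin.sum_univ_three] using habc)
    (fun i _ => by fin_cases i <;> simpa)
  simpa [Fin.prod_univ_three] using h

lemma holder_exponents {C e₁ e₂ e₃ a b c : ℝ} (hC : 0 < C) {I₁ I₂ I₃ : ℝ≥0∞}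
    (h₁ : I₁ ≤ ENNReal.ofReal (C * 2 ^ e₁)) (h₂ : I₂ ≤ ENNReal.ofReal (C * 2 ^ e₂))
    (h₃ : I₃ ≤ ENNReal.ofReal (C * 2 ^ e₃)) (ha : 0 ≤ a) (hb : 0 ≤ b) (hc : 0 ≤ c)
    (habc : a + b + c = 1) :
    I₁ ^ a * I₂ ^ b * I₃ ^ c ≤ ENNReal.ofReal (C * 2 ^ (a * e₁ + b * e₂ + c * e₃)) := by
  calc I₁ ^ a * I₂ ^ b * I₃ ^ c ≤ ENNReal.ofReal (C * 2 ^ e₁) ^ a *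
        ENNReal.ofReal (C * 2 ^ e₂) ^ b * ENNReal.ofReal (C * 2 ^ e₃) ^ c := by gcongr
    _ = _ := by
      rw [ENNReal.ofReal_rpow_of_pos (by positivity), ENNReal.ofReal_rpow_of_pos (by positivity),
        ENNReal.ofReal_rpow_of_pos (by positivity), ← ENNReal.ofReal_mul (by positivity),
        ← ENNReal.ofReal_mul (by positivity)]
      congr 1
      rw [Real.mul_rpow hC.le (by positivity), Real.mul_rpow hC.le (by positivity),
        Real.mul_rpow hC.le (by positivity), ← Real.rpow_mul (by norm_num),
        ← Real.rpow_mul (by norm_num), ← Real.rpow_mul (by norm_num)]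
      calc _ = (C ^ a * C ^ b * C ^ c) * ((2 : ℝ) ^ (e₁ * a) * 2 ^ (e₂ * b) * 2 ^ (e₃ * c)) := by
            ring
        _ = _ := by
          rw [← Real.rpow_add hC, ← Real.rpow_add hC, habc, Real.rpow_one,
            ← Real.rpow_add (by norm_num), ← Real.rpow_add (by norm_num)]
          congr 2; ring

/-- Hölder interpolation between two one-function bounds and a bound for the product. -/
lemma lintegral_product_rpow_le {u v : SpaceTime → ℝ} (hu : Measurable u) (hv : Measurable v)
    (hu0 : ∀ y, 0 ≤ u y) (hu1 : ∀ y, u y ≤ 1) (hv0 : ∀ y, 0 ≤ v y) (hv1 : ∀ y, v y ≤ 1)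
    {q₀ q C e₁ e₂ e₃ a b c : ℝ} (hC : 0 < C)
    (h₁ : ∫⁻ y, ENNReal.ofReal (u y ^ q₀) ≤ ENNReal.ofReal (C * 2 ^ e₁))
    (h₂ : ∫⁻ y, ENNReal.ofReal (v y ^ q₀) ≤ ENNReal.ofReal (C * 2 ^ e₂))
    (h₃ : c = 0 ∨ ∫⁻ y, ENNReal.ofReal ((u y * v y) ^ (4 : ℝ)) ≤ ENNReal.ofReal (C * 2 ^ e₃))
    (ha : 0 ≤ a) (hb : 0 ≤ b) (hc : 0 ≤ c) (habc : a + b + c = 1) (hq₀ : 0 < q₀)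
    (hqa : q₀ * a + 4 * c ≤ q / 2) (hqb : q₀ * b + 4 * c ≤ q / 2) :
    ∫⁻ y, ENNReal.ofReal ((u y * v y) ^ (q / 2)) ≤
      ENNReal.ofReal (C * 2 ^ (a * e₁ + b * e₂ + c * e₃)) := by
  have key : ∀ {x t s : ℝ}, 0 ≤ x → x ≤ 1 → 0 ≤ t → t ≤ s → x ^ s ≤ x ^ t :=
    fun hx0 hx1 ht hts => Real.rpow_le_rpow_of_exponent_ge_of_imp hx0 hx1 hts
      (fun hx h => by linarith)
  -- Because u, v ≤ 1, raising the exponent decreases the power; the Hölder exponents therefore only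
  -- need to stay below q/2.
  have hpt : ∀ y, ENNReal.ofReal ((u y * v y) ^ (q / 2)) ≤
      ENNReal.ofReal (u y ^ q₀) ^ a * ENNReal.ofReal (v y ^ q₀) ^ b *
        ENNReal.ofReal ((u y * v y) ^ (4 : ℝ)) ^ c := by
    intro y
    have pu := hu0 y
    have pv := hv0 y
    rw [ENNReal.ofReal_rpow_of_nonneg (by positivity) ha,
      ENNReal.ofReal_rpow_of_nonneg (by positivity) hb,
      ENNReal.ofReal_rpow_of_nonneg (by positivity) hc, ← ENNReal.ofReal_mul (by positivity),
      ← ENNReal.ofReal_mul (by positivity)]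
    refine ENNReal.ofReal_le_ofReal ?_
    rw [← Real.rpow_mul pu, ← Real.rpow_mul pv, ← Real.rpow_mul (by positivity),
      Real.mul_rpow pu pv, Real.mul_rpow pu pv]
    calc u y ^ (q / 2) * v y ^ (q / 2) ≤ u y ^ (q₀ * a + 4 * c) * v y ^ (q₀ * b + 4 * c) := by
          exact mul_le_mul (key pu (hu1 y) (by positivity) hqa)
            (key pv (hv1 y) (by positivity) hqb) (by positivity) (by positivity)
      _ = _ := by
          rw [Real.rpow_add_of_nonneg pu (by positivity) (by positivity),
            Real.rpow_add_of_nonneg pv (by positivity) (by positivity)]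
          ring
  refine (lintegral_mono hpt).trans ?_
  refine (lintegral_rpow_mul_rpow_mul_rpow_le (hu.pow_const q₀).ennreal_ofReal
    (hv.pow_const q₀).ennreal_ofReal ((hu.mul hv).pow_const 4).ennreal_ofReal ha hb hc habc).trans ?_
  -- For c = 0 the third factor is 1 even when its integral is infinite.
  rcases h₃ with h₃ | h₃
  · subst h₃
    simp only [ENNReal.rpow_zero, mul_one, zero_mul, add_zero]
    have := holder_exponents (e₃ := 0) (c := 0) hC h₁ h₂ (le_refl _) ha hb le_rfl habc
    simpa using this
  · exact holder_exponents hC h₁ h₂ h₃ ha hb hc habc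

/-- Bilinear `L^(q/2)` estimate with decay in the ratio of the scales and of the measures. -/
theorem exists_bilinear_bound {q₀ q β C : ℝ} (hβ2 : 2 ≤ β) (hβ3 : β ≤ 3) (hq₀ : 0 < q₀)
    (hq : q₀ < q) (hC : 0 < C)
    (hA : ∀ N : ℕ, 1 ≤ N → ∀ f E m, IsBump f E m → E ⊆ annulus N →
      ∫⁻ y, ENNReal.ofReal ((‖extension f y‖ / m) ^ q₀) ≤ ENNReal.ofReal (C * m ^ (-β))) :
    ∃ C' δ : ℝ, 0 < C' ∧ 0 < δ ∧ ∀ N M : ℕ, 1 ≤ N → 1 ≤ M → ∀ (f g : SpaceTime → ℂ)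
      (E F : Set SpaceTime) (μ ν : ℝ), IsBump f E (2 ^ μ) → IsBump g F (2 ^ ν) →
      E ⊆ sector N → F ⊆ sector M →
      ∫⁻ y, ENNReal.ofReal ((‖extension f y‖ / 2 ^ μ * (‖extension g y‖ / 2 ^ ν)) ^ (q / 2)) ≤
        ENNReal.ofReal (C' * 2 ^ (-(β / 2) * (μ + ν) - δ * |(N : ℝ) - M| - δ * |μ - ν|)) := by
  -- The strict inequality q > q₀ leaves room for a Hölder weight δ on the L⁴ bound together with a
  -- tilt of the other two weights.
  set δ : ℝ := min (1 / 8) ((q - q₀) / (2 * (q₀ + 4))) with hδ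
  have hδ0 : 0 < δ := lt_min (by norm_num) (div_pos (by linarith) (by linarith))
  have hδ8 : δ ≤ 1 / 8 := min_le_left _ _
  have hδq : δ * (2 * (q₀ + 4)) ≤ q - q₀ := by
    rw [← le_div_iff₀ (by linarith)]; exact min_le_right _ _
  set D : ℝ := C + 2 ^ 17 * Real.pi ^ 4 with hD
  have hD0 : 0 < D := by positivity
  have hβ0 : 0 < β := by linarith
  have hAD : ∀ N : ℕ, 1 ≤ N → ∀ f E (μ : ℝ), IsBump f E (2 ^ μ) → E ⊆ sector N →
      ∫⁻ y, ENNReal.ofReal ((‖extension f y‖ / 2 ^ μ) ^ q₀) ≤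
        ENNReal.ofReal (D * 2 ^ (-β * μ)) := by
    intro N hN f E μ hf hE
    refine (hA N hN f E _ hf (hE.trans (sector_subset_annulus N))).trans ?_
    refine ENNReal.ofReal_le_ofReal ?_
    rw [← Real.rpow_mul (by norm_num), show μ * -β = -β * μ by ring]
    gcongr
    rw [hD]; have : 0 < 2 ^ 17 * Real.pi ^ 4 := by positivity
    linarith
  have main : ∀ N M : ℕ, 1 ≤ N → N ≤ M → ∀ (f g : SpaceTime → ℂ)
      (E F : Set SpaceTime) (μ ν : ℝ), IsBump f E (2 ^ μ) → IsBump g F (2 ^ ν) →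
      E ⊆ sector N → F ⊆ sector M →
      ∫⁻ y, ENNReal.ofReal ((‖extension f y‖ / 2 ^ μ * (‖extension g y‖ / 2 ^ ν)) ^ (q / 2)) ≤
        ENNReal.ofReal (2 * D * 2 ^ (-(β / 2) * (μ + ν) - δ * ((M : ℝ) - N) - δ * |μ - ν|)) := by
    intro N M hN hNM f g E F μ ν hf hg hE hF
    -- τ is the sign of μ − ν. Tilting the two linear weights by ±τδ/β produces the decay δ|μ − ν|.
    obtain ⟨τ, hτ, hτ1⟩ : ∃ τ : ℝ, τ * (μ - ν) = |μ - ν| ∧ |τ| ≤ 1 := by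
      rcases le_total 0 (μ - ν) with h | h
      · exact ⟨1, by rw [abs_of_nonneg h, one_mul], by simp⟩
      · exact ⟨-1, by rw [abs_of_nonpos h]; ring, by simp⟩
    have hτa := abs_le.1 hτ1
    have hinv : β⁻¹ ≤ 1 / 2 := by
      rw [one_div]; exact inv_anti₀ (by norm_num) hβ2
    have hinv0 : 0 < β⁻¹ := by positivity
    have hδi : δ * β⁻¹ ≤ δ / 2 := by nlinarith
    have hδi0 : 0 < δ * β⁻¹ := by positivity
    have ht1 : -(δ / 2) ≤ τ * (δ * β⁻¹) := by nlinarith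
    have ht2 : τ * (δ * β⁻¹) ≤ δ / 2 := by nlinarith
    have hββ : β * β⁻¹ = 1 := mul_inv_cancel₀ hβ0.ne'
    have hu0 : ∀ y, 0 ≤ ‖extension f y‖ / 2 ^ μ := fun y => by positivity
    have hv0 : ∀ y, 0 ≤ ‖extension g y‖ / 2 ^ ν := fun y => by positivity
    have hu1 : ∀ y, ‖extension f y‖ / 2 ^ μ ≤ 1 :=
      fun y => (div_le_one hf.pos).2 (hf.norm_extension_le y)
    have hv1 : ∀ y, ‖extension g y‖ / 2 ^ ν ≤ 1 :=
      fun y => (div_le_one hg.pos).2 (hg.norm_extension_le y)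
    have hum := (measurable_extension hf.measurable).norm.div_const ((2 : ℝ) ^ μ)
    have hvm := (measurable_extension hg.measurable).norm.div_const ((2 : ℝ) ^ ν)
    by_cases hcase : N + 3 ≤ M
    -- With r = β − 2, which lies in [0, 1], the powers of the two measures add up to −β, as in the
    -- linear bounds.
    · have h₃ := lintegral_product_pow_four_le hN hcase hf hg hE hF (r := β - 2) (by linarith)
        (by linarith)
      have h₃' : ∫⁻ y, ENNReal.ofReal ((‖extension f y‖ / 2 ^ μ * (‖extension g y‖ / 2 ^ ν)) ^
          (4 : ℝ)) ≤ ENNReal.ofReal (D * 2 ^ (((N : ℝ) - M) - (β - 1) * μ - ν)) := by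
        refine h₃.trans (ENNReal.ofReal_le_ofReal ?_)
        have e1 : (2 : ℝ) ^ (((N : ℝ) - M) - (β - 1) * μ - ν) =
            2 ^ N / 2 ^ M * ((2 : ℝ) ^ μ) ^ (-(1 + (β - 2))) * ((2 : ℝ) ^ ν)⁻¹ := by
          rw [Real.rpow_sub (by norm_num), Real.rpow_sub (by norm_num),
            Real.rpow_sub (by norm_num), Real.rpow_natCast, Real.rpow_natCast,
            ← Real.rpow_mul (by norm_num), show μ * -(1 + (β - 2)) = -((β - 1) * μ) by ring,
            Real.rpow_neg (by norm_num)]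
          rw [div_eq_mul_inv, div_eq_mul_inv (2 ^ N / 2 ^ M : ℝ)]
        rw [e1]
        calc _ = 2 ^ 17 * Real.pi ^ 4 *
              (2 ^ N / 2 ^ M * ((2 : ℝ) ^ μ) ^ (-(1 + (β - 2))) * ((2 : ℝ) ^ ν)⁻¹) := by ring
          _ ≤ _ := by
            gcongr
            rw [hD]; linarith
      -- The corrections δ(1 − 1/β) and δ/β cancel the uneven powers β − 1 and 1 of the measures in
      -- the L⁴ bound, leaving the symmetric main term −(β/2)(μ + ν).
      have h := lintegral_product_rpow_le hum hvm hu0 hu1 hv0 hv1 (q := q)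
        (a := 1 / 2 - δ * (1 - β⁻¹) + τ * (δ * β⁻¹)) (b := 1 / 2 - δ * β⁻¹ - τ * (δ * β⁻¹)) (c := δ)
        hD0 (hAD N hN f E μ hf hE) (hAD M (by omega) g F ν hg hF) (Or.inr h₃')
        (by nlinarith) (by nlinarith) hδ0.le (by ring) hq₀ (by nlinarith) (by nlinarith)
      refine h.trans (ENNReal.ofReal_le_ofReal ?_)
      refine le_trans (le_of_eq ?_) (mul_le_mul_of_nonneg_right (show D ≤ 2 * D by linarith)
        (Real.rpow_nonneg (by norm_num) _))
      · congr 2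
        · rw [← hτ]
          linear_combination (δ * μ + δ * ν + δ * τ * ν - δ * τ * μ - 2 * δ * μ) * hββ
    -- For scales at most two apart the decay in the scales is absorbed by the factor 2, and tilted
    -- Hölder alone gives decay in |μ − ν|.
    · have h := lintegral_product_rpow_le hum hvm hu0 hu1 hv0 hv1 (q := q) (e₃ := 0)
        (a := 1 / 2 + τ * (δ * β⁻¹)) (b := 1 / 2 - τ * (δ * β⁻¹)) (c := 0)
        hD0 (hAD N hN f E μ hf hE) (hAD M (by omega) g F ν hg hF) (Or.inl rfl)
        (by linarith) (by linarith) le_rfl (by ring) hq₀ (by nlinarith) (by nlinarith)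
      refine h.trans (ENNReal.ofReal_le_ofReal ?_)
      have hd : (M : ℝ) - N ≤ 2 := by
        have : M ≤ N + 2 := by omega
        have : (M : ℝ) ≤ N + 2 := by exact_mod_cast this
        linarith
      have e : (1 / 2 + τ * (δ * β⁻¹)) * (-β * μ) + (1 / 2 - τ * (δ * β⁻¹)) * (-β * ν) + 0 * 0 ≤
          1 + (-(β / 2) * (μ + ν) - δ * ((M : ℝ) - N) - δ * |μ - ν|) := by
        have e1 : (1 / 2 + τ * (δ * β⁻¹)) * (-β * μ) + (1 / 2 - τ * (δ * β⁻¹)) * (-β * ν) + 0 * 0 =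
          -(β / 2) * (μ + ν) - δ * (τ * (μ - ν)) := by
          linear_combination (δ * τ * ν - δ * τ * μ) * hββ
        rw [e1, hτ]
        nlinarith
      calc _ ≤ D * 2 ^ (1 + (-(β / 2) * (μ + ν) - δ * ((M : ℝ) - N) - δ * |μ - ν|)) :=
            mul_le_mul_of_nonneg_left (Real.rpow_le_rpow_of_exponent_le (by norm_num) e) hD0.le
        _ = _ := by
            rw [Real.rpow_add (by norm_num), Real.rpow_one]; ring
  refine ⟨2 * D, δ, by positivity, hδ0, fun N M hN hM f g E F μ ν hf hg hE hF => ?_⟩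
  rcases le_total N M with h | h
  · have := main N M hN h f g E F μ ν hf hg hE hF
    rwa [abs_sub_comm (N : ℝ), abs_of_nonneg (show (0 : ℝ) ≤ (M : ℝ) - N by
      have : (N : ℝ) ≤ M := by exact_mod_cast h
      linarith)]
  · have := main M N hM h g f F E ν μ hg hf hF hE
    rw [abs_of_nonneg (show (0 : ℝ) ≤ (N : ℝ) - M by
      have : (M : ℝ) ≤ N := by exact_mod_cast h
      linarith), abs_sub_comm μ, add_comm μ]
    simpa only [mul_comm (‖extension g _‖ / 2 ^ ν)] using this

/-! ### Summation over a lattice with off-diagonal decay. -/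

/-- The `ℓ¹` length on the lattice of scales and heights. -/
noncomputable def latticeLength (i : ℤ × ℤ) : ℝ := |(i.1 : ℝ)| + |(i.2 : ℝ)|

noncomputable def latticeWeight (c : ℝ) (i : ℤ × ℤ) : ℝ≥0∞ :=
  ENNReal.ofReal (2 ^ (c * latticeLength i))

lemma latticeWeight_mul_neg (c : ℝ) (i : ℤ × ℤ) :
    latticeWeight (-c) i * latticeWeight c i = 1 := by
  unfold latticeWeight
  rw [← ENNReal.ofReal_mul (by positivity), ← Real.rpow_add (by norm_num)]
  simp

lemma tsum_int_weight_ne_top {c : ℝ} (hc : 0 < c) :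
    ∑' n : ℤ, ENNReal.ofReal (2 ^ (-c * |(n : ℝ)|)) ≠ ⊤ := by
  have hs : Summable fun n : ℤ => (2 : ℝ) ^ (-c * |(n : ℝ)|) := by
    have h : Summable fun n : ℕ => ((2 : ℝ) ^ (-c)) ^ n :=
      summable_geometric_of_lt_one (by positivity)
        (Real.rpow_lt_one_of_one_lt_of_neg (by norm_num) (by linarith))
    have e : ∀ n : ℕ, ((2 : ℝ) ^ (-c)) ^ n = (2 : ℝ) ^ (-c * (n : ℝ)) := fun n => by
      rw [← Real.rpow_natCast, ← Real.rpow_mul (by norm_num)]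
    simp_rw [e] at h
    refine Summable.of_nat_of_neg ?_ ?_ <;> simpa using h
  rw [← ENNReal.ofReal_tsum_of_nonneg (fun n => by positivity) hs]
  exact ENNReal.ofReal_ne_top

lemma tsum_latticeWeight_ne_top {c : ℝ} (hc : 0 < c) : ∑' i, latticeWeight (-c) i ≠ ⊤ := by
  have e : ∀ n k : ℤ, latticeWeight (-c) (n, k) =
      ENNReal.ofReal (2 ^ (-c * |(n : ℝ)|)) * ENNReal.ofReal (2 ^ (-c * |(k : ℝ)|)) := by
    intro n k
    rw [← ENNReal.ofReal_mul (by positivity), ← Real.rpow_add (by norm_num), latticeWeight,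
      latticeLength]
    congr 2; ring
  rw [ENNReal.tsum_prod' (f := latticeWeight (-c))]
  simp_rw [e, ENNReal.tsum_mul_left, ENNReal.tsum_mul_right]
  exact ENNReal.mul_ne_top (tsum_int_weight_ne_top hc) (tsum_int_weight_ne_top hc)

lemma tsum_latticeWeight_sub (c : ℝ) (j : ℤ × ℤ) :
    ∑' i, latticeWeight c (i - j) = ∑' i, latticeWeight c i :=
  (Equiv.subRight j).tsum_eq (latticeWeight c)

lemma tsum_latticeWeight_sub' (c : ℝ) (i : ℤ × ℤ) :
    ∑' j, latticeWeight c (i - j) = ∑' j, latticeWeight c j :=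
  (Equiv.subLeft i).tsum_eq (latticeWeight c)

/-- Let j maximize h on S. Then h i ^ q ≤ (h i · h j)^(q/2) for every i in S, so the sum is
controlled by interactions with j alone; the weights centred at j make the passage from a sum to a
sum of q-th powers summable. -/
lemma sum_rpow_le (h : ℤ × ℤ → ℝ≥0∞) {c q : ℝ} (hq : 0 < q) (S : Finset (ℤ × ℤ)) :
    (∑ i ∈ S, h i) ^ q ≤ (∑' i, latticeWeight (-c) i) ^ q *
      ∑' i, ∑' j, (h i * h j) ^ (q / 2) * latticeWeight c (i - j) ^ q := by
  rcases S.eq_empty_or_nonempty with rfl | hS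
  · simp [ENNReal.zero_rpow_of_pos hq]
  obtain ⟨j, -, hj⟩ := S.exists_max_image h hS
  set W := ∑' i, (latticeWeight c (i - j) * h i) ^ q * if i ∈ S then 1 else 0 with hW
  have h1 : ∀ i ∈ S, latticeWeight c (i - j) * h i ≤ W ^ q⁻¹ := by
    intro i hi
    rw [ENNReal.le_rpow_inv_iff hq]
    refine le_trans ?_ (ENNReal.le_tsum i)
    simp [hi]
  have h2 : ∑ i ∈ S, h i ≤ (∑' i, latticeWeight (-c) i) * W ^ q⁻¹ := by
    calc ∑ i ∈ S, h i = ∑ i ∈ S, latticeWeight (-c) (i - j) * (latticeWeight c (i - j) * h i) := by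
          refine Finset.sum_congr rfl fun i _ => ?_
          rw [← mul_assoc, latticeWeight_mul_neg, one_mul]
      _ ≤ ∑ i ∈ S, latticeWeight (-c) (i - j) * W ^ q⁻¹ :=
          Finset.sum_le_sum fun i hi => mul_le_mul' le_rfl (h1 i hi)
      _ = (∑ i ∈ S, latticeWeight (-c) (i - j)) * W ^ q⁻¹ := by rw [Finset.sum_mul]
      _ ≤ _ := by
          gcongr
          rw [← tsum_latticeWeight_sub _ j]
          exact ENNReal.sum_le_tsum S
  calc (∑ i ∈ S, h i) ^ q ≤ ((∑' i, latticeWeight (-c) i) * W ^ q⁻¹) ^ q := by gcongr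
    _ = (∑' i, latticeWeight (-c) i) ^ q * W := by
        rw [ENNReal.mul_rpow_of_nonneg _ _ hq.le, ENNReal.rpow_inv_rpow hq.ne']
    _ ≤ _ := by
        gcongr
        refine ENNReal.tsum_le_tsum fun i => ?_
        refine le_trans ?_ (ENNReal.le_tsum j)
        by_cases hi : i ∈ S
        · rw [if_pos hi, mul_one, ENNReal.mul_rpow_of_nonneg _ _ hq.le, mul_comm]
          gcongr
          calc h i ^ q = (h i * h i) ^ (q / 2) := by
                rw [ENNReal.mul_rpow_of_nonneg _ _ (by positivity),
                  ← ENNReal.rpow_add_of_nonneg _ _ (by positivity) (by positivity), add_halves]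
            _ ≤ _ := by gcongr; exact hj i hi
        · simp [hi]

/-- Pointwise bound of the `q`-th power of a sum by weighted bilinear terms. -/
lemma tsum_rpow_le_bilinear (h : ℤ × ℤ → ℝ≥0∞) {c q : ℝ} (hq : 0 < q) :
    (∑' i, h i) ^ q ≤ (∑' i, latticeWeight (-c) i) ^ q *
      ∑' i, ∑' j, (h i * h j) ^ (q / 2) * latticeWeight c (i - j) ^ q := by
  rw [← ENNReal.le_rpow_inv_iff hq, ENNReal.tsum_eq_iSup_sum]
  refine iSup_le fun S => ?_
  rw [ENNReal.le_rpow_inv_iff hq]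
  exact sum_rpow_le h hq S

lemma tsum_rpow_le_rpow_tsum {ι : Type*} (a : ι → ℝ≥0∞) {p q : ℝ} (hp : 0 < p) (hpq : p ≤ q) :
    ∑' i, a i ^ q ≤ (∑' i, a i ^ p) ^ (q / p) := by
  have hq : 0 < q := hp.trans_le hpq
  set A := (∑' i, a i ^ p) with hA
  calc ∑' i, a i ^ q ≤ ∑' i, a i ^ p * A ^ ((q - p) / p) := by
        refine ENNReal.tsum_le_tsum fun i => ?_
        have h1 : a i ≤ A ^ p⁻¹ := by
          rw [ENNReal.le_rpow_inv_iff hp]; exact ENNReal.le_tsum i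
        calc a i ^ q = a i ^ p * a i ^ (q - p) := by
              rw [← ENNReal.rpow_add_of_nonneg _ _ hp.le (by linarith)]; congr 1; ring
          _ ≤ a i ^ p * (A ^ p⁻¹) ^ (q - p) := by gcongr
          _ = _ := by rw [← ENNReal.rpow_mul]; congr 2; field_simp
    _ = A ^ (1 : ℝ) * A ^ ((q - p) / p) := by rw [ENNReal.tsum_mul_right, ENNReal.rpow_one]
    _ = _ := by
        rw [← ENNReal.rpow_add_of_nonneg _ _ (by norm_num) (div_nonneg (by linarith) hp.le)]
        congr 1; field_simp; ring

/-- Summation of pieces whose bilinear interactions decay off the diagonal. -/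
theorem lintegral_tsum_rpow_le {Y : Type*} [MeasurableSpace Y] {κ : Measure Y}
    {h : ℤ × ℤ → Y → ℝ≥0∞} (hm : ∀ i, Measurable (h i)) {a : ℤ × ℤ → ℝ≥0∞} {c q : ℝ} {C : ℝ≥0∞}
    (hq : 0 < q)
    (hb : ∀ i j, ∫⁻ y, (h i y * h j y) ^ (q / 2) ∂κ ≤
      C * ((a i ^ q + a j ^ q) * latticeWeight (-(c * (q + 1))) (i - j))) :
    ∫⁻ y, (∑' i, h i y) ^ q ∂κ ≤
      (∑' i, latticeWeight (-c) i) ^ q * (C * (2 * ∑' i, latticeWeight (-c) i)) *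
        ∑' i, a i ^ q := by
  -- Of the decay c(q+1) available, cq pays for the weights in the pointwise bound, and the
  -- remaining c makes the double sum converge.
  have hw : ∀ i, latticeWeight (-(c * (q + 1))) i * latticeWeight c i ^ q =
      latticeWeight (-c) i := by
    intro i
    unfold latticeWeight
    rw [ENNReal.ofReal_rpow_of_pos (by positivity), ← ENNReal.ofReal_mul (by positivity),
      ← Real.rpow_mul (by norm_num), ← Real.rpow_add (by norm_num)]
    congr 2; ring
  set K := ∑' i, latticeWeight (-c) i with hK
  calc ∫⁻ y, (∑' i, h i y) ^ q ∂κ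
      ≤ ∫⁻ y, K ^ q * ∑' i, ∑' j, (h i y * h j y) ^ (q / 2) * latticeWeight c (i - j) ^ q ∂κ :=
        lintegral_mono fun y => tsum_rpow_le_bilinear (fun i => h i y) hq
    _ = K ^ q * ∑' i, ∑' j, (∫⁻ y, (h i y * h j y) ^ (q / 2) ∂κ) *
          latticeWeight c (i - j) ^ q := by
        rw [lintegral_const_mul _ (by fun_prop), lintegral_tsum fun i => by fun_prop]
        congr 2; ext i
        rw [lintegral_tsum fun j => by fun_prop]
        congr 1; ext j
        rw [lintegral_mul_const _ (by fun_prop)]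
    _ ≤ K ^ q * ∑' i, ∑' j, C * (a i ^ q * latticeWeight (-c) (i - j) +
          a j ^ q * latticeWeight (-c) (i - j)) := by
        refine mul_le_mul' le_rfl (ENNReal.tsum_le_tsum fun i => ENNReal.tsum_le_tsum fun j => ?_)
        refine (mul_le_mul' (hb i j) le_rfl).trans (le_of_eq ?_)
        rw [← hw (i - j)]; ring
    _ = K ^ q * (C * (∑' i, a i ^ q * K + ∑' j, a j ^ q * K)) := by
        simp_rw [ENNReal.tsum_mul_left]
        congr 2
        simp_rw [ENNReal.tsum_add]
        congr 1
        · congr 1; ext i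
          rw [ENNReal.tsum_mul_left, tsum_latticeWeight_sub']
        · rw [ENNReal.tsum_comm]
          congr 1; ext j
          rw [ENNReal.tsum_mul_left, tsum_latticeWeight_sub]
    _ = _ := by rw [ENNReal.tsum_mul_right]; ring

/-! ### Decomposition by scale and height, and the estimate on sectors. -/

/-- The part of the `i.1`-th dyadic sector where `|f|` is of size about `2 ^ i.2`. -/
def piece (f : SpaceTime → ℂ) (i : ℤ × ℤ) : Set SpaceTime :=
  {z | 1 ≤ i.1 ∧ z ∈ sector i.1.toNat ∧ ‖f z‖ ∈ Set.Ioc ((2 : ℝ) ^ i.2) (2 ^ (i.2 + 1))}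

section pieces
variable {f : SpaceTime → ℂ}

lemma measurableSet_piece (hf : Measurable f) (i : ℤ × ℤ) : MeasurableSet (piece f i) := by
  refine (MeasurableSet.const _).inter ((measurableSet_sector _).inter ?_)
  exact hf.norm measurableSet_Ioc

lemma eq_of_mem_sector {N M : ℕ} {z : SpaceTime} (h : z ∈ sector N) (h' : z ∈ sector M) :
    N = M := by
  have a := (pow_lt_pow_iff_right₀ (one_lt_two (α := ℝ))).1 (h.2.2.1.trans_lt h'.2.2.2.1)
  have b := (pow_lt_pow_iff_right₀ (one_lt_two (α := ℝ))).1 (h'.2.2.1.trans_lt h.2.2.2.1)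
  omega

lemma pairwise_disjoint_piece : Pairwise (Function.onFun Disjoint (piece f)) := by
  intro i j hij
  refine Set.disjoint_left.2 fun z hi hj => hij ?_
  have h1 := eq_of_mem_sector hi.2.1 hj.2.1
  have h2 := (zpow_lt_zpow_iff_right₀ (one_lt_two (α := ℝ))).1 (hi.2.2.1.trans_le hj.2.2.2)
  have h3 := (zpow_lt_zpow_iff_right₀ (one_lt_two (α := ℝ))).1 (hj.2.2.1.trans_le hi.2.2.2)
  have h4 := hi.1
  have h5 := hj.1
  ext <;> omega

lemma mem_iUnion_piece (hs : ∀ z, f z ≠ 0 → ∃ N : ℕ, 1 ≤ N ∧ z ∈ sector N) {z : SpaceTime}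
    (hz : f z ≠ 0) : z ∈ ⋃ i, piece f i := by
  obtain ⟨N, hN, hzN⟩ := hs z hz
  obtain ⟨k, hk⟩ := exists_mem_Ioc_zpow (norm_pos_iff.2 hz) (one_lt_two (α := ℝ))
  exact Set.mem_iUnion.2 ⟨((N : ℤ), k), Int.ofNat_le.2 hN, by simpa using hzN, hk⟩

noncomputable def pieceExtension (f : SpaceTime → ℂ) (i : ℤ × ℤ) (y : SpaceTime) : ℂ :=
  ∫ z in piece f i, Complex.exp (Complex.I * (pairing y z : ℂ)) * f z ∂sigma

lemma enorm_extension_le_tsum (hf : Measurable f) (hi : Integrable f sigma)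
    (hs : ∀ z, f z ≠ 0 → ∃ N : ℕ, 1 ≤ N ∧ z ∈ sector N) (y : SpaceTime) :
    ‖extension f y‖ₑ ≤ ∑' i, ‖pieceExtension f i y‖ₑ := by
  have h1 : extension f y =
      ∫ z in ⋃ i, piece f i, Complex.exp (Complex.I * (pairing y z : ℂ)) * f z ∂sigma := by
    unfold extension
    rw [setIntegral_eq_integral_of_forall_compl_eq_zero]
    intro z hz
    by_contra hcon
    exact hz (mem_iUnion_piece hs fun h => hcon (by rw [h, mul_zero]))
  have h2 := hasSum_integral_iUnion (μ := sigma) (s := piece f)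
    (fun i => measurableSet_piece hf i) pairwise_disjoint_piece
    ((integrable_cexp_mul hi y).integrableOn)
  rw [h1, ← h2.tsum_eq]
  exact enorm_tsum_le_tsum_enorm

noncomputable def pieceBump (f : SpaceTime → ℂ) (i : ℤ × ℤ) : SpaceTime → ℂ :=
  (piece f i).indicator fun z => (((2 : ℝ) ^ (i.2 + 1))⁻¹ : ℝ) * f z

lemma pieceExtension_eq (hf : Measurable f) (i : ℤ × ℤ) (y : SpaceTime) :
    ‖pieceExtension f i y‖ = 2 ^ (i.2 + 1) * ‖extension (pieceBump f i) y‖ := by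
  have h2 : (0 : ℝ) < 2 ^ (i.2 + 1) := by positivity
  have : extension (pieceBump f i) y = (((2 : ℝ) ^ (i.2 + 1))⁻¹ : ℝ) * pieceExtension f i y := by
    unfold extension pieceExtension pieceBump
    rw [← integral_indicator (measurableSet_piece hf i), ← integral_const_mul]
    congr 1; ext z
    by_cases hz : z ∈ piece f i
    · simp only [Set.indicator_of_mem hz]; ring
    · simp [Set.indicator_of_notMem hz]
  rw [this, norm_mul, Complex.norm_real, Real.norm_of_nonneg (by positivity), ← mul_assoc,
    mul_inv_cancel₀ h2.ne', one_mul]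

lemma pieceExtension_eq_zero {i : ℤ × ℤ} (h : sigma (piece f i) = 0) (y : SpaceTime) :
    pieceExtension f i y = 0 := by
  unfold pieceExtension
  rw [Measure.restrict_eq_zero.2 h, integral_zero_measure]

lemma sigma_piece_ne_top {i : ℤ × ℤ} (h : sigma (piece f i) ≠ 0) : 1 ≤ i.1 ∧
    sigma (piece f i) ≠ ⊤ := by
  obtain ⟨z, hz⟩ := nonempty_of_measure_ne_zero h
  refine ⟨hz.1, ?_⟩
  have h1 : 1 ≤ i.1.toNat := by have := hz.1; omega
  exact ((measure_mono fun z hz => hz.2.1).trans_lt (sigma_sector_ne_top h1).lt_top).ne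

/-- The measure is written as a power of 2 to match the bilinear estimate, so null pieces are
excluded; their extensions vanish. -/
lemma isBump_pieceBump (hf : Measurable f) {i : ℤ × ℤ} (h : sigma (piece f i) ≠ 0) :
    IsBump (pieceBump f i) (piece f i) (2 ^ Real.logb 2 (sigma (piece f i)).toReal) := by
  have hpos := ENNReal.toReal_pos h (sigma_piece_ne_top h).2
  have e : (2 : ℝ) ^ Real.logb 2 (sigma (piece f i)).toReal = (sigma (piece f i)).toReal :=
    Real.rpow_logb (by norm_num) (by norm_num) hpos
  have h2 : (0 : ℝ) < 2 ^ (i.2 + 1) := by positivity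
  refine ⟨(measurable_const.mul hf).indicator (measurableSet_piece hf i), measurableSet_piece hf i,
    fun z => ?_, fun z hz => Set.indicator_of_notMem hz _, by rw [e]; exact hpos,
    by rw [e, ENNReal.ofReal_toReal (sigma_piece_ne_top h).2]⟩
  by_cases hz : z ∈ piece f i
  · unfold pieceBump
    rw [Set.indicator_of_mem hz, norm_mul, Complex.norm_real, Real.norm_of_nonneg (by positivity),
      inv_mul_le_iff₀ h2, mul_one]
    exact hz.2.2.2
  · simp [pieceBump, Set.indicator_of_notMem hz]

/-- The `L^p` size of a piece. -/
noncomputable def pieceSize (p : ℝ) (f : SpaceTime → ℂ) (i : ℤ × ℤ) : ℝ≥0∞ :=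
  ENNReal.ofReal (2 ^ i.2) * sigma (piece f i) ^ p⁻¹

lemma tsum_pieceSize_le (hf : Measurable f) {p : ℝ} (hp : 0 < p) :
    ∑' i, pieceSize p f i ^ p ≤ ∫⁻ z, ‖f z‖ₑ ^ p ∂sigma := by
  calc ∑' i, pieceSize p f i ^ p ≤ ∑' i, ∫⁻ z in piece f i, ‖f z‖ₑ ^ p ∂sigma := by
        refine ENNReal.tsum_le_tsum fun i => ?_
        unfold pieceSize
        rw [ENNReal.mul_rpow_of_nonneg _ _ hp.le, ENNReal.rpow_inv_rpow hp.ne',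
          ← setLIntegral_const]
        refine setLIntegral_mono' (measurableSet_piece hf i) fun z hz => ?_
        gcongr
        rw [← ofReal_norm]
        exact ENNReal.ofReal_le_ofReal hz.2.2.1.le
    _ = ∫⁻ z in ⋃ i, piece f i, ‖f z‖ₑ ^ p ∂sigma :=
        (lintegral_iUnion (fun i => measurableSet_piece hf i) pairwise_disjoint_piece _).symm
    _ ≤ _ := setLIntegral_le_lintegral _ _

lemma pieceSize_rpow {p q : ℝ} (hp : 0 < p) {i : ℤ × ℤ} (h : sigma (piece f i) ≠ 0) :
    pieceSize p f i ^ q =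
      ENNReal.ofReal (2 ^ (q * (i.2 + Real.logb 2 (sigma (piece f i)).toReal / p))) := by
  have hpos := ENNReal.toReal_pos h (sigma_piece_ne_top h).2
  have e : (2 : ℝ) ^ Real.logb 2 (sigma (piece f i)).toReal = (sigma (piece f i)).toReal :=
    Real.rpow_logb (by norm_num) (by norm_num) hpos
  set μ := Real.logb 2 (sigma (piece f i)).toReal
  unfold pieceSize
  rw [← ENNReal.ofReal_toReal (sigma_piece_ne_top h).2, ← e, ENNReal.ofReal_rpow_of_pos
    (by positivity), ← ENNReal.ofReal_mul (by positivity), ENNReal.ofReal_rpow_of_pos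
    (by positivity), ← Real.rpow_intCast, ← Real.rpow_mul (by norm_num),
    ← Real.rpow_add (by norm_num), ← Real.rpow_mul (by norm_num)]
  congr 2
  field_simp

end pieces

/-- α and α' are the logarithms of the L^p sizes of two pieces. Replacing their mean by their
maximum gains (q/2)|α − α'|. Since k − l = (α − α') − (μ − ν)/p, this gain and the decay in |μ − ν|
together give decay in the height difference |k − l|. -/
lemma exponent_le {q p δ c μ ν k l n α α' : ℝ} (hp : 0 < p) (hα : α = k + μ / p)
    (hα' : α' = l + ν / p) (hn : 0 ≤ n) (hc0 : 0 ≤ c) (hcq : c ≤ q / 2) (hcp : c ≤ δ * p)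
    (hcδ : c ≤ δ) :
    q / 2 * (α + α') - δ * n - δ * |μ - ν| ≤ q * max α α' - c * (n + |k - l|) := by
  have e1 : |μ - ν| = p * |(α - α') - (k - l)| := by
    have : μ - ν = p * ((α - α') - (k - l)) := by rw [hα, hα']; field_simp; ring
    rw [this, abs_mul, abs_of_pos hp]
  have e2 : max α α' = (α + α') / 2 + |α - α'| / 2 := by
    rcases le_total α α' with h | h
    · rw [max_eq_right h, abs_of_nonpos (by linarith)]; ring
    · rw [max_eq_left h, abs_of_nonneg (by linarith)]; ring
  have h1 : |k - l| ≤ |α - α'| + |(α - α') - (k - l)| := by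
    have := abs_sub_abs_le_abs_sub (k - l) (α - α')
    rw [abs_sub_comm (k - l)] at this
    linarith
  have h2 : c * |k - l| ≤ q / 2 * |α - α'| + δ * p * |(α - α') - (k - l)| := by
    calc c * |k - l| ≤ c * (|α - α'| + |(α - α') - (k - l)|) := by gcongr
      _ = c * |α - α'| + c * |(α - α') - (k - l)| := by ring
      _ ≤ _ := by gcongr
  rw [e1, e2]
  nlinarith

/-- The restricted annular estimate implies the global extension estimate for functions on the
dyadic sectors. -/
theorem sector_extension {p q₀ q β C : ℝ} (hβ2 : 2 ≤ β) (hβ3 : β ≤ 3) (hq₀ : 0 < q₀)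
    (hq : q₀ < q) (hC : 0 < C) (hp : 0 < p) (hpq : p ≤ q) (hline : q - β = q / p)
    (hA : ∀ N : ℕ, 1 ≤ N → ∀ f E m, IsBump f E m → E ⊆ annulus N →
      ∫⁻ y, ENNReal.ofReal ((‖extension f y‖ / m) ^ q₀) ≤ ENNReal.ofReal (C * m ^ (-β))) :
    ∃ K : ℝ≥0∞, K ≠ ⊤ ∧ ∀ f : SpaceTime → ℂ, Measurable f → Integrable f sigma →
      (∀ z, f z ≠ 0 → ∃ N : ℕ, 1 ≤ N ∧ z ∈ sector N) →
      ∫⁻ y, ‖extension f y‖ₑ ^ q ≤ K * (∫⁻ z, ‖f z‖ₑ ^ p ∂sigma) ^ (q / p) := by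
  obtain ⟨C', δ, hC', hδ, hbil⟩ := exists_bilinear_bound hβ2 hβ3 hq₀ hq hC hA
  have hq0 : 0 < q := hq₀.trans hq
  set c₀ : ℝ := min (min (q / 2) (δ * p)) δ with hc₀
  have hc₀0 : 0 < c₀ := lt_min (lt_min (by positivity) (by positivity)) hδ
  set c : ℝ := c₀ / (q + 1) with hcdef
  have hc : 0 < c := by positivity
  have hcc : c * (q + 1) = c₀ := by rw [hcdef]; field_simp
  set S := ∑' i, latticeWeight (-c) i with hS
  have hStop : S ≠ ⊤ := tsum_latticeWeight_ne_top hc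
  -- The factor 2^q arises because each piece is normalized by the upper end 2^(k+1) of its height
  -- range.
  set D : ℝ≥0 := (2 ^ q * C').toNNReal with hD
  refine ⟨S ^ q * (D * (2 * S)), ?_, fun f hf hi hs => ?_⟩
  · exact ENNReal.mul_ne_top (ENNReal.rpow_ne_top_of_nonneg hq0.le hStop)
      (ENNReal.mul_ne_top ENNReal.coe_ne_top (ENNReal.mul_ne_top (by norm_num) hStop))
  have hm : ∀ i, Measurable fun y => ‖pieceExtension f i y‖ₑ := by
    intro i
    have : ∀ y, ‖pieceExtension f i y‖ₑ =
        ENNReal.ofReal (2 ^ (i.2 + 1)) * ‖extension (pieceBump f i) y‖ₑ := by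
      intro y
      rw [← ofReal_norm, pieceExtension_eq hf, ENNReal.ofReal_mul (by positivity), ofReal_norm]
    simp_rw [this]
    refine Measurable.const_mul (measurable_extension ?_).enorm _
    exact (measurable_const.mul hf).indicator (measurableSet_piece hf i)
  have hb : ∀ i j, ∫⁻ y, (‖pieceExtension f i y‖ₑ * ‖pieceExtension f j y‖ₑ) ^ (q / 2) ≤
      D * ((pieceSize p f i ^ q + pieceSize p f j ^ q) *
        latticeWeight (-(c * (q + 1))) (i - j)) := by
    intro i j
    have hq2 : 0 < q / 2 := by positivity
    by_cases hi0 : sigma (piece f i) = 0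
    · simp [pieceExtension_eq_zero hi0, ENNReal.zero_rpow_of_pos hq2]
    by_cases hj0 : sigma (piece f j) = 0
    · simp [pieceExtension_eq_zero hj0, ENNReal.zero_rpow_of_pos hq2]
    have bi := isBump_pieceBump hf hi0
    have bj := isBump_pieceBump hf hj0
    have hi1 := (sigma_piece_ne_top hi0).1
    have hj1 := (sigma_piece_ne_top hj0).1
    rw [pieceSize_rpow hp hi0, pieceSize_rpow hp hj0]
    set μ := Real.logb 2 (sigma (piece f i)).toReal with hμ
    set ν := Real.logb 2 (sigma (piece f j)).toReal with hν
    have h1 := hbil i.1.toNat j.1.toNat (by omega) (by omega) _ _ _ _ μ ν bi bj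
      (fun z hz => hz.2.1) (fun z hz => hz.2.1)
    have cast : ∀ m : ℤ, 1 ≤ m → ((m.toNat : ℕ) : ℝ) = (m : ℝ) := by
      intro m hm
      have : ((m.toNat : ℕ) : ℤ) = m := Int.toNat_of_nonneg (by omega)
      exact_mod_cast congrArg (Int.cast : ℤ → ℝ) this
    rw [cast _ hi1, cast _ hj1] at h1
    have e1 : ∀ y, (‖pieceExtension f i y‖ₑ * ‖pieceExtension f j y‖ₑ) ^ (q / 2) =
        ENNReal.ofReal (2 ^ (q / 2 * ((i.2 : ℝ) + j.2 + 2 + μ + ν))) * ENNReal.ofReal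
          ((‖extension (pieceBump f i) y‖ / 2 ^ μ * (‖extension (pieceBump f j) y‖ / 2 ^ ν)) ^
            (q / 2)) := by
      intro y
      rw [← ofReal_norm, ← ofReal_norm, ← ENNReal.ofReal_mul (norm_nonneg _),
        ENNReal.ofReal_rpow_of_nonneg (by positivity) hq2.le, ← ENNReal.ofReal_mul (by positivity),
        pieceExtension_eq hf, pieceExtension_eq hf]
      congr 1
      rw [mul_comm (q / 2), Real.rpow_mul (by norm_num), ← Real.mul_rpow (by positivity)
        (by positivity)]
      congr 1
      rw [Real.rpow_add (by norm_num), Real.rpow_add (by norm_num),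
        show (i.2 : ℝ) + j.2 + 2 = ((i.2 + 1 : ℤ) : ℝ) + ((j.2 + 1 : ℤ) : ℝ) by push_cast; ring,
        Real.rpow_add (by norm_num), Real.rpow_intCast, Real.rpow_intCast]
      have p1 : (2 : ℝ) ^ μ ≠ 0 := by positivity
      have p2 : (2 : ℝ) ^ ν ≠ 0 := by positivity
      field_simp
    simp_rw [e1]
    rw [lintegral_const_mul' _ _ ENNReal.ofReal_ne_top]
    refine (mul_le_mul' le_rfl h1).trans ?_
    set α := (i.2 : ℝ) + μ / p with hα
    set α' := (j.2 : ℝ) + ν / p with hα'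
    have hexp := exponent_le (q := q) (δ := δ) (c := c₀) (n := |(i.1 : ℝ) - j.1|) hp hα hα'
      (abs_nonneg _) hc₀0.le ((min_le_left _ _).trans (min_le_left _ _))
      ((min_le_left _ _).trans (min_le_right _ _)) (min_le_right _ _)
    have hmax : (2 : ℝ) ^ (q * max α α') ≤ 2 ^ (q * α) + 2 ^ (q * α') := by
      have a1 : (0 : ℝ) < 2 ^ (q * α) := by positivity
      have a2 : (0 : ℝ) < 2 ^ (q * α') := by positivity
      rcases max_choice α α' with h | h <;> rw [h] <;> linarith
    have hL : latticeLength (i - j) = |(i.1 : ℝ) - j.1| + |(i.2 : ℝ) - j.2| := by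
      simp [latticeLength]
    rw [hcc, latticeWeight, hL, ← ENNReal.ofReal_add (by positivity) (by positivity),
      ← ENNReal.ofReal_mul (by positivity), ← ENNReal.ofReal_mul (by positivity), hD,
      ← ENNReal.ofReal, ← ENNReal.ofReal_mul (by positivity)]
    refine ENNReal.ofReal_le_ofReal ?_
    -- The identity q − β = q/p enters here: the powers of heights and measures combine into L^p
    -- sizes exactly.
    have e2 : q / 2 * ((i.2 : ℝ) + j.2 + 2 + μ + ν) +
        (-(β / 2) * (μ + ν) - δ * |(i.1 : ℝ) - j.1| - δ * |μ - ν|) =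
        q + (q / 2 * (α + α') - δ * |(i.1 : ℝ) - j.1| - δ * |μ - ν|) := by
      have : q / 2 * (μ / p + ν / p) = (q - β) / 2 * (μ + ν) := by rw [hline]; field_simp
      rw [hα, hα']
      linear_combination -this
    calc _ = C' * 2 ^ (q / 2 * ((i.2 : ℝ) + j.2 + 2 + μ + ν) +
          (-(β / 2) * (μ + ν) - δ * |(i.1 : ℝ) - j.1| - δ * |μ - ν|)) := by
          rw [Real.rpow_add (by norm_num)]; ring
      _ ≤ C' * 2 ^ (q + (q * max α α' - c₀ * (|(i.1 : ℝ) - j.1| + |(i.2 : ℝ) - j.2|))) := by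
          rw [e2]
          refine mul_le_mul_of_nonneg_left ?_ hC'.le
          exact Real.rpow_le_rpow_of_exponent_le (by norm_num) (by linarith)
      _ = 2 ^ q * C' * (2 ^ (q * max α α') *
          2 ^ (-c₀ * (|(i.1 : ℝ) - j.1| + |(i.2 : ℝ) - j.2|))) := by
          rw [Real.rpow_add (by norm_num), sub_eq_add_neg, Real.rpow_add (by norm_num),
            neg_mul]
          ring
      _ ≤ _ := by gcongr
  calc ∫⁻ y, ‖extension f y‖ₑ ^ q ≤ ∫⁻ y, (∑' i, ‖pieceExtension f i y‖ₑ) ^ q := by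
        refine lintegral_mono fun y => ?_
        gcongr
        exact enorm_extension_le_tsum hf hi hs y
    _ ≤ S ^ q * (D * (2 * S)) * ∑' i, pieceSize p f i ^ q :=
        lintegral_tsum_rpow_le hm hq0 hb
    _ ≤ _ := by
        gcongr
        refine (tsum_rpow_le_rpow_tsum _ hp hpq).trans ?_
        gcongr
        exact tsum_pieceSize_le hf hp

/-! ### σ as the cone measure of the Lorentz form. -/

/-- The Lorentz form `|ξ|² - τ²`. -/
noncomputable def lorentz (z : SpaceTime) : ℝ := ‖z.2‖ ^ 2 - z.1 ^ 2

lemma continuous_lorentz : Continuous lorentz := by unfold lorentz; fun_prop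

lemma lorentz_smul (c : ℝ) (z : SpaceTime) : lorentz (c • z) = c ^ 2 * lorentz z := by
  simp only [lorentz, Prod.smul_fst, Prod.smul_snd, norm_smul, smul_eq_mul, Real.norm_eq_abs,
    mul_pow, sq_abs]
  ring

lemma mem_hyperboloid_iff {z : SpaceTime} : z ∈ hyperboloid ↔ lorentz z = 1 := by
  simp only [hyperboloid, lorentz, Set.mem_ofPred_eq]
  constructor <;> intro h <;> linarith

lemma lintegral_Ioo_symm {r : ℝ} {h : ℝ → ℝ≥0∞} (hh : Measurable h) :
    ∫⁻ t in Set.Ioo (-r) r, h t = ∫⁻ t in Set.Ioo 0 r, (h (-t) + h t) := by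
  rcases le_or_gt r 0 with hr | hr
  · rw [Set.Ioo_eq_empty (by linarith), Set.Ioo_eq_empty (by linarith)]; simp
  have e : (Set.Ioo (-r) r : Set ℝ) =ᵐ[volume] (Set.Ioo (-r) 0 ∪ Set.Ioo 0 r : Set ℝ) := by
    have : (Set.Ioo (-r) r : Set ℝ) = (Set.Ioo (-r) 0 ∪ Set.Ioo 0 r) ∪ {0} := by
      ext t
      simp only [Set.mem_Ioo, Set.mem_union, Set.mem_singleton_iff]
      constructor
      · rintro ⟨h1, h2⟩
        rcases lt_trichotomy t 0 with h | h | h <;> simp [*]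
      · rintro ((⟨h1, h2⟩ | ⟨h1, h2⟩) | h)
        · exact ⟨h1, by linarith⟩
        · exact ⟨by linarith, h2⟩
        · subst h; exact ⟨by linarith, hr⟩
    rw [this]
    exact union_ae_eq_left_of_ae_eq_empty (ae_eq_empty.2 (by simp))
  rw [setLIntegral_congr e, lintegral_union measurableSet_Ioo
    (Set.disjoint_left.2 fun t h1 h2 => by linarith [h1.2, h2.1]),
    lintegral_add_left (f := fun t => h (-t)) (hh.comp measurable_neg)]
  congr 1
  have := (Measure.measurePreserving_neg (volume : Measure ℝ)).setLIntegral_comp_preimage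
    (measurableSet_Ioo (a := -r) (b := 0)) hh
  rw [← this]
  congr 2
  simp

/-- The substitution t = √(r² − s²), with r = |ζ|, trades the time variable at fixed ζ for the
Lorentz radius s. -/
lemma lintegral_sqrt_sq_sub {r : ℝ} (h : ℝ → ℝ≥0∞) :
    ∫⁻ s in Set.Ioo 0 r, ENNReal.ofReal (s / √(r ^ 2 - s ^ 2)) * h (√(r ^ 2 - s ^ 2)) =
      ∫⁻ t in Set.Ioo 0 r, h t := by
  have himg : (fun s : ℝ => √(r ^ 2 - s ^ 2)) '' Set.Ioo 0 r = Set.Ioo 0 r := by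
    have hmap : ∀ s ∈ Set.Ioo 0 r, √(r ^ 2 - s ^ 2) ∈ Set.Ioo 0 r := by
      rintro s ⟨h1, h2⟩
      exact ⟨Real.sqrt_pos.2 (by nlinarith), (Real.sqrt_lt' (h1.trans h2)).2 (by nlinarith)⟩
    refine Set.Subset.antisymm (Set.image_subset_iff.2 hmap) fun t ht => ⟨_, hmap t ht, ?_⟩
    simp only
    rw [Real.sq_sqrt (by nlinarith [ht.1, ht.2]), sub_sub_cancel, Real.sqrt_sq ht.1.le]
  have hd : ∀ s ∈ Set.Ioo 0 r, HasDerivWithinAt (fun s : ℝ => √(r ^ 2 - s ^ 2))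
      (-(s / √(r ^ 2 - s ^ 2))) (Set.Ioo 0 r) s := by
    rintro s ⟨h1, h2⟩
    have h0 : r ^ 2 - s ^ 2 ≠ 0 := by nlinarith
    have := (((hasDerivAt_pow 2 s).const_sub (r ^ 2)).sqrt h0).hasDerivWithinAt
      (s := Set.Ioo 0 r)
    have e : -(s / √(r ^ 2 - s ^ 2)) =
        -(((2 : ℕ) : ℝ) * s ^ (2 - 1)) / (2 * √(r ^ 2 - s ^ 2)) := by
      rw [Nat.add_one_sub_one, pow_one, Nat.cast_ofNat, ← mul_neg, mul_div_mul_left _ _ two_ne_zero,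
        neg_div]
    rw [e]
    exact this
  have hinj : Set.InjOn (fun s : ℝ => √(r ^ 2 - s ^ 2)) (Set.Ioo 0 r) := by
    intro s hs t ht hst
    simp only at hst
    rw [Real.sqrt_inj (by nlinarith [hs.1, hs.2]) (by nlinarith [ht.1, ht.2])] at hst
    exact (pow_left_inj₀ hs.1.le ht.1.le two_ne_zero).1 (by linarith)
  conv_rhs => rw [← himg, lintegral_image_eq_lintegral_abs_deriv_mul measurableSet_Ioo hd hinj]
  refine setLIntegral_congr_fun measurableSet_Ioo fun s hs => ?_
  rw [abs_neg, abs_of_nonneg (div_nonneg hs.1.le (Real.sqrt_nonneg _))]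

lemma lintegral_comp_smul_plane {h : Plane → ℝ≥0∞} {c : ℝ} (hc : 0 < c) :
    ENNReal.ofReal (c ^ 2) * ∫⁻ ξ, h (c • ξ) = ∫⁻ ξ, h ξ := by
  have e : MeasurableEmbedding fun ξ : Plane => c • ξ :=
    (Homeomorph.smulOfNeZero c hc.ne').measurableEmbedding
  rw [← e.lintegral_map h, Measure.map_addHaar_smul volume hc.ne', lintegral_smul_measure,
    smul_eq_mul, ← mul_assoc, ← ENNReal.ofReal_mul (by positivity)]
  have : c ^ 2 * |(c ^ Module.finrank ℝ Plane)⁻¹| = 1 := by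
    rw [finrank_euclideanSpace_fin, abs_of_pos (by positivity)]
    field_simp
  rw [this]; simp

/-- Integration in polar coordinates for the Lorentz form. -/
lemma lintegral_lorentz_pos {H : SpaceTime → ℝ≥0∞} (hH : Measurable H) :
    ∫⁻ x in {x | 0 < lorentz x}, H x =
      ∫⁻ ρ in Set.Ioi (0 : ℝ), ENNReal.ofReal (ρ ^ 2) * ∫⁻ z, H (ρ • z) ∂sigma := by
  have hb := measurable_bracket
  have hms : MeasurableSet {x | 0 < lorentz x} :=
    measurableSet_lt measurable_const continuous_lorentz.measurable
  set k : ℝ → Plane → ℝ≥0∞ := fun t ξ => H (-t, ξ) + H (t, ξ) with hk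
  have hkm : Measurable fun x : ℝ × Plane => k x.1 x.2 := by
    simp only [hk]
    exact (hH.comp (by fun_prop)).add (hH.comp (by fun_prop))
  -- After rescaling ζ = ρξ, the hyperboloid of radius ρ is the pair of graphs ±√(|ζ|² − ρ²) over
  -- |ζ| > ρ; one factor of ρ is left in the density.
  set F : ℝ → Plane → ℝ≥0∞ := fun ρ ζ => if ρ < ‖ζ‖ then
    ENNReal.ofReal (ρ / √(‖ζ‖ ^ 2 - ρ ^ 2)) * k (√(‖ζ‖ ^ 2 - ρ ^ 2)) ζ else 0 with hF
  have hFm : Measurable fun x : ℝ × Plane => F x.1 x.2 := by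
    simp only [hF]
    refine Measurable.ite (measurableSet_lt measurable_fst measurable_snd.norm) ?_ measurable_const
    refine Measurable.mul (by fun_prop) ?_
    exact hkm.comp (f := fun x : ℝ × Plane => (√(‖x.2‖ ^ 2 - x.1 ^ 2), x.2)) (by fun_prop)
  have hs : MeasurableSet {ξ : Plane | 1 < ‖ξ‖} := measurableSet_lt (by fun_prop) (by fun_prop)
  have hR : ∀ ρ ∈ Set.Ioi (0 : ℝ), ENNReal.ofReal (ρ ^ 2) * ∫⁻ z, H (ρ • z) ∂sigma =
      ∫⁻ ζ, F ρ ζ := by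
    intro ρ hρ
    rw [← lintegral_comp_smul_plane (h := F ρ) hρ]
    congr 1
    have hc : Measurable fun z : SpaceTime => H (ρ • z) := hH.comp (measurable_const_smul ρ)
    rw [lintegral_sigma hc, ← lintegral_add_left
        (f := fun ξ => H (ρ • (-bracket ξ, ξ))) (hc.comp (by fun_prop)),
      lintegral_planeMeasure (g := fun ξ => H (ρ • (-bracket ξ, ξ)) + H (ρ • (bracket ξ, ξ)))
        ((hc.comp (by fun_prop)).add (hc.comp (by fun_prop))),
      ← lintegral_indicator hs]
    refine lintegral_congr fun ξ => ?_
    have hρ0 : 0 < ρ := hρ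
    have hn : ‖ρ • ξ‖ = ρ * ‖ξ‖ := by rw [norm_smul, Real.norm_of_nonneg hρ0.le]
    have hcond : ρ < ‖ρ • ξ‖ ↔ 1 < ‖ξ‖ := by
      rw [hn]; exact lt_mul_iff_one_lt_right hρ0
    have hsq : √(‖ρ • ξ‖ ^ 2 - ρ ^ 2) = ρ * bracket ξ := by
      rw [hn, bracket, show (ρ * ‖ξ‖) ^ 2 - ρ ^ 2 = ρ ^ 2 * (‖ξ‖ ^ 2 - 1) by ring,
        Real.sqrt_mul (by positivity), Real.sqrt_sq hρ0.le]
    simp only [hF, hcond, hsq]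
    by_cases hξ : 1 < ‖ξ‖
    · rw [Set.indicator_of_mem (by exact hξ), if_pos hξ]
      have hbp := bracket_pos hξ
      have : ρ / (ρ * bracket ξ) = 1 / bracket ξ := by field_simp
      rw [this]
      simp [hk]
    · rw [Set.indicator_of_notMem (by exact hξ), if_neg hξ]
  rw [setLIntegral_congr_fun measurableSet_Ioi hR,
    lintegral_lintegral_swap (hFm.comp measurable_id).aemeasurable,
    ← lintegral_indicator hms, Measure.volume_eq_prod, lintegral_prod_symm _
      (hH.indicator hms).aemeasurable]
  refine lintegral_congr fun ζ => ?_
  have e1 : ∀ t : ℝ, Set.indicator {x | 0 < lorentz x} H (t, ζ) =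
      (Set.Ioo (-‖ζ‖) ‖ζ‖).indicator (fun t => H (t, ζ)) t := by
    intro t
    have : (t, ζ) ∈ {x | 0 < lorentz x} ↔ t ∈ Set.Ioo (-‖ζ‖) ‖ζ‖ := by
      rw [Set.mem_ofPred_eq, lorentz, sub_pos, sq_lt_sq, abs_norm, abs_lt]; rfl
    by_cases h : t ∈ Set.Ioo (-‖ζ‖) ‖ζ‖
    · rw [Set.indicator_of_mem h, Set.indicator_of_mem (this.2 h)]
    · rw [Set.indicator_of_notMem h, Set.indicator_of_notMem (fun h' => h (this.1 h'))]
  simp_rw [e1]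
  rw [lintegral_indicator measurableSet_Ioo, lintegral_Ioo_symm (h := fun t => H (t, ζ)) (hH.comp (by fun_prop)),
    ← lintegral_sqrt_sq_sub, ← lintegral_indicator measurableSet_Ioo,
    ← lintegral_indicator measurableSet_Ioi]
  refine lintegral_congr fun ρ => ?_
  by_cases h0 : 0 < ρ
  · by_cases h1 : ρ < ‖ζ‖
    · rw [Set.indicator_of_mem (by exact ⟨h0, h1⟩), Set.indicator_of_mem (by exact h0)]
      simp [hF, h1, hk]
    · rw [Set.indicator_of_notMem (fun h => h1 h.2), Set.indicator_of_mem (by exact h0)]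
      simp [hF, h1]
  · rw [Set.indicator_of_notMem (fun h => h0 h.1), Set.indicator_of_notMem (by exact h0)]

/-- The normalizing constant `∫₀¹ ρ² dρ`. -/
noncomputable def coneConst : ℝ≥0∞ := ∫⁻ ρ in Set.Ioo (0 : ℝ) 1, ENNReal.ofReal (ρ ^ 2)

lemma coneConst_ne_zero : coneConst ≠ 0 := by
  unfold coneConst
  rw [← lintegral_indicator measurableSet_Ioo]
  intro h
  rw [lintegral_eq_zero_iff ((by fun_prop : Measurable fun ρ : ℝ =>
    ENNReal.ofReal (ρ ^ 2)).indicator measurableSet_Ioo)] at h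
  have h2 : volume (Set.Ioo (0 : ℝ) 1) = 0 := by
    refine measure_mono_null ?_ h
    intro ρ hρ
    have := hρ.1
    simp [this, hρ.2, this.ne']
  simp at h2

lemma coneConst_ne_top : coneConst ≠ ⊤ := by
  unfold coneConst
  refine ((setLIntegral_mono' (g := fun _ => 1) measurableSet_Ioo fun ρ hρ => ?_).trans_lt ?_).ne
  · exact ENNReal.ofReal_le_one.2 (by nlinarith [hρ.1, hρ.2])
  · simp

/-- The measure `σ` as the cone measure of the Lorentz unit ball. -/
lemma lintegral_cone {g : SpaceTime → ℝ≥0∞} (hg : Measurable g) :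
    ∫⁻ x in {x | 0 < lorentz x ∧ lorentz x < 1}, g ((√(lorentz x))⁻¹ • x) =
      coneConst * ∫⁻ z, g z ∂sigma := by
  have hl := continuous_lorentz.measurable
  have hm1 : MeasurableSet {x | lorentz x < 1} := measurableSet_lt hl measurable_const
  have hG : Measurable fun x => g ((√(lorentz x))⁻¹ • x) := hg.comp (by fun_prop)
  have e : {x | 0 < lorentz x ∧ lorentz x < 1} = {x | lorentz x < 1} ∩ {x | 0 < lorentz x} := by
    ext x; simp [and_comm]
  rw [e, ← Measure.restrict_restrict hm1, ← lintegral_indicator hm1,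
    lintegral_lorentz_pos (hG.indicator hm1), coneConst, ← lintegral_mul_const _ (by fun_prop),
    ← lintegral_indicator measurableSet_Ioi, ← lintegral_indicator measurableSet_Ioo]
  refine lintegral_congr fun ρ => ?_
  by_cases h0 : 0 < ρ
  swap
  · rw [Set.indicator_of_notMem (by exact h0), Set.indicator_of_notMem (fun h => h0 h.1)]
  rw [Set.indicator_of_mem (by exact h0)]
  have key : ∀ᵐ z ∂sigma, Set.indicator {x | lorentz x < 1}
      (fun x => g ((√(lorentz x))⁻¹ • x)) (ρ • z) = if ρ < 1 then g z else 0 := by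
    filter_upwards [ae_mem_hyperboloid] with z hz
    have hz1 : lorentz (ρ • z) = ρ ^ 2 := by
      rw [lorentz_smul, mem_hyperboloid_iff.1 hz, mul_one]
    by_cases h1 : ρ < 1
    · rw [Set.indicator_of_mem (by rw [Set.mem_ofPred_eq, hz1]; nlinarith), if_pos h1, hz1,
        Real.sqrt_sq h0.le, inv_smul_smul₀ h0.ne']
    · rw [Set.indicator_of_notMem (by rw [Set.mem_ofPred_eq, hz1]; nlinarith), if_neg h1]
  rw [lintegral_congr_ae key]
  by_cases h1 : ρ < 1
  · rw [Set.indicator_of_mem (by exact ⟨h0, h1⟩)]; simp [h1]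
  · rw [Set.indicator_of_notMem (fun h => h1 h.2)]; simp [h1]

/-- The part of the solid cone of Lorentz radius below 1 over this portion of the hyperboloid lies
in the Euclidean ball, so Lebesgue volume bounds the mass; the singular density at |ξ| = 1 is never
estimated directly. -/
lemma sigma_ball_lt_top (R : ℝ) : sigma (Metric.ball 0 R) < ⊤ := by
  have hmB : MeasurableSet (Metric.ball (0 : SpaceTime) R) := Metric.isOpen_ball.measurableSet
  have h := lintegral_cone (g := (Metric.ball (0 : SpaceTime) R).indicator 1)
    (measurable_one.indicator hmB)
  rw [lintegral_indicator_one hmB] at h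
  have hl := continuous_lorentz.measurable
  have hms : MeasurableSet {x | 0 < lorentz x ∧ lorentz x < 1} :=
    (measurableSet_lt measurable_const hl).inter (measurableSet_lt hl measurable_const)
  have h2 : coneConst * sigma (Metric.ball 0 R) < ⊤ := by
    rw [← h]
    calc _ ≤ ∫⁻ x in {x | 0 < lorentz x ∧ lorentz x < 1},
          (Metric.ball (0 : SpaceTime) R).indicator 1 x := by
          refine setLIntegral_mono' hms fun x hx => ?_
          by_cases hx' : (√(lorentz x))⁻¹ • x ∈ Metric.ball (0 : SpaceTime) R
          · have hs : 0 < √(lorentz x) := Real.sqrt_pos.2 hx.1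
            have hs1 : √(lorentz x) ≤ 1 := Real.sqrt_le_one.2 hx.2.le
            have : x ∈ Metric.ball (0 : SpaceTime) R := by
              rw [mem_ball_zero_iff, norm_smul, norm_inv, Real.norm_of_nonneg hs.le,
                inv_mul_lt_iff₀ hs] at hx'
              rw [mem_ball_zero_iff]
              have hR : 0 ≤ R := by
                by_contra hR
                nlinarith [norm_nonneg x, not_le.1 hR]
              nlinarith
            simp [Set.indicator_of_mem hx', Set.indicator_of_mem this]
          · simp [Set.indicator_of_notMem hx']
      _ ≤ ∫⁻ x, (Metric.ball (0 : SpaceTime) R).indicator 1 x := setLIntegral_le_lintegral _ _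
      _ < ⊤ := by rw [lintegral_indicator_one hmB]; exact measure_ball_lt_top
  by_contra hcon
  rw [not_lt, top_le_iff] at hcon
  rw [hcon, ENNReal.mul_top coneConst_ne_zero] at h2
  exact lt_irrefl _ h2

/-! ### Lorentz symmetries of σ and of the extension operator. -/

/-- The coordinates `(τ, ξ₁, ξ₂)`. -/
noncomputable def coords (z : SpaceTime) : Fin 3 → ℝ := ![z.1, z.2 0, z.2 1]

/-- The linear map of space-time with a given matrix. -/
noncomputable def matrixMap (m : Matrix (Fin 3) (Fin 3) ℝ) : SpaceTime →ₗ[ℝ] SpaceTime where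
  toFun z := (m.mulVec (coords z) 0, !₂[m.mulVec (coords z) 1, m.mulVec (coords z) 2])
  map_add' x y := by
    have : coords (x + y) = coords x + coords y := by
      ext i; fin_cases i <;> simp [coords]
    rw [this, Matrix.mulVec_add]
    ext i
    · rfl
    · fin_cases i <;> simp
  map_smul' c x := by
    have : coords (c • x) = c • coords x := by
      ext i; fin_cases i <;> simp [coords]
    rw [this, Matrix.mulVec_smul]
    ext i
    · rfl
    · fin_cases i <;> simp

lemma coords_matrixMap (m : Matrix (Fin 3) (Fin 3) ℝ) (z : SpaceTime) :
    coords (matrixMap m z) = m.mulVec (coords z) := by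
  ext i; fin_cases i <;> simp [coords, matrixMap]

lemma coords_injective : Function.Injective coords := by
  intro x y h
  have h0 := congrFun h 0
  have h1 := congrFun h 1
  have h2 := congrFun h 2
  simp only [coords, Matrix.cons_val] at h0 h1 h2
  ext i
  · exact h0
  · fin_cases i
    · exact h1
    · exact h2

lemma matrixMap_mul (m n : Matrix (Fin 3) (Fin 3) ℝ) :
    matrixMap (m * n) = matrixMap m ∘ₗ matrixMap n := by
  refine LinearMap.ext fun z => coords_injective ?_
  rw [LinearMap.comp_apply]
  simp only [coords_matrixMap, Matrix.mulVec_mulVec]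

lemma matrixMap_one : matrixMap 1 = LinearMap.id := by
  refine LinearMap.ext fun z => coords_injective ?_
  simp [coords_matrixMap]

lemma pairing_eq_dotProduct (y z : SpaceTime) : pairing y z = coords y ⬝ᵥ coords z := by
  simp [pairing, coords, PiLp.inner_apply, dotProduct, Fin.sum_univ_succ, mul_comm]

lemma pairing_matrixMap (m : Matrix (Fin 3) (Fin 3) ℝ) (y z : SpaceTime) :
    pairing y (matrixMap m z) = pairing (matrixMap m.transpose y) z := by
  rw [pairing_eq_dotProduct, pairing_eq_dotProduct, coords_matrixMap, coords_matrixMap,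
    Matrix.dotProduct_mulVec, Matrix.mulVec_transpose]

lemma measurePreserving_matrixMap {m : Matrix (Fin 3) (Fin 3) ℝ} (hm : m * m = 1) :
    MeasurePreserving (matrixMap m) (volume : Measure SpaceTime) volume := by
  have h1 : LinearMap.det (matrixMap m) * LinearMap.det (matrixMap m) = 1 := by
    rw [← LinearMap.det_comp, ← matrixMap_mul, hm, matrixMap_one, LinearMap.det_id]
  have h0 : LinearMap.det (matrixMap m) ≠ 0 := by
    intro h; simp [h] at h1
  refine ⟨(LinearMap.continuous_of_finiteDimensional _).measurable, ?_⟩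
  rw [Measure.map_linearMap_addHaar_eq_smul_addHaar _ h0]
  have : |(LinearMap.det (matrixMap m))⁻¹| = 1 := by
    rcases mul_self_eq_one_iff.1 h1 with h | h <;> simp [h]
  rw [this]; simp

/-- Involutive Lorentz matrices. -/
structure IsLorentzInvolution (m : Matrix (Fin 3) (Fin 3) ℝ) : Prop where
  mul_self : m * m = 1
  lorentz_eq : ∀ z, lorentz (matrixMap m z) = lorentz z

namespace IsLorentzInvolution
variable {m : Matrix (Fin 3) (Fin 3) ℝ}

lemma measurable (_ : IsLorentzInvolution m) : Measurable (matrixMap m) :=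
  (LinearMap.continuous_of_finiteDimensional _).measurable

lemma apply_apply (h : IsLorentzInvolution m) (z : SpaceTime) :
    matrixMap m (matrixMap m z) = z := by
  rw [← LinearMap.comp_apply, ← matrixMap_mul, h.mul_self, matrixMap_one, LinearMap.id_apply]

lemma measurePreserving_transpose (h : IsLorentzInvolution m) :
    MeasurePreserving (matrixMap m.transpose) (volume : Measure SpaceTime) volume :=
  measurePreserving_matrixMap (by rw [← Matrix.transpose_mul, h.mul_self, Matrix.transpose_one])

/-- The map preserves Lebesgue measure and the Lorentz form, hence the cone integral that represents
σ. -/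
lemma lintegral_comp (h : IsLorentzInvolution m) {g : SpaceTime → ℝ≥0∞} (hg : Measurable g) :
    ∫⁻ z, g (matrixMap m z) ∂sigma = ∫⁻ z, g z ∂sigma := by
  have hl := continuous_lorentz.measurable
  have hms : MeasurableSet {x | 0 < lorentz x ∧ lorentz x < 1} :=
    (measurableSet_lt measurable_const hl).inter (measurableSet_lt hl measurable_const)
  have hG : Measurable fun x => g ((√(lorentz x))⁻¹ • x) := hg.comp (by fun_prop)
  refine (ENNReal.mul_right_inj coneConst_ne_zero coneConst_ne_top).1 ?_
  rw [← lintegral_cone hg, ← lintegral_cone (g := fun z => g (matrixMap m z)) (hg.comp h.measurable),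
    ← (measurePreserving_matrixMap h.mul_self).setLIntegral_comp_preimage hms hG]
  simp [Set.preimage, h.lorentz_eq]

lemma measurePreserving_sigma (h : IsLorentzInvolution m) :
    MeasurePreserving (matrixMap m) sigma sigma := by
  refine ⟨h.measurable, ?_⟩
  ext s hs
  rw [Measure.map_apply h.measurable hs, ← lintegral_indicator_one hs,
    ← h.lintegral_comp (measurable_one.indicator hs),
    ← lintegral_indicator_one (h.measurable hs)]
  rfl

lemma measurableEmbedding (h : IsLorentzInvolution m) : MeasurableEmbedding (matrixMap m) :=
  (MeasurableEquiv.mk ⟨matrixMap m, matrixMap m, h.apply_apply, h.apply_apply⟩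
    h.measurable h.measurable).measurableEmbedding

/-- A change of frequency variables by m acts on the physical side by the transpose. -/
lemma extension_eq (h : IsLorentzInvolution m) (f : SpaceTime → ℂ) (y : SpaceTime) :
    extension f y = extension (f ∘ matrixMap m) (matrixMap m.transpose y) := by
  unfold extension
  rw [← h.measurePreserving_sigma.integral_comp h.measurableEmbedding]
  simp only [pairing_matrixMap, Function.comp_apply]

end IsLorentzInvolution

/-! ### Covering the hyperboloid by images of the sectors. -/

/-- The extension estimate for functions supported in `S`. -/
def Admissible (p q : ℝ≥0∞) (S : Set SpaceTime) : Prop :=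
  ∃ C : ℝ≥0, ∀ f : SpaceTime → ℂ, Measurable f → Integrable f sigma → Function.support f ⊆ S →
    eLpNorm (extension f) q volume ≤ C * eLpNorm f p sigma

namespace Admissible
variable {p q : ℝ≥0∞} {S T : Set SpaceTime}

lemma mono (hT : Admissible p q T) (h : S ⊆ T) : Admissible p q S :=
  let ⟨C, hC⟩ := hT
  ⟨C, fun f hf hi hs => hC f hf hi (hs.trans h)⟩

lemma preimage (hT : Admissible p q T) {m : Matrix (Fin 3) (Fin 3) ℝ}
    (h : IsLorentzInvolution m) : Admissible p q (matrixMap m ⁻¹' T) := by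
  obtain ⟨C, hC⟩ := hT
  refine ⟨C, fun f hf hi hs => ?_⟩
  have h1 := hC (f ∘ matrixMap m) (hf.comp h.measurable)
    ((h.measurePreserving_sigma.integrable_comp hi.aestronglyMeasurable).2 hi) (fun z hz => by
      have := hs (show matrixMap m z ∈ Function.support f from hz)
      rwa [Set.mem_preimage, h.apply_apply] at this)
  rw [eLpNorm_comp_measurePreserving hi.aestronglyMeasurable h.measurePreserving_sigma] at h1
  rw [show extension f = extension (f ∘ matrixMap m) ∘ matrixMap m.transpose from
    funext (h.extension_eq f), eLpNorm_comp_measurePreserving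
    (measurable_extension (hf.comp h.measurable)).aestronglyMeasurable
    h.measurePreserving_transpose]
  exact h1

lemma union (hq : 1 ≤ q) (hS : Admissible p q S) (hT : Admissible p q T) (hm : MeasurableSet S) :
    Admissible p q (S ∪ T) := by
  obtain ⟨C, hC⟩ := hS
  obtain ⟨D, hD⟩ := hT
  refine ⟨C + D, fun f hf hi hs => ?_⟩
  have e : f = S.indicator f + Sᶜ.indicator f := (Set.indicator_self_add_compl S f).symm
  have e2 : extension f = extension (S.indicator f) + extension (Sᶜ.indicator f) := by
    conv_lhs => rw [e]
    exact funext fun y => extension_add (hi.indicator hm) (hi.indicator hm.compl) y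
  have h1 := hC (S.indicator f) (hf.indicator hm) (hi.indicator hm) Set.support_indicator_subset
  have h2 := hD (Sᶜ.indicator f) (hf.indicator hm.compl) (hi.indicator hm.compl) (by
    rw [Set.support_indicator]
    rintro z ⟨hz, hz'⟩
    exact (hs hz').resolve_left hz)
  rw [e2]
  refine (eLpNorm_add_le (measurable_extension (hf.indicator hm)).aestronglyMeasurable
    (measurable_extension (hf.indicator hm.compl)).aestronglyMeasurable hq).trans ?_
  rw [ENNReal.coe_add, add_mul]
  refine add_le_add (h1.trans ?_) (h2.trans ?_)
  · gcongr; exact eLpNorm_indicator_le f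
  · gcongr; exact eLpNorm_indicator_le f

lemma univ_of_hyperboloid (h : Admissible p q hyperboloid) : Admissible p q Set.univ := by
  obtain ⟨C, hC⟩ := h
  refine ⟨C, fun f hf hi _ => ?_⟩
  have hae : hyperboloid.indicator f =ᵐ[sigma] f := by
    filter_upwards [ae_mem_hyperboloid] with z hz
    exact Set.indicator_of_mem hz f
  have h1 := hC (hyperboloid.indicator f) (hf.indicator measurableSet_hyperboloid)
    (hi.indicator measurableSet_hyperboloid) Set.support_indicator_subset
  rw [eLpNorm_congr_ae hae] at h1
  have : extension (hyperboloid.indicator f) = extension f := by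
    ext1 y
    refine integral_congr_ae ?_
    filter_upwards [hae] with z hz
    rw [hz]
  rwa [this] at h1

end Admissible

lemma lorentz_eq (z : SpaceTime) : lorentz z = z.2 0 ^ 2 + z.2 1 ^ 2 - z.1 ^ 2 := by
  rw [lorentz, norm_sq_plane]

def reflectTime : Matrix (Fin 3) (Fin 3) ℝ := !![-1, 0, 0; 0, 1, 0; 0, 0, 1]

def reflectSpace : Matrix (Fin 3) (Fin 3) ℝ := !![1, 0, 0; 0, -1, 0; 0, 0, -1]

def swapSpace : Matrix (Fin 3) (Fin 3) ℝ := !![1, 0, 0; 0, 0, 1; 0, 1, 0]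

/-- A boost in the `ξ₁` direction composed with the time reflection. -/
noncomputable def boost (s : ℝ) : Matrix (Fin 3) (Fin 3) ℝ :=
  !![-(25 / 7), s, 0; -s, 25 / 7, 0; 0, 0, 1]

lemma matrixMap_fst (m : Matrix (Fin 3) (Fin 3) ℝ) (z : SpaceTime) :
    (matrixMap m z).1 = m 0 0 * z.1 + m 0 1 * z.2 0 + m 0 2 * z.2 1 := by
  simp [matrixMap, coords, Matrix.mulVec, dotProduct, Fin.sum_univ_three]

lemma matrixMap_snd_zero (m : Matrix (Fin 3) (Fin 3) ℝ) (z : SpaceTime) :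
    (matrixMap m z).2 0 = m 1 0 * z.1 + m 1 1 * z.2 0 + m 1 2 * z.2 1 := by
  simp [matrixMap, coords, Matrix.mulVec, dotProduct, Fin.sum_univ_three]

lemma matrixMap_snd_one (m : Matrix (Fin 3) (Fin 3) ℝ) (z : SpaceTime) :
    (matrixMap m z).2 1 = m 2 0 * z.1 + m 2 1 * z.2 0 + m 2 2 * z.2 1 := by
  simp [matrixMap, coords, Matrix.mulVec, dotProduct, Fin.sum_univ_three]

lemma isLorentzInvolution_reflectTime : IsLorentzInvolution reflectTime := by
  refine ⟨?_, fun z => ?_⟩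
  · ext i j; fin_cases i <;> fin_cases j <;> simp [reflectTime]
  · rw [lorentz_eq, lorentz_eq, matrixMap_fst, matrixMap_snd_zero, matrixMap_snd_one]
    simp [reflectTime]

lemma isLorentzInvolution_reflectSpace : IsLorentzInvolution reflectSpace := by
  refine ⟨?_, fun z => ?_⟩
  · ext i j; fin_cases i <;> fin_cases j <;> simp [reflectSpace]
  · rw [lorentz_eq, lorentz_eq, matrixMap_fst, matrixMap_snd_zero, matrixMap_snd_one]
    simp [reflectSpace]

lemma isLorentzInvolution_swapSpace : IsLorentzInvolution swapSpace := by
  refine ⟨?_, fun z => ?_⟩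
  · ext i j; fin_cases i <;> fin_cases j <;> simp [swapSpace]
  · rw [lorentz_eq, lorentz_eq, matrixMap_fst, matrixMap_snd_zero, matrixMap_snd_one]
    simp [swapSpace, add_comm]

lemma isLorentzInvolution_boost {s : ℝ} (hs : s ^ 2 = 576 / 49) :
    IsLorentzInvolution (boost s) := by
  refine ⟨?_, fun z => ?_⟩
  · ext i j
    fin_cases i <;> fin_cases j <;> simp [boost] <;> linarith
  · rw [lorentz_eq, lorentz_eq, matrixMap_fst, matrixMap_snd_zero, matrixMap_snd_one]
    simp [boost]
    linear_combination (z.1 ^ 2 - z.2 0 ^ 2) * hs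

lemma mem_sectors_of_pos {z : SpaceTime} (hz : z ∈ hyperboloid) (h0 : 0 < z.1)
    (h2 : 2 ≤ ‖z.2‖) (hs : |z.2 1| ≤ z.2 0) : ∃ N : ℕ, 1 ≤ N ∧ z ∈ sector N := by
  obtain ⟨N, hN, hN'⟩ := exists_nat_pow_near (by linarith : (1 : ℝ) ≤ ‖z.2‖) one_lt_two
  refine ⟨N, ?_, hz, h0, hN, hN', hs⟩
  by_contra hcon
  have : N = 0 := by omega
  subst this
  norm_num at hN'
  linarith

lemma two_le_norm_iff {ξ : Plane} : 2 ≤ ‖ξ‖ ↔ 4 ≤ ξ 0 ^ 2 + ξ 1 ^ 2 := by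
  rw [← norm_sq_plane]
  constructor
  · intro h; nlinarith
  · intro h; nlinarith [norm_nonneg ξ]

lemma IsLorentzInvolution.mem_hyperboloid {m : Matrix (Fin 3) (Fin 3) ℝ}
    (h : IsLorentzInvolution m) {z : SpaceTime} (hz : z ∈ hyperboloid) :
    matrixMap m z ∈ hyperboloid := by
  rwa [mem_hyperboloid_iff, h.lorentz_eq, ← mem_hyperboloid_iff]

/-- An estimate on the dyadic sectors extends by symmetry to the whole hyperboloid. -/
lemma Admissible.univ_of_sectors {p q : ℝ≥0∞} (hq : 1 ≤ q)
    (h : Admissible p q {z | ∃ N : ℕ, 1 ≤ N ∧ z ∈ sector N}) : Admissible p q Set.univ := by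
  have msum : ∀ {S : Set SpaceTime} {m : Matrix (Fin 3) (Fin 3) ℝ}, MeasurableSet S →
      IsLorentzInvolution m → MeasurableSet (S ∪ matrixMap m ⁻¹' S) :=
    fun hS hm => hS.union (hm.measurable hS)
  have hT := isLorentzInvolution_reflectTime
  have hR := isLorentzInvolution_reflectSpace
  have hW := isLorentzInvolution_swapSpace
  -- The values 25/7 and 24/7 are a rational hyperbolic cosine and sine; any s² ≥ 6 would be strong
  -- enough for the covering below.
  have hB := isLorentzInvolution_boost (s := 24 / 7) (by norm_num)
  have hB' := isLorentzInvolution_boost (s := -(24 / 7)) (by norm_num)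
  set S0 := {z : SpaceTime | ∃ N : ℕ, 1 ≤ N ∧ z ∈ sector N} with hS0
  have m0 : MeasurableSet S0 := by
    have : S0 = ⋃ N : ℕ, ⋃ _ : 1 ≤ N, sector N := by ext z; simp [hS0]
    rw [this]
    exact MeasurableSet.iUnion fun N => MeasurableSet.iUnion fun _ => measurableSet_sector N
  -- the exterior of the disk of radius two
  have h3 : Admissible p q {z | z ∈ hyperboloid ∧ 2 ≤ ‖z.2‖} := by
    have a1 := h.union hq (h.preimage hT) m0
    have m1 := msum m0 hT
    have a2 := a1.union hq (a1.preimage hR) m1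
    have m2 := msum m1 hR
    refine (a2.union hq (a2.preimage hW) m2).mono ?_
    have c1 : ∀ z ∈ hyperboloid, 2 ≤ ‖z.2‖ → |z.2 1| ≤ z.2 0 →
        z ∈ S0 ∪ matrixMap reflectTime ⁻¹' S0 := by
      intro z hz h2 hs
      rcases lt_trichotomy 0 z.1 with h0 | h0 | h0
      · exact Or.inl (mem_sectors_of_pos hz h0 h2 hs)
      · have : 1 + z.1 ^ 2 = ‖z.2‖ ^ 2 := hz
        rw [← h0] at this
        nlinarith
      · refine Or.inr (mem_sectors_of_pos (hT.mem_hyperboloid hz) ?_ ?_ ?_)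
        · rw [matrixMap_fst]; simpa [reflectTime] using h0
        · rw [two_le_norm_iff] at h2 ⊢
          rw [matrixMap_snd_zero, matrixMap_snd_one]; simpa [reflectTime] using h2
        · rw [matrixMap_snd_zero, matrixMap_snd_one]; simpa [reflectTime] using hs
    have c2 : ∀ z ∈ hyperboloid, 2 ≤ ‖z.2‖ → |z.2 1| ≤ |z.2 0| →
        z ∈ (S0 ∪ matrixMap reflectTime ⁻¹' S0) ∪
          matrixMap reflectSpace ⁻¹' (S0 ∪ matrixMap reflectTime ⁻¹' S0) := by
      intro z hz h2 hs
      rcases le_total 0 (z.2 0) with h0 | h0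
      · exact Or.inl (c1 z hz h2 (by rwa [abs_of_nonneg h0] at hs))
      · refine Or.inr (c1 _ (hR.mem_hyperboloid hz) ?_ ?_)
        · rw [two_le_norm_iff] at h2 ⊢
          rw [matrixMap_snd_zero, matrixMap_snd_one]; simpa [reflectSpace] using h2
        · rw [abs_of_nonpos h0] at hs
          rw [matrixMap_snd_zero, matrixMap_snd_one]; simpa [reflectSpace] using hs
    rintro z ⟨hz, h2⟩
    rcases le_total |z.2 1| |z.2 0| with hs | hs
    · exact Or.inl (c2 z hz h2 hs)
    · refine Or.inr (c2 _ (hW.mem_hyperboloid hz) ?_ ?_)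
      · rw [two_le_norm_iff] at h2 ⊢
        rw [matrixMap_snd_zero, matrixMap_snd_one]; simpa [swapSpace, add_comm] using h2
      · rw [matrixMap_snd_zero, matrixMap_snd_one]; simpa [swapSpace] using hs
  set S3 := {z : SpaceTime | z ∈ hyperboloid ∧ 2 ≤ ‖z.2‖} with hS3
  have m3 : MeasurableSet S3 :=
    measurableSet_hyperboloid.inter (measurableSet_le measurable_const measurable_snd.norm)
  have a4 := (h3.preimage hB).union hq (h3.preimage hB') (hB.measurable m3)
  have m4 := (hB.measurable m3).union (hB'.measurable m3)
  have a5 := a4.union hq (a4.preimage hW) m4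
  refine Admissible.univ_of_hyperboloid (a5.mono fun z hz => ?_)
  -- a point outside all boosted exteriors would lie in the unit disk
  have key : ∀ z ∈ hyperboloid, z ∉ matrixMap (boost (24 / 7)) ⁻¹' S3 ∪
      matrixMap (boost (-(24 / 7))) ⁻¹' S3 → z.2 0 ^ 2 < 147 / 576 := by
    intro z hz hn
    have aux : ∀ w ∈ hyperboloid, w ∉ S3 → w.1 ^ 2 < 3 := by
      intro w hw hn
      by_contra hcon
      refine hn ⟨hw, ?_⟩
      have : 1 + w.1 ^ 2 = ‖w.2‖ ^ 2 := hw
      nlinarith [norm_nonneg w.2]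
    have b1 := aux _ (hB.mem_hyperboloid hz) fun h => hn (Or.inl h)
    have b2 := aux _ (hB'.mem_hyperboloid hz) fun h => hn (Or.inr h)
    rw [matrixMap_fst] at b1 b2
    simp [boost] at b1 b2
    -- Adding the two inequalities cancels the cross terms and leaves s²ξ₁² < 3. The bound 147/576
    -- is below 1/2, so imposing it on both coordinates gives |ξ| < 1.
    nlinarith [sq_nonneg z.1]
  by_contra hcon
  rw [Set.mem_union, not_or] at hcon
  have k1 := key z hz hcon.1
  have k2 := key _ (hW.mem_hyperboloid hz) hcon.2
  rw [matrixMap_snd_zero] at k2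
  simp [swapSpace] at k2
  have h1 := mem_hyperboloid_iff.1 hz
  rw [lorentz_eq] at h1
  nlinarith [sq_nonneg z.1]

/-! ### Exponents and conclusion. -/

lemma integrable_of_contDiff {f : SpaceTime → ℂ} (hf : ContDiff ℝ ∞ f)
    (hs : HasCompactSupport f) : Integrable f sigma := by
  obtain ⟨R, hR⟩ := hs.isCompact.isBounded.subset_ball 0
  obtain ⟨B, hB⟩ := hs.exists_bound_of_continuous hf.continuous
  have h1 : IntegrableOn f (Metric.ball 0 R) sigma :=
    Measure.integrableOn_of_bounded (M := B) (sigma_ball_lt_top R).ne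
      hf.continuous.aestronglyMeasurable (Filter.Eventually.of_forall hB)
  exact (integrableOn_iff_integrable_of_support_subset ((subset_tsupport f).trans hR)).1 h1

lemma GlobalExtension.one_top : GlobalExtension 1 ⊤ := by
  refine ⟨1, fun f _ _ => ?_⟩
  rw [ENNReal.coe_one, one_mul, eLpNorm_one_eq_lintegral_enorm, eLpNorm_exponent_top]
  exact eLpNormEssSup_le_of_ae_enorm_bound
    (Filter.Eventually.of_forall fun y => enorm_extension_le f y)

lemma Admissible.globalExtension {p q : ℝ≥0∞} (h : Admissible p q Set.univ) :
    GlobalExtension p q := by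
  obtain ⟨C, hC⟩ := h
  exact ⟨C, fun f hf hs => hC f hf.continuous.measurable (integrable_of_contDiff hf hs)
    (Set.subset_univ _)⟩

lemma admissible_of_lintegral {p q : ℝ} (hp : 0 < p) (hq : 0 < q) {K : ℝ≥0∞}
    (hK : K ≠ ⊤) {S : Set SpaceTime}
    (h : ∀ f : SpaceTime → ℂ, Measurable f → Integrable f sigma →
      (∀ z, f z ≠ 0 → z ∈ S) →
      ∫⁻ y, ‖extension f y‖ₑ ^ q ≤ K * (∫⁻ z, ‖f z‖ₑ ^ p ∂sigma) ^ (q / p)) :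
    Admissible (ENNReal.ofReal p) (ENNReal.ofReal q) S := by
  refine ⟨(K ^ q⁻¹).toNNReal, fun f hf hi hs => ?_⟩
  rw [ENNReal.coe_toNNReal (ENNReal.rpow_ne_top_of_nonneg (by positivity) hK),
    eLpNorm_eq_lintegral_rpow_enorm_toReal (by simpa using hq) ENNReal.ofReal_ne_top,
    eLpNorm_eq_lintegral_rpow_enorm_toReal (by simpa using hp) ENNReal.ofReal_ne_top,
    ENNReal.toReal_ofReal hp.le, ENNReal.toReal_ofReal hq.le]
  refine (ENNReal.rpow_le_rpow (h f hf hi fun z hz => hs hz) (by positivity)).trans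
    (le_of_eq ?_)
  rw [ENNReal.mul_rpow_of_nonneg _ _ (by positivity), ← ENNReal.rpow_mul, one_div]
  congr 2
  field_simp

/-- The exponents of the annular hypothesis are finite, and their scaling exponent
`β = q₀ / p₀'` satisfies `2 ≤ β ≤ q₀ - 1`. -/
lemma exponent_bounds {p₀ q₀ : ℝ≥0∞} (hq : q₀ ≠ ⊤) (hp₀ : (q₀ / 2).conjExponent ≤ p₀)
    (hpq₀ : p₀ ≤ q₀) : 1 < p₀.toReal ∧ p₀ ≠ ⊤ ∧
      2 ≤ q₀.toReal * (1 - p₀.toReal⁻¹) ∧ q₀.toReal * (1 - p₀.toReal⁻¹) + 1 ≤ q₀.toReal := by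
  have hp : p₀ ≠ ⊤ := ne_top_of_le_ne_top hq hpq₀
  lift q₀ to ℝ≥0 using hq
  lift p₀ to ℝ≥0 using hp
  -- If q₀ ≤ 2, the conjugate exponent of q₀/2 evaluates to ∞, which would force p₀ = q₀ = ∞.
  have hq2 : (1 : ℝ≥0∞) < q₀ / 2 := by
    by_contra hcon
    rw [ENNReal.conjExponent, tsub_eq_zero_of_le (not_lt.1 hcon)] at hp₀
    simp at hp₀
  have hdiv : (q₀ : ℝ≥0∞) / 2 = ((q₀ / 2 : ℝ≥0) : ℝ≥0∞) := by simp
  rw [hdiv] at hq2 hp₀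
  have hq2' : 1 < q₀ / 2 := by exact_mod_cast hq2
  rw [← ENNReal.coe_conjExponent hq2', ENNReal.coe_le_coe, NNReal.conjExponent] at hp₀
  rw [ENNReal.coe_le_coe] at hpq₀
  rw [← NNReal.coe_le_coe] at hp₀ hpq₀
  rw [← NNReal.coe_lt_coe] at hq2'
  rw [NNReal.coe_div, NNReal.coe_sub hq2'.le] at hp₀
  push_cast at hp₀ hq2'
  simp only [ENNReal.coe_toReal]
  set Q := (q₀ : ℝ)
  set P := (p₀ : ℝ)
  have hQ : 0 < Q / 2 - 1 := by linarith
  rw [div_le_iff₀ hQ] at hp₀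
  have hP : 1 < P := by nlinarith
  refine ⟨hP, ENNReal.coe_ne_top, ?_, ?_⟩
  · have : Q * (1 - P⁻¹) = Q * (P - 1) / P := by field_simp
    rw [this, le_div_iff₀ (by linarith)]
    linarith
  · have : 1 ≤ Q * P⁻¹ := by
      rw [← div_eq_mul_inv, le_div_iff₀ (by linarith)]; linarith
    linarith

/-- On the scaling line, `1 / p = 1 - β / q`. -/
lemma scaling_line {p₀ q₀ p q : ℝ≥0∞} (hP : 1 < p₀.toReal) (hp₀ : p₀ ≠ ⊤)
    (hq₀ : 0 < q₀.toReal) (hp : 1 ≤ p)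
    (hlt : q₀.toReal * (1 - p₀.toReal⁻¹) < q.toReal)
    (hpq : p.conjExponent = p₀.conjExponent / q₀ * q) :
    p ≠ ⊤ ∧ 1 < p.toReal ∧ q.toReal - q₀.toReal * (1 - p₀.toReal⁻¹) = q.toReal / p.toReal := by
  have hR : (p₀.conjExponent / q₀ * q).toReal =
      q.toReal / (q₀.toReal * (1 - p₀.toReal⁻¹)) := by
    lift p₀ to ℝ≥0 using hp₀
    have h1 : 1 < p₀ := by exact_mod_cast hP
    rw [← ENNReal.coe_conjExponent h1, ENNReal.toReal_mul, ENNReal.toReal_div, ENNReal.coe_toReal,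
      ENNReal.coe_toReal, NNReal.conjExponent, NNReal.coe_div, NNReal.coe_sub h1.le,
      NNReal.coe_one]
    have : (p₀ : ℝ) - 1 ≠ 0 := by simpa [sub_eq_zero] using h1.ne'
    have : (p₀ : ℝ) ≠ 0 := by positivity
    field_simp
  set β := q₀.toReal * (1 - p₀.toReal⁻¹) with hβ
  have hβ0 : 0 < β := mul_pos hq₀ (sub_pos.2 (inv_lt_one_of_one_lt₀ hP))
  have htop : p₀.conjExponent / q₀ * q ≠ ⊤ := by
    intro h
    rw [h, ENNReal.toReal_top] at hR
    have : 0 < q.toReal / β := div_pos (hβ0.trans hlt) hβ0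
    linarith
  have hgt : 1 < q.toReal / β := by rwa [one_lt_div hβ0]
  -- The endpoints are excluded because p' = q/β is finite and greater than 1.
  have hp1 : p ≠ 1 := by
    rintro rfl
    rw [← hpq] at htop
    simp [ENNReal.conjExponent] at htop
  have hpt : p ≠ ⊤ := by
    rintro rfl
    rw [← hpq] at hR
    simp [ENNReal.conjExponent] at hR
    linarith
  have hp1' : 1 < p := lt_of_le_of_ne hp hp1.symm
  refine ⟨hpt, ?_, ?_⟩
  · rw [← ENNReal.toReal_one]; exact (ENNReal.toReal_lt_toReal ENNReal.one_ne_top hpt).2 hp1'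
  lift p to ℝ≥0 using hpt
  have h1 : 1 < p := by exact_mod_cast hp1'
  have h1' : 0 < (p : ℝ) - 1 := by
    have : (1 : ℝ) < p := by exact_mod_cast h1
    linarith
  rw [← hpq, ← ENNReal.coe_conjExponent h1, ENNReal.coe_toReal, NNReal.conjExponent,
    NNReal.coe_div, NNReal.coe_sub h1.le, NNReal.coe_one, div_eq_div_iff h1'.ne' hβ0.ne'] at hR
  rw [ENNReal.coe_toReal]
  have : (p : ℝ) ≠ 0 := by linarith
  field_simp
  linarith

end HypHyp

theorem lemma8p1 (p₀ q₀ : ℝ≥0∞)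
    (hp₀ : (q₀ / 2).conjExponent ≤ p₀) (hpq₀ : p₀ ≤ q₀)
    (hann : HypHyp.AnnularExtension p₀ q₀)
    (p q : ℝ≥0∞) (hp : 1 ≤ p) (hq : q₀ < q)
    (hpq : p.conjExponent = p₀.conjExponent / q₀ * q) :
    HypHyp.GlobalExtension p q := by
  have hq₀ : q₀ ≠ ⊤ := hq.ne_top
  obtain ⟨hP, hp₀t, hβ2, hβQ⟩ := HypHyp.exponent_bounds hq₀ hp₀ hpq₀
  have hQ : 0 < q₀.toReal := by linarith
  -- Here p' = ∞, and the trivial L¹ to L^∞ bound applies.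
  by_cases hqt : q = ⊤
  · have hp1 : p = 1 := by
      have h0 : p₀.conjExponent / q₀ ≠ 0 := by
        simp [ENNReal.conjExponent, hq₀]
      rw [hqt, ENNReal.mul_top h0, ENNReal.conjExponent, ENNReal.add_eq_top] at hpq
      have h1 : p - 1 = 0 := by simpa using hpq
      exact le_antisymm (tsub_eq_zero_iff_le.1 h1) hp
    rw [hp1, hqt]
    exact HypHyp.GlobalExtension.one_top
  have hqQ : q₀.toReal < q.toReal := (ENNReal.toReal_lt_toReal hq₀ hqt).2 hq
  obtain ⟨hpt, hp1, hline⟩ := HypHyp.scaling_line hP hp₀t hQ hp (by linarith) hpq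
  have hp₀0 : p₀ ≠ 0 := by rintro rfl; norm_num at hP
  have hq₀0 : q₀ ≠ 0 := by rintro rfl; norm_num at hQ
  obtain ⟨C, hC, hA⟩ := HypHyp.annular_moment hann hp₀0 hp₀t hq₀0 hq₀
  have hβ3 := HypHyp.scaling_condition hQ hC (by linarith) hA
  -- q/p = q − β > q₀ − β ≥ 1; the last inequality is p₀ ≤ q₀ in terms of β.
  have hpq' : p.toReal ≤ q.toReal := by
    have h1 : 1 ≤ q.toReal / p.toReal := by linarith
    rwa [one_le_div (by linarith)] at h1
  obtain ⟨K, hK, hKf⟩ := HypHyp.sector_extension hβ2 hβ3 hQ hqQ hC (by linarith) hpq' hline hA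
  have hadm := HypHyp.admissible_of_lintegral (by linarith) (by linarith) hK hKf
  rw [ENNReal.ofReal_toReal hpt, ENNReal.ofReal_toReal hqt] at hadm
  have hq1 : 1 ≤ q := by
    rw [← ENNReal.ofReal_toReal hqt, ENNReal.one_le_ofReal]
    linarith
  exact (hadm.univ_of_sectors hq1).globalExtension
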